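/- Let $d\ge 1$, let $X\neq\{0\}$ be a complex Banach space, $1<p_0\le p_1<\infty$, $q_0,q_1\in[1,\infty]$, $s_0,s_1\in\mathbb R$, and $w_0(x)=|x|^{\gamma_0}$, $w_1(x)=|x|^{\gamma_1}$ on $\mathbb R^d$ with $\gamma_0,\gamma_1>-d$. Let $\widehat\varphi(\xi)=(2\pi)^{-d/2}\int_{\mathbb R^d}e^{-ix\cdot\xi}\varphi(x)\,dx$ and let $(\varphi_k)_{k\ge0}$ be Schwartz functions on $\mathbb R^d$ with $0\le\widehat\varphi_0\le1$, $\widehat\varphi_0(\xi)=1$ for $|\xi|\le1$, $\widehat\varphi_0(\xi)=0$ for $|\xi|\ge\frac32$, and $\widehat\varphi_k(\xi)=\widehat\varphi_0(2^{-k}\xi)-\widehat\varphi_0(2^{-k+1}\xi)$ for $k\ge1$. For an $X$-valued tempered distribution $f$ let $S_kf$ be the smooth function $\mathcal F^{-1}[\widehat\varphi_k\widehat f]$. For $1<p<\infty$, $q\in[1,\infty]$, $s\in\mathbb R$ and $w(x)=|x|^\gamma$ with $\gamma>-d$, the weighted Triebel–Lizorkin space $F^{s}_{p,q}(\mathbb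 R^d,w;X)$ consists of all $f\in\mathscr S'(\mathbb R^d;X)$ with $$\|f\|_{F^s_{p,q}(\mathbb R^d,w;X)}=\Big(\int_{\mathbb R^d}\big\|(2^{ks}S_kf(x))_{k\ge0}\big\|_{\ell^q(X)}^p\,w(x)\,dx\Big)^{1/p}<\infty .$$ Then the following assertions are equivalent: (1) One has the continuous embedding $F^{s_0}_{p_0,q_0}(\mathbb R^d,w_0;X)\hookrightarrow F^{s_1}_{p_1,q_1}(\mathbb R^d,w_1;X)$, i.e. the first space is contained in the second and there is a constant $C$ such that $\|f\|_{F^{s_1}_{p_1,q_1}(\mathbb R^d,w_1;X)}\le C\|f\|_{F^{s_0}_{p_0,q_0}(\mathbb R^d,w_0;X)}$ for all $f$ in the first space. (2) Either $$\gamma_0=\gamma_1,\quad p_0=p_1,\quad\text{and either } s_0>s_1,\ \text{ or } s_0=s_1 \text{ and } q_0\le q_1,$$ or $$\frac{\gamma_1}{p_1}\le\frac{\gamma_0}{p_0},\qquad \frac{d+\gamma_1}{p_1}<\frac{d+\gamma_0}{p_0}\qquad\text{and}\qquad s_0-\frac{d+\gamma_0}{p_0}\ge s_1-\frac{d+\gamma_1}{p_1}.$$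 -/

import Mathlib

open MeasureTheory
open scoped ENNReal NNReal SchwartzMap

noncomputable section

namespace WeightedTL

/-- The Euclidean space `ℝ^d`. -/
abbrev Rd (d : ℕ) : Type := EuclideanSpace ℝ (Fin d)

/-- The unitary Fourier transform in the angular frequency,
`(2π)^{-d/2} ∫ e^{-i x⋅ξ} φ(x) dx`. -/
def fourierHat {d : ℕ} (φ : 𝓢(Rd d, ℂ)) (ξ : Rd d) : ℂ :=
  (((2 * Real.pi) ^ (-(d : ℝ) / 2) : ℝ) : ℂ) *
    ∫ x : Rd d, Complex.exp (-(Complex.I * ((inner ℝ x ξ : ℝ) : ℂ))) * φ x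

/-- The dyadic resolutions `(φ_k)_{k ≥ 0}`: the Fourier transform `m` of `φ_0` takes values in
`[0,1]`, equals `1` on `|ξ| ≤ 1` and `0` on `|ξ| ≥ 3/2`, and for `k ≥ 1` the Fourier transform of
`φ_k` is `m(2^{-k} ξ) - m(2^{-k+1} ξ)`. -/
structure IsDyadicResolution {d : ℕ} (φ : ℕ → 𝓢(Rd d, ℂ)) : Prop where
  mem_Icc : ∀ ξ, ∃ r ∈ Set.Icc (0 : ℝ) 1, fourierHat (φ 0) ξ = (r : ℂ)
  eq_one : ∀ ξ : Rd d, ‖ξ‖ ≤ 1 → fourierHat (φ 0) ξ = 1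
  eq_zero : ∀ ξ : Rd d, 3 / 2 ≤ ‖ξ‖ → fourierHat (φ 0) ξ = 0
  succ : ∀ (k : ℕ) (ξ : Rd d), fourierHat (φ (k + 1)) ξ =
    fourierHat (φ 0) (((2 : ℝ) ^ (k + 1))⁻¹ • ξ) - fourierHat (φ 0) (((2 : ℝ) ^ k)⁻¹ • ξ)

/-- The Schwartz function `y ↦ φ (x - y)`. -/
def reflectTranslate {d : ℕ} (φ : 𝓢(Rd d, ℂ)) (x : Rd d) : 𝓢(Rd d, ℂ) :=
  SchwartzMap.compSubConstCLM ℂ x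
    (SchwartzMap.compCLMOfContinuousLinearEquiv ℂ (ContinuousLinearEquiv.neg ℝ) φ)

theorem reflectTranslate_apply {d : ℕ} (φ : 𝓢(Rd d, ℂ)) (x y : Rd d) :
    reflectTranslate φ x y = φ (x - y) := by
  simp [reflectTranslate]

/-- The smooth function representing the tempered distribution with Fourier transform `φ̂ f̂`.
The Fourier transform being the unitary one, this is the convolution `x ↦ f (φ (x - ⋅))` times
`(2π)^{-d/2}`. -/
def fourierCutoff {d : ℕ} {X : Type*} [NormedAddCommGroup X] [NormedSpace ℂ X]
    (φ : 𝓢(Rd d, ℂ)) (f : 𝓢'(Rd d, X)) (x : Rd d) : X :=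
  ((2 * Real.pi) ^ (-(d : ℝ) / 2) : ℝ) • f (reflectTranslate φ x)

/-- The power weight `x ↦ |x|^γ`. -/
def powerWeight (d : ℕ) (γ : ℝ) (x : Rd d) : ℝ := ‖x‖ ^ γ

/-- The (extended) norm of `L^p(ℝ^d, w; ℓ^q(X))` of the sequence `(2^{ks} S_k f)_{k ≥ 0}`, where
`S_k f` is the function with Fourier transform `φ̂_k f̂`. -/
def tlNorm {d : ℕ} {X : Type*} [NormedAddCommGroup X] [NormedSpace ℂ X]
    (φ : ℕ → 𝓢(Rd d, ℂ)) (s p : ℝ) (q : ℝ≥0∞) (w : Rd d → ℝ) (f : 𝓢'(Rd d, X)) : ℝ≥0∞ :=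
  eLpNorm
    (fun x : Rd d => eLpNorm
      (fun k : ℕ => (2 : ℝ) ^ ((k : ℝ) * s) • fourierCutoff (φ k) f x) q Measure.count)
    (ENNReal.ofReal p) (volume.withDensity fun x => ENNReal.ofReal (w x))

/-- The weighted Triebel–Lizorkin space `F^s_{p,q}(ℝ^d, w; X)`, with respect to the dyadic
resolution `φ`. -/
def tlSpace {d : ℕ} (X : Type*) [NormedAddCommGroup X] [NormedSpace ℂ X]
    (φ : ℕ → 𝓢(Rd d, ℂ)) (s p : ℝ) (q : ℝ≥0∞) (w : Rd d → ℝ) : Set 𝓢'(Rd d, X) :=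
  {f | tlNorm φ s p q w f < ∞}

/-- The continuous embedding
`F^{s₀}_{p₀,q₀}(ℝ^d, w₀; X) ↪ F^{s₁}_{p₁,q₁}(ℝ^d, w₁; X)`. -/
def TLEmbedding {d : ℕ} (X : Type*) [NormedAddCommGroup X] [NormedSpace ℂ X]
    (φ : ℕ → 𝓢(Rd d, ℂ)) (s₀ p₀ : ℝ) (q₀ : ℝ≥0∞) (w₀ : Rd d → ℝ)
    (s₁ p₁ : ℝ) (q₁ : ℝ≥0∞) (w₁ : Rd d → ℝ) : Prop :=
  tlSpace X φ s₀ p₀ q₀ w₀ ⊆ tlSpace X φ s₁ p₁ q₁ w₁ ∧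
    ∃ C : ℝ≥0, ∀ f ∈ tlSpace X φ s₀ p₀ q₀ w₀,
      tlNorm φ s₁ p₁ q₁ w₁ f ≤ C * tlNorm φ s₀ p₀ q₀ w₀ f

end WeightedTL

end

noncomputable section

namespace WeightedTL

/-! ### Tempered distributions and convolutions -/

section Translations

variable {d : ℕ}

/-! Sufficiency. Only the second alternative is deep. Put `F k = 2^{k s₀} |S_k f|` and `δ =
(d+γ₀)/p₀ - (d+γ₁)/p₁`. Since `ℓ^{q₀} ↪ ℓ^∞` and `ℓ^1 ↪ ℓ^{q₁}`, it is enough to bound the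
`L^{p₁}(|x|^{γ₁})` norm of `∑ 2^{-kδ} F k` by the `L^{p₀}(|x|^{γ₀})` norm of `sup_k F k`; this is
`exists_lintegral_tsum_le`.

The weights need not be Muckenhoupt weights, so no maximal theorem is invoked. Instead, `S_k f` is
reproduced by a Schwartz kernel at scale `2^{-k}`. Peetre's argument bounds it by its `r`-means with
`r` small, and Hölder's inequality inserts an arbitrary power weight:
`exists_rpow_le_weighted_lintegral`, which rescales to `LocalBound`.

The sum over `k` is split at `2^k |x| = 1`. For high frequencies, `F k x` is at most `sup_j F j x`
and also at most a constant times `2^{kd/p₀} |x|^{-γ₀/p₀} I^{1/p₀}`, where `I` is the `p₀`-th power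
of the right-hand norm. When `p₀ < p₁`, a geometric sum of minima interpolates between the two
bounds; when `p₀ = p₁`, the inequality `γ₁ < γ₀` makes the sum geometric. For low frequencies, the
crude bound by `I` leads to `|x|^{-d}` near the origin, which just fails to be integrable. Using
`LocalBound` with the weight exponent `γ₀ + 1` replaces `I` by pieces `dyadicPart` whose sum over
`k` is at most a multiple of `I`, and this restores convergence.

Necessity. Functions with spectrum in the annulus `3/4 · 2^k ≤ |ξ| ≤ 2^k` meet a single member of
the resolution, so their norms are weighted `L^p` norms. Dilations force the inequality between the
differential dimensions, translations force `γ₁/p₁ ≤ γ₀/p₀`, and sums over many annuli of pieces of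
equal modulus force `q₀ ≤ q₁` when all other parameters agree. -/

theorem exists_bound_one_add_pow_mul_iteratedFDeriv (g : 𝓢(Rd d, ℂ)) (k n : ℕ) :
    ∃ C : ℝ, 0 ≤ C ∧ ∀ x, (1 + ‖x‖) ^ k * ‖iteratedFDeriv ℝ n g x‖ ≤ C := by
  refine ⟨2 ^ k * (Finset.Iic (k, n)).sup (fun m => SchwartzMap.seminorm ℝ m.1 m.2) g,
    by positivity, fun x => ?_⟩
  exact SchwartzMap.one_add_le_sup_seminorm_apply (m := (k, n)) le_rfl le_rfl g x

theorem norm_le_one_add_mul_one_add (z a : Rd d) : ‖z‖ ≤ (1 + ‖a‖) * (1 + ‖z - a‖) := by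
  have h : ‖z‖ ≤ ‖z - a‖ + ‖a‖ := by simpa using norm_add_le (z - a) a
  nlinarith [norm_nonneg (z - a), norm_nonneg a, mul_nonneg (norm_nonneg (z - a)) (norm_nonneg a)]

/-- The Banach space of bounded continuous functions with values in the `n`-linear forms. -/
def DerivSpace (d n : ℕ) : Type := BoundedContinuousFunction (Rd d) (Rd d [×n]→L[ℝ] ℂ)

instance (d n : ℕ) : NormedAddCommGroup (DerivSpace d n) :=
  inferInstanceAs (NormedAddCommGroup (BoundedContinuousFunction (Rd d) (Rd d [×n]→L[ℝ] ℂ)))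

instance (d n : ℕ) : NormedSpace ℂ (DerivSpace d n) :=
  inferInstanceAs (NormedSpace ℂ (BoundedContinuousFunction (Rd d) (Rd d [×n]→L[ℝ] ℂ)))

instance (d n : ℕ) : CompleteSpace (DerivSpace d n) :=
  inferInstanceAs (CompleteSpace (BoundedContinuousFunction (Rd d) (Rd d [×n]→L[ℝ] ℂ)))

/-- Evaluation at a point on `DerivSpace d n`. -/
def DerivSpace.eval {d n : ℕ} (z : Rd d) : DerivSpace d n →L[ℂ] (Rd d [×n]→L[ℝ] ℂ) :=
  BoundedContinuousFunction.evalCLM ℂ z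

theorem DerivSpace.norm_eval_le {d n : ℕ} (u : DerivSpace d n) (z : Rd d) :
    ‖DerivSpace.eval z u‖ ≤ ‖u‖ :=
  BoundedContinuousFunction.norm_coe_le_norm
    (show BoundedContinuousFunction (Rd d) (Rd d [×n]→L[ℝ] ℂ) from u) z

theorem DerivSpace.norm_le {d n : ℕ} (u : DerivSpace d n) {C : ℝ} (hC : 0 ≤ C)
    (h : ∀ z, ‖DerivSpace.eval z u‖ ≤ C) : ‖u‖ ≤ C :=
  (BoundedContinuousFunction.norm_le
    (f := (show BoundedContinuousFunction (Rd d) (Rd d [×n]→L[ℝ] ℂ) from u)) hC).2 h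

theorem DerivSpace.ext {d n : ℕ} {u v : DerivSpace d n}
    (h : ∀ z, DerivSpace.eval z u = DerivSpace.eval z v) : u = v :=
  BoundedContinuousFunction.ext h

/-- The weighted derivative `x ↦ ‖x‖ ^ k • D^n g x` of a Schwartz function, as a bounded
continuous function. Its norm is a Schwartz seminorm. -/
def weightedDeriv (d k n : ℕ) :
    𝓢(Rd d, ℂ) →ₗ[ℂ] DerivSpace d n where
  toFun g := BoundedContinuousFunction.ofNormedAddCommGroup
    (fun x => (‖x‖ ^ k : ℝ) • iteratedFDeriv ℝ n g x)
    ((continuous_norm.pow k).smul ((g.smooth n).continuous_iteratedFDeriv le_rfl))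
    (SchwartzMap.seminorm ℂ k n g)
    (fun x => by
      rw [norm_smul, Real.norm_of_nonneg (by positivity)]
      exact SchwartzMap.le_seminorm ℂ k n g x)
  map_add' g h := by
    refine DerivSpace.ext fun x => ?_
    have : iteratedFDeriv ℝ n (⇑g + ⇑h) x = _ :=
      iteratedFDeriv_add_apply (g.contDiffAt n) (h.contDiffAt n)
    change (‖x‖ ^ k : ℝ) • iteratedFDeriv ℝ n (⇑g + ⇑h) x =
      (‖x‖ ^ k : ℝ) • iteratedFDeriv ℝ n g x + (‖x‖ ^ k : ℝ) • iteratedFDeriv ℝ n h x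
    rw [this, smul_add]
  map_smul' c g := by
    refine DerivSpace.ext fun x => ?_
    have : iteratedFDeriv ℝ n (c • ⇑g) x = _ :=
      iteratedFDeriv_const_smul_apply (a := c) (g.contDiffAt n)
    change (‖x‖ ^ k : ℝ) • iteratedFDeriv ℝ n (c • ⇑g) x =
      c • ((‖x‖ ^ k : ℝ) • iteratedFDeriv ℝ n g x)
    rw [this, smul_comm]

theorem weightedDeriv_apply (k n : ℕ) (g : 𝓢(Rd d, ℂ)) (x : Rd d) :
    DerivSpace.eval x (weightedDeriv d k n g) = (‖x‖ ^ k : ℝ) • iteratedFDeriv ℝ n g x := rfl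

theorem seminorm_le_norm_weightedDeriv (k n : ℕ) (g : 𝓢(Rd d, ℂ)) :
    SchwartzMap.seminorm ℂ k n g ≤ ‖weightedDeriv d k n g‖ := by
  refine SchwartzMap.seminorm_le_bound ℂ k n g (norm_nonneg (weightedDeriv d k n g)) fun x => ?_
  have := (weightedDeriv d k n g).norm_eval_le x
  rwa [weightedDeriv_apply, norm_smul, Real.norm_of_nonneg (by positivity)] at this

theorem iteratedFDeriv_compSubConst (n : ℕ) (g : 𝓢(Rd d, ℂ)) (a z : Rd d) :
    iteratedFDeriv ℝ n (SchwartzMap.compSubConstCLM ℂ a g) z = iteratedFDeriv ℝ n g (z - a) := by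
  rw [← iteratedFDeriv_comp_sub]
  congr 1

theorem norm_weightedDeriv_compSubConst_le (k n : ℕ) (g : 𝓢(Rd d, ℂ)) :
    ∃ C : ℝ, 0 ≤ C ∧ ∀ a, ‖weightedDeriv d k n (SchwartzMap.compSubConstCLM ℂ a g)‖ ≤
      C * (1 + ‖a‖) ^ k := by
  obtain ⟨C, hC0, hC⟩ := exists_bound_one_add_pow_mul_iteratedFDeriv g k n
  refine ⟨C, hC0, fun a => ?_⟩
  refine DerivSpace.norm_le _ (by positivity) fun z => ?_
  rw [weightedDeriv_apply, norm_smul, Real.norm_of_nonneg (by positivity),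
    iteratedFDeriv_compSubConst]
  calc ‖z‖ ^ k * ‖iteratedFDeriv ℝ n g (z - a)‖
      ≤ ((1 + ‖a‖) * (1 + ‖z - a‖)) ^ k * ‖iteratedFDeriv ℝ n g (z - a)‖ := by
        gcongr; exact norm_le_one_add_mul_one_add z a
    _ = ((1 + ‖z - a‖) ^ k * ‖iteratedFDeriv ℝ n g (z - a)‖) * (1 + ‖a‖) ^ k := by
        rw [mul_pow]; ring
    _ ≤ C * (1 + ‖a‖) ^ k := by gcongr; exact hC _

/-- Mean value inequality for the derivative of order `n` on the segment from `z - b` to `z - a`.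
Points `w` there satisfy `‖z - w‖ ≤ ‖a‖ + ‖b‖`, so the decay of `g` in `w` absorbs the weight in
`z`. -/
theorem norm_weightedDeriv_compSubConst_sub_le (k n : ℕ) (g : 𝓢(Rd d, ℂ)) :
    ∃ C : ℝ, 0 ≤ C ∧ ∀ a b, ‖weightedDeriv d k n (SchwartzMap.compSubConstCLM ℂ a g) -
      weightedDeriv d k n (SchwartzMap.compSubConstCLM ℂ b g)‖ ≤
      C * (1 + ‖a‖ + ‖b‖) ^ k * ‖a - b‖ := by
  obtain ⟨C, hC0, hC⟩ := exists_bound_one_add_pow_mul_iteratedFDeriv g k (n + 1)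
  refine ⟨C, hC0, fun a b => ?_⟩
  refine DerivSpace.norm_le _ (by positivity) fun z => ?_
  rw [map_sub, weightedDeriv_apply, weightedDeriv_apply,
    iteratedFDeriv_compSubConst, iteratedFDeriv_compSubConst]
  have key : ‖(‖z‖ ^ k : ℝ) • iteratedFDeriv ℝ n g (z - a) -
      (‖z‖ ^ k : ℝ) • iteratedFDeriv ℝ n g (z - b)‖ ≤
      C * (1 + ‖a‖ + ‖b‖) ^ k * ‖(z - a) - (z - b)‖ := by
    have hdiff : Differentiable ℝ (iteratedFDeriv ℝ n g) :=
      (g.smooth (n + 1 : ℕ)).differentiable_iteratedFDeriv (by exact_mod_cast Nat.lt_succ_self n)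
    refine Convex.norm_image_sub_le_of_norm_fderiv_le (𝕜 := ℝ) (s := segment ℝ (z - b) (z - a))
      (f := fun w => (‖z‖ ^ k : ℝ) • iteratedFDeriv ℝ n g w) (fun w _ => ?_) (fun w hw => ?_)
      (convex_segment _ _) (left_mem_segment ℝ _ _) (right_mem_segment ℝ _ _)
    · exact (hdiff w).const_smul (‖z‖ ^ k : ℝ)
    · rw [fderiv_fun_const_smul (hdiff w), norm_smul, Real.norm_of_nonneg (by positivity),
        norm_fderiv_iteratedFDeriv]
      have hzw : ‖z - w‖ ≤ ‖a‖ + ‖b‖ := by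
        obtain ⟨s, t, hs, ht, hst, rfl⟩ := hw
        have e : z - (s • (z - b) + t • (z - a)) = s • b + t • a := by
          have : z = (s + t) • z := by rw [hst, one_smul]
          nth_rw 1 [this]
          module
        rw [e]
        refine (norm_add_le _ _).trans ?_
        rw [norm_smul, norm_smul, Real.norm_of_nonneg hs, Real.norm_of_nonneg ht]
        nlinarith [norm_nonneg a, norm_nonneg b]
      have h1 : ‖z‖ ≤ (1 + ‖a‖ + ‖b‖) * (1 + ‖w‖) := by
        have h := norm_le_one_add_mul_one_add z (z - w)
        rw [sub_sub_cancel] at h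
        exact h.trans (mul_le_mul_of_nonneg_right (by linarith) (by positivity))
      calc ‖z‖ ^ k * ‖iteratedFDeriv ℝ (n + 1) g w‖
          ≤ ((1 + ‖a‖ + ‖b‖) * (1 + ‖w‖)) ^ k * ‖iteratedFDeriv ℝ (n + 1) g w‖ := by gcongr
        _ = ((1 + ‖w‖) ^ k * ‖iteratedFDeriv ℝ (n + 1) g w‖) * (1 + ‖a‖ + ‖b‖) ^ k := by
            rw [mul_pow]; ring
        _ ≤ C * (1 + ‖a‖ + ‖b‖) ^ k := by gcongr; exact hC _
  refine key.trans (le_of_eq ?_)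
  rw [sub_sub_sub_cancel_left, norm_sub_rev]

theorem continuous_weightedDeriv_compSubConst (k n : ℕ) (g : 𝓢(Rd d, ℂ)) :
    Continuous fun a => weightedDeriv d k n (SchwartzMap.compSubConstCLM ℂ a g) := by
  obtain ⟨C, hC0, hC⟩ := norm_weightedDeriv_compSubConst_sub_le k n g
  rw [continuous_iff_continuousAt]
  intro b
  refine tendsto_iff_norm_sub_tendsto_zero.2 ?_
  have hlim : Filter.Tendsto (fun a : Rd d => C * (1 + ‖a‖ + ‖b‖) ^ k * ‖a - b‖) (nhds b)
      (nhds 0) := by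
    have : Continuous fun a : Rd d => C * (1 + ‖a‖ + ‖b‖) ^ k * ‖a - b‖ := by fun_prop
    simpa using this.tendsto b
  exact squeeze_zero (fun _ => norm_nonneg _) (fun a => hC a b) hlim

/-- Differentiation under the integral sign, by induction on `n`: the derivatives of `g` are
bounded, so a multiple of `‖Ψ‖` dominates. -/
theorem iteratedFDeriv_integral_smul_comp_sub (g : 𝓢(Rd d, ℂ)) {Ψ : Rd d → ℂ}
    (hΨ : Integrable Ψ) {c : Rd d → Rd d} (hc : Continuous c) (n : ℕ) (z : Rd d) :
    iteratedFDeriv ℝ n (fun z => ∫ y, Ψ y • g (z - c y)) z =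
      ∫ y, Ψ y • iteratedFDeriv ℝ n g (z - c y) := by
  have hint : ∀ (n : ℕ) (z : Rd d),
      Integrable (fun y => Ψ y • iteratedFDeriv ℝ n g (z - c y)) := by
    intro n z
    obtain ⟨C, hC0, hC⟩ := exists_bound_one_add_pow_mul_iteratedFDeriv g 0 n
    refine hΨ.smul_bdd C
      (Continuous.aestronglyMeasurable (((g.smooth n).continuous_iteratedFDeriv le_rfl).comp
        (continuous_const.sub hc))) ?_
    exact Filter.Eventually.of_forall fun y => by simpa using hC (z - c y)
  induction n generalizing z with
  | zero =>
    ext m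
    rw [iteratedFDeriv_zero_apply]
    rw [show (∫ y, Ψ y • iteratedFDeriv ℝ 0 g (z - c y)) m =
      ContinuousMultilinearMap.apply ℝ (fun _ : Fin 0 => Rd d) ℂ m
        (∫ y, Ψ y • iteratedFDeriv ℝ 0 g (z - c y)) from rfl,
      ← ContinuousLinearMap.integral_comp_comm _ (hint 0 z)]
    rfl
  | succ n ih =>
    have hfun : iteratedFDeriv ℝ n (fun z => ∫ y, Ψ y • g (z - c y)) =
        fun z => ∫ y, Ψ y • iteratedFDeriv ℝ n g (z - c y) := funext ih
    have hdiff : Differentiable ℝ (iteratedFDeriv ℝ n g) :=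
      (g.smooth (n + 1 : ℕ)).differentiable_iteratedFDeriv (by exact_mod_cast Nat.lt_succ_self n)
    obtain ⟨C, hC0, hC⟩ := exists_bound_one_add_pow_mul_iteratedFDeriv g 0 (n + 1)
    have hcf : Continuous (fderiv ℝ (iteratedFDeriv ℝ n g)) := by
      have h := (g.smooth (n + 1 : ℕ)).continuous_iteratedFDeriv (m := n + 1) le_rfl
      rw [iteratedFDeriv_succ_eq_comp_left] at h
      exact (LinearIsometryEquiv.comp_continuous_iff _).1 h
    have : SecondCountableTopologyEither (Rd d) (Rd d →L[ℝ] Rd d [×n]→L[ℝ] ℂ) :=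
      secondCountableTopologyEither_of_left _ _
    have hder : HasFDerivAt (fun z => ∫ y, Ψ y • iteratedFDeriv ℝ n g (z - c y))
        (∫ y, Ψ y • fderiv ℝ (iteratedFDeriv ℝ n g) (z - c y)) z := by
      refine hasFDerivAt_integral_of_dominated_of_fderiv_le (𝕜 := ℝ) (s := Set.univ)
        (bound := fun y => ‖Ψ y‖ * C)
        (F' := fun z y => Ψ y • fderiv ℝ (iteratedFDeriv ℝ n g) (z - c y)) Filter.univ_mem
        (Filter.Eventually.of_forall fun w => (hint n w).aestronglyMeasurable) (hint n z) ?_ ?_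
        (hΨ.norm.mul_const C) ?_
      · exact hΨ.aestronglyMeasurable.smul (Continuous.aestronglyMeasurable
          (hcf.comp (continuous_const.sub hc)))
      · refine Filter.Eventually.of_forall fun y w _ => ?_
        rw [norm_smul, norm_fderiv_iteratedFDeriv]
        gcongr
        simpa using hC (w - c y)
      · refine Filter.Eventually.of_forall fun y w _ => ?_
        exact (((hdiff (w - c y)).hasFDerivAt).comp w
          ((hasFDerivAt_id w).sub_const (c y))).const_smul (Ψ y)
    rw [iteratedFDeriv_succ_eq_comp_left, Function.comp_apply, hfun, hder.fderiv]
    refine (ContinuousLinearEquiv.integral_comp_comm (𝕜 := ℝ)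
      (E := Rd d →L[ℝ] Rd d [×n]→L[ℝ] ℂ) (F := Rd d [×(n + 1)]→L[ℝ] ℂ)
      (continuousMultilinearCurryLeftEquiv ℝ (fun _ : Fin (n + 1) =>
        Rd d) ℂ).symm.toContinuousLinearEquiv
      (fun y => Ψ y • fderiv ℝ (iteratedFDeriv ℝ n g) (z - c y)) (μ := volume)).symm.trans ?_
    congr 1

theorem integrable_one_add_norm_pow_mul (Ψ : 𝓢(Rd d, ℂ)) (m : ℕ) :
    Integrable fun y => (1 + ‖y‖) ^ m * ‖Ψ y‖ := by
  simp_rw [add_comm (1 : ℝ), add_pow, one_pow, mul_one, Finset.sum_mul]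
  refine integrable_finsetSum _ fun i _ => ?_
  refine Integrable.congr (f := fun y => ‖y‖ ^ i * ‖Ψ y‖ * (m.choose i : ℝ)) ?_
    (Filter.Eventually.of_forall fun y => by ring)
  exact (Ψ.integrable_pow_mul volume i).mul_const _

variable {X : Type*} [NormedAddCommGroup X] [NormedSpace ℂ X]

/-- A tempered distribution is dominated by finitely many of the weighted derivatives. -/
theorem exists_norm_apply_le (f : 𝓢'(Rd d, X)) :
    ∃ (s : Finset (ℕ × ℕ)) (C : ℝ), 0 ≤ C ∧ ∀ ψ, ‖f ψ‖ ≤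
      C * ‖LinearMap.pi (fun i : s => weightedDeriv d i.1.1 i.1.2) ψ‖ := by
  obtain ⟨s, C, hC, h⟩ := Seminorm.bound_of_continuous (schwartz_withSeminorms ℂ (Rd d) ℂ)
    ((normSeminorm ℂ X).comp (f : 𝓢(Rd d, ℂ) →ₗ[ℂ] X)) (by
      exact continuous_norm.comp f.continuous)
  refine ⟨s, C, C.2, fun ψ => (h ψ).trans ?_⟩
  rw [smul_apply, NNReal.smul_def, smul_eq_mul]
  gcongr
  refine Seminorm.finset_sup_apply_le (norm_nonneg _) fun i hi => ?_
  refine (seminorm_le_norm_weightedDeriv i.1 i.2 ψ).trans ?_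
  exact norm_le_pi_norm (LinearMap.pi (fun i : s => weightedDeriv d i.1.1 i.1.2) ψ) ⟨i, hi⟩

theorem exists_norm_pi_weightedDeriv_le (s : Finset (ℕ × ℕ)) (g : 𝓢(Rd d, ℂ)) :
    ∃ (C : ℝ) (m : ℕ), 0 ≤ C ∧ ∀ a, ‖LinearMap.pi (fun i : s => weightedDeriv d i.1.1 i.1.2)
      (SchwartzMap.compSubConstCLM ℂ a g)‖ ≤ C * (1 + ‖a‖) ^ m := by
  choose C hC0 hC using fun i : s => norm_weightedDeriv_compSubConst_le i.1.1 i.1.2 g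
  refine ⟨∑ i, C i, s.sup Prod.fst, Finset.sum_nonneg fun i _ => hC0 i, fun a => ?_⟩
  refine (pi_norm_le_iff_of_nonneg (mul_nonneg (Finset.sum_nonneg fun i _ => hC0 i)
    (by positivity))).2 fun i => (hC i a).trans ?_
  have h1 : C i ≤ ∑ i, C i := Finset.single_le_sum (fun i _ => hC0 i) (Finset.mem_univ i)
  have h2 : (1 + ‖a‖) ^ i.1.1 ≤ (1 + ‖a‖) ^ s.sup Prod.fst :=
    pow_le_pow_right₀ (by linarith [norm_nonneg a]) (Finset.le_sup (f := Prod.fst) i.2)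
  exact mul_le_mul h1 h2 (by positivity) (Finset.sum_nonneg fun i _ => hC0 i)

theorem continuous_pi_weightedDeriv (s : Finset (ℕ × ℕ)) (g : 𝓢(Rd d, ℂ)) :
    Continuous fun a => LinearMap.pi (fun i : s => weightedDeriv d i.1.1 i.1.2)
      (SchwartzMap.compSubConstCLM ℂ a g) :=
  continuous_pi fun i => continuous_weightedDeriv_compSubConst i.1.1 i.1.2 g

theorem exists_norm_apply_compSubConst_le (f : 𝓢'(Rd d, X)) (g : 𝓢(Rd d, ℂ)) :
    ∃ (C : ℝ) (m : ℕ), 0 ≤ C ∧ ∀ a, ‖f (SchwartzMap.compSubConstCLM ℂ a g)‖ ≤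
      C * (1 + ‖a‖) ^ m := by
  obtain ⟨s, C, hC0, hC⟩ := exists_norm_apply_le f
  obtain ⟨C', m, hC'0, hC'⟩ := exists_norm_pi_weightedDeriv_le s g
  refine ⟨C * C', m, by positivity, fun a => (hC _).trans ?_⟩
  rw [mul_assoc]
  exact mul_le_mul_of_nonneg_left (hC' a) hC0

theorem continuous_apply_of_norm_le {V : Type*} [NormedAddCommGroup V] [NormedSpace ℂ V]
    (f : 𝓢'(Rd d, X)) (T : 𝓢(Rd d, ℂ) →ₗ[ℂ] V) {C : ℝ} (hC : ∀ ψ, ‖f ψ‖ ≤ C * ‖T ψ‖)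
    {G : Rd d → 𝓢(Rd d, ℂ)} (hG : Continuous fun y => T (G y)) : Continuous fun y => f (G y) := by
  rw [continuous_iff_continuousAt]
  intro b
  refine tendsto_iff_norm_sub_tendsto_zero.2 ?_
  have h := tendsto_iff_norm_sub_tendsto_zero.1 (hG.tendsto b)
  refine squeeze_zero (fun _ => norm_nonneg _) (fun a => ?_) (by simpa using h.const_mul C)
  rw [← map_sub, ← map_sub]
  exact hC _

/-- A linear map dominated by a linear map `T` into a Banach space commutes with those integrals
that `T` commutes with. -/
theorem apply_eq_integral_of_norm_le {V : Type*} [NormedAddCommGroup V] [NormedSpace ℂ V]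
    [CompleteSpace V] [CompleteSpace X] (f : 𝓢'(Rd d, X)) (T : 𝓢(Rd d, ℂ) →ₗ[ℂ] V) {C : ℝ}
    (hC : ∀ ψ, ‖f ψ‖ ≤ C * ‖T ψ‖) {G : Rd d → 𝓢(Rd d, ℂ)} (hG : Continuous fun y => T (G y))
    {Ψ : Rd d → ℂ} (hΨ : Continuous Ψ) (hint : Integrable fun y => Ψ y • T (G y))
    {χ : 𝓢(Rd d, ℂ)} (hχ : ∫ y, Ψ y • T (G y) = T χ) :
    f χ = ∫ y, Ψ y • f (G y) := by
  -- The bound `hC` makes `f ψ` depend only on `T ψ`. Hence `f` factors through the range of `T` and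
  -- extends continuously to its closure `K`, a Banach space in which the Bochner integral can be
  -- taken.
  set K := (LinearMap.range T).topologicalClosure with hK
  have hTK : ∀ ψ, T ψ ∈ K := fun ψ => subset_closure (LinearMap.mem_range_self T ψ)
  let e : 𝓢(Rd d, ℂ) →ₗ[ℂ] K := T.codRestrict K hTK
  have : CompleteSpace K := (LinearMap.range T).isClosed_topologicalClosure.completeSpace_coe
  have hdense : DenseRange e := by
    intro y
    rw [closure_subtype]
    have hy : (y : V) ∈ closure (LinearMap.range T : Set V) := y.2
    convert hy using 2
    ext w
    constructor
    · rintro ⟨_, ⟨ψ, rfl⟩, rfl⟩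
      exact ⟨ψ, rfl⟩
    · rintro ⟨ψ, rfl⟩
      exact ⟨e ψ, ⟨ψ, rfl⟩, rfl⟩
  let F : K →L[ℂ] X := (f : 𝓢(Rd d, ℂ) →ₗ[ℂ] X).extendOfNorm e
  have hF : ∀ ψ, F (e ψ) = f ψ :=
    LinearMap.extendOfNorm_eq hdense ⟨C, fun ψ => hC ψ⟩
  have hcont : Continuous fun y => e (G y) := Continuous.subtype_mk hG _
  have hint' : Integrable fun y => Ψ y • e (G y) :=
    hint.mono (hΨ.smul hcont).aestronglyMeasurable (Filter.Eventually.of_forall fun y => le_rfl)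
  have hval : ∫ y, Ψ y • e (G y) = e χ := by
    apply Subtype.ext
    change K.subtypeL (∫ y, Ψ y • e (G y)) = T χ
    rw [← K.subtypeL.integral_comp_comm hint', ← hχ]
    rfl
  rw [← hF, ← hval, ← F.integral_comp_comm hint']
  simp_rw [map_smul, hF]

theorem continuous_apply_compSubConst (f : 𝓢'(Rd d, X)) (g : 𝓢(Rd d, ℂ)) :
    Continuous fun a => f (SchwartzMap.compSubConstCLM ℂ a g) := by
  obtain ⟨s, C, hC0, hC⟩ := exists_norm_apply_le f
  exact continuous_apply_of_norm_le f _ hC (continuous_pi_weightedDeriv s g)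

/-- A pointwise superposition of translates passes through `f`. No integral with values in the
Schwartz space is formed: finitely many weighted derivatives dominate `f`, and the integral is taken
in the product of their Banach spaces. -/
theorem apply_eq_integral_compSubConst [CompleteSpace X] (f : 𝓢'(Rd d, X))
    (g χ Ψ : 𝓢(Rd d, ℂ)) (x : Rd d) (h : ∀ z, χ z = ∫ y, Ψ y • g (z - (x - y))) :
    f χ = ∫ y, Ψ y • f (SchwartzMap.compSubConstCLM ℂ (x - y) g) := by
  obtain ⟨s, C, hC0, hC⟩ := exists_norm_apply_le f
  obtain ⟨C', m, hC'0, hC'⟩ := exists_norm_pi_weightedDeriv_le s g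
  have hcont : Continuous fun y => LinearMap.pi (fun i : s => weightedDeriv d i.1.1 i.1.2)
      (SchwartzMap.compSubConstCLM ℂ (x - y) g) := (continuous_pi_weightedDeriv s g).comp
    (continuous_const.sub continuous_id : Continuous fun y => x - y)
  have hint : Integrable fun y => Ψ y • LinearMap.pi (fun i : s => weightedDeriv d i.1.1 i.1.2)
      (SchwartzMap.compSubConstCLM ℂ (x - y) g) := by
    refine Integrable.mono' ((integrable_one_add_norm_pow_mul Ψ m).const_mul
      (C' * (1 + ‖x‖) ^ m)) (Ψ.continuous.smul hcont).aestronglyMeasurable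
      (Filter.Eventually.of_forall fun y => ?_)
    rw [norm_smul]
    have h2 : 1 + ‖x - y‖ ≤ (1 + ‖x‖) * (1 + ‖y‖) := by
      nlinarith [norm_sub_le x y, norm_nonneg x, norm_nonneg y,
        mul_nonneg (norm_nonneg x) (norm_nonneg y)]
    have h3 : C' * (1 + ‖x - y‖) ^ m ≤ C' * ((1 + ‖x‖) * (1 + ‖y‖)) ^ m := by gcongr
    refine (mul_le_mul_of_nonneg_left ((hC' (x - y)).trans h3) (norm_nonneg _)).trans
      (le_of_eq ?_)
    rw [mul_pow]
    ring
  refine apply_eq_integral_of_norm_le f _ hC hcont Ψ.continuous hint ?_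
  -- The vector-valued identity is checked one seminorm and one point at a time, where it is
  -- differentiation under the integral sign.
  funext i
  refine DerivSpace.ext fun z => ?_
  let L : ((i : s) → DerivSpace d i.1.2) →L[ℂ] (Rd d [×i.1.2]→L[ℝ] ℂ) :=
    (DerivSpace.eval z).comp (ContinuousLinearMap.proj i)
  refine (L.integral_comp_comm hint).symm.trans ?_
  have hL : ∀ (c : ℂ) ψ, L (c • LinearMap.pi (fun i : s => weightedDeriv d i.1.1 i.1.2) ψ) =
      (‖z‖ ^ i.1.1 : ℝ) • (c • iteratedFDeriv ℝ i.1.2 ψ z) := fun c ψ => by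
    rw [map_smul]
    exact smul_comm c (‖z‖ ^ i.1.1 : ℝ) (iteratedFDeriv ℝ i.1.2 ψ z)
  simp_rw [hL, iteratedFDeriv_compSubConst]
  refine (integral_smul _ _).trans ?_
  refine congrArg _ ?_
  refine (iteratedFDeriv_integral_smul_comp_sub g Ψ.integrable (c := fun y => x - y)
    (by fun_prop) _ z).symm.trans ?_
  congr 1
  exact funext fun w => (h w).symm

end Translations

end WeightedTL

end

noncomputable section

namespace WeightedTL

/-! ### Fourier multipliers -/

section Fourier

open FourierTransform

variable {d : ℕ}

/-- The normalizing constant of the unitary Fourier transform. -/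
def fourierConst (d : ℕ) : ℝ := (2 * Real.pi) ^ (-(d : ℝ) / 2)

theorem fourierConst_pos (d : ℕ) : 0 < fourierConst d := by
  unfold fourierConst; positivity

theorem fourierHat_eq (φ : 𝓢(Rd d, ℂ)) (ξ : Rd d) :
    fourierHat φ ξ = (fourierConst d : ℂ) * 𝓕 φ ((2 * Real.pi)⁻¹ • ξ) := by
  unfold fourierHat
  rw [SchwartzMap.fourier_coe, Real.fourier_eq']
  congr 2
  ext x
  rw [smul_eq_mul, inner_smul_right]
  congr 2
  push_cast
  have : (Real.pi : ℂ) ≠ 0 := by exact_mod_cast Real.pi_ne_zero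
  field_simp

theorem fourier_eq_fourierHat (φ : 𝓢(Rd d, ℂ)) (ξ : Rd d) :
    𝓕 φ ξ = (fourierConst d : ℂ)⁻¹ * fourierHat φ ((2 * Real.pi) • ξ) := by
  have h : (fourierConst d : ℂ) ≠ 0 := by exact_mod_cast (fourierConst_pos d).ne'
  rw [fourierHat_eq, smul_smul, inv_mul_cancel₀ (by positivity), one_smul, ← mul_assoc,
    inv_mul_cancel₀ h, one_mul]

theorem eq_of_fourierHat_eq {φ ψ : 𝓢(Rd d, ℂ)} (h : ∀ ξ, fourierHat φ ξ = fourierHat ψ ξ) :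
    φ = ψ := by
  have : 𝓕 φ = 𝓕 ψ := by
    ext ξ
    rw [fourier_eq_fourierHat, fourier_eq_fourierHat, h]
  rw [← fourierInv_fourier_eq (F := 𝓢(Rd d, ℂ)) φ, this, fourierInv_fourier_eq]

theorem fourierHat_add (φ ψ : 𝓢(Rd d, ℂ)) (ξ : Rd d) :
    fourierHat (φ + ψ) ξ = fourierHat φ ξ + fourierHat ψ ξ := by
  simp_rw [fourierHat_eq, FourierTransform.fourier_add, add_apply, mul_add]

theorem fourierHat_smul (c : ℂ) (φ : 𝓢(Rd d, ℂ)) (ξ : Rd d) :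
    fourierHat (c • φ) ξ = c * fourierHat φ ξ := by
  simp_rw [fourierHat_eq, FourierTransform.fourier_smul, smul_apply, smul_eq_mul]
  ring

/-- The convolution theorem in the unitary normalization. -/
theorem eq_integral_of_fourierHat_eq_mul {χ φ ψ : 𝓢(Rd d, ℂ)}
    (h : ∀ ξ, fourierHat χ ξ = fourierHat φ ξ * fourierHat ψ ξ) (x : Rd d) :
    χ x = fourierConst d * ∫ y, φ (x - y) * ψ y := by
  have hχ : χ = (fourierConst d : ℂ) •
      SchwartzMap.convolution (ContinuousLinearMap.mul ℂ ℂ) ψ φ := by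
    apply eq_of_fourierHat_eq
    intro ξ
    rw [fourierHat_smul, h, fourierHat_eq, fourierHat_eq, fourierHat_eq,
      SchwartzMap.fourier_convolution, SchwartzMap.pairing_apply_apply,
      ContinuousLinearMap.mul_apply']
    ring
  rw [hχ, smul_apply, SchwartzMap.convolution_apply, smul_eq_mul]
  congr 1
  unfold convolution
  congr 1
  ext y
  rw [ContinuousLinearMap.mul_apply', mul_comm]

/-- The dilation `y ↦ R ^ d * ψ (R y)`. -/
def dilate (R : ℝ) (hR : R ≠ 0) (ψ : 𝓢(Rd d, ℂ)) : 𝓢(Rd d, ℂ) :=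
  ((R ^ d : ℝ) : ℂ) • SchwartzMap.compCLMOfContinuousLinearEquiv ℂ
    (ContinuousLinearEquiv.smulLeft (Units.mk0 R hR)) ψ

theorem dilate_apply (R : ℝ) (hR : R ≠ 0) (ψ : 𝓢(Rd d, ℂ)) (y : Rd d) :
    dilate R hR ψ y = ((R ^ d : ℝ) : ℂ) * ψ (R • y) := by
  simp [dilate]

theorem integral_dilate_smul {X : Type*} [NormedAddCommGroup X] [NormedSpace ℂ X] {R : ℝ}
    (hR : 0 < R) (ψ : 𝓢(Rd d, ℂ)) (u : Rd d → X) :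
    ∫ y, dilate R hR.ne' ψ y • u y = ∫ y, ψ y • u (R⁻¹ • y) := by
  have h := Measure.integral_comp_smul (volume : Measure (Rd d))
    (fun y => ψ y • u (R⁻¹ • y)) R
  simp only [smul_smul, inv_mul_cancel₀ hR.ne', one_smul, finrank_euclideanSpace,
    Fintype.card_fin, abs_inv, abs_of_pos (pow_pos hR d)] at h
  simp_rw [dilate_apply, mul_smul]
  rw [integral_smul, h]
  simp only [Complex.coe_smul]
  rw [smul_smul, mul_inv_cancel₀ (pow_pos hR d).ne', one_smul]

theorem fourierHat_dilate {R : ℝ} (hR : 0 < R) (ψ : 𝓢(Rd d, ℂ)) (ξ : Rd d) :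
    fourierHat (dilate R hR.ne' ψ) ξ = fourierHat ψ (R⁻¹ • ξ) := by
  unfold fourierHat
  congr 1
  simp_rw [mul_comm (Complex.exp _)]
  have := integral_dilate_smul hR ψ
    (fun x : Rd d => Complex.exp (-(Complex.I * ((inner ℝ x ξ : ℝ) : ℂ))))
  simp only [smul_eq_mul] at this
  rw [this]
  simp_rw [inner_smul_left, inner_smul_right]
  simp

theorem fourierHat_compSubConst (a : Rd d) (ψ : 𝓢(Rd d, ℂ)) (ξ : Rd d) :
    fourierHat (SchwartzMap.compSubConstCLM ℂ a ψ) ξ =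
      Complex.exp (-(Complex.I * ((inner ℝ a ξ : ℝ) : ℂ))) * fourierHat ψ ξ := by
  unfold fourierHat
  rw [mul_left_comm]
  congr 1
  rw [← integral_const_mul, ← integral_sub_right_eq_self (fun x : Rd d =>
    Complex.exp (-(Complex.I * ((inner ℝ a ξ : ℝ) : ℂ))) *
      (Complex.exp (-(Complex.I * ((inner ℝ x ξ : ℝ) : ℂ))) * ψ x)) a]
  congr 1
  ext x
  rw [SchwartzMap.compSubConstCLM_apply, ← mul_assoc, ← Complex.exp_add, inner_sub_left]
  congr 2
  push_cast
  ring

variable {φ : ℕ → 𝓢(Rd d, ℂ)}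

theorem IsDyadicResolution.fourierHat_eq_zero (hφ : IsDyadicResolution φ) (k : ℕ) {ξ : Rd d}
    (h : 3 / 2 * 2 ^ k ≤ ‖ξ‖) : fourierHat (φ k) ξ = 0 := by
  cases k with
  | zero => exact hφ.eq_zero ξ (by simpa using h)
  | succ k =>
    rw [hφ.succ, hφ.eq_zero, hφ.eq_zero, sub_zero]
    · rw [norm_smul, norm_inv, norm_pow, Real.norm_two, ← div_eq_inv_mul, le_div_iff₀ (by positivity)]
      rw [pow_succ] at h
      linarith [pow_pos (two_pos (α := ℝ)) k]
    · rw [norm_smul, norm_inv, norm_pow, Real.norm_two, ← div_eq_inv_mul, le_div_iff₀ (by positivity)]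
      exact h

/-- The spectrum of `φ k` lies in `‖ξ‖ ≤ 3/2 · 2^k`, and the dilated `φ 0` has Fourier transform `1`
on the larger ball `‖ξ‖ ≤ 2^(k+1)`. -/
theorem IsDyadicResolution.fourierHat_mul_fourierHat_dilate (hφ : IsDyadicResolution φ) (k : ℕ)
    (ξ : Rd d) :
    fourierHat (φ k) ξ = fourierHat (φ k) ξ *
      fourierHat (dilate (2 ^ (k + 1)) (by positivity) (φ 0)) ξ := by
  by_cases h : 3 / 2 * 2 ^ k ≤ ‖ξ‖
  · rw [hφ.fourierHat_eq_zero k h, zero_mul]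
  · rw [fourierHat_dilate (by positivity), hφ.eq_one, mul_one]
    rw [norm_smul, norm_inv, norm_pow, Real.norm_two, ← div_eq_inv_mul, div_le_one (by positivity),
      pow_succ]
    push Not at h
    linarith [pow_pos (two_pos (α := ℝ)) k]

/-- On this annulus the cutoff `φ̂₀(2^{-i} ξ)` is `1` for `i ≥ k` and `0` for `i < k`, so the
telescoping differences are all trivial except the one at `k`. -/
theorem IsDyadicResolution.fourierHat_eq_ite (hφ : IsDyadicResolution φ) (j k : ℕ) {ξ : Rd d}
    (h₁ : 3 / 4 * 2 ^ k ≤ ‖ξ‖) (h₂ : ‖ξ‖ ≤ 2 ^ k) :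
    fourierHat (φ j) ξ = if j = k then 1 else 0 := by
  have hone : ∀ i, k ≤ i → fourierHat (φ 0) (((2 : ℝ) ^ i)⁻¹ • ξ) = 1 := by
    intro i hi
    apply hφ.eq_one
    rw [norm_smul, norm_inv, norm_pow, Real.norm_two, ← div_eq_inv_mul, div_le_one (by positivity)]
    exact h₂.trans (pow_le_pow_right₀ one_le_two hi)
  have hzero : ∀ i, i < k → fourierHat (φ 0) (((2 : ℝ) ^ i)⁻¹ • ξ) = 0 := by
    intro i hi
    apply hφ.eq_zero
    rw [norm_smul, norm_inv, norm_pow, Real.norm_two, ← div_eq_inv_mul, le_div_iff₀ (by positivity)]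
    have : (2 : ℝ) ^ (i + 1) ≤ 2 ^ k := pow_le_pow_right₀ one_le_two hi
    rw [pow_succ] at this
    linarith
  cases j with
  | zero =>
    by_cases hk : k = 0
    · subst hk
      simpa using hone 0 le_rfl
    · have := hzero 0 (Nat.pos_of_ne_zero hk)
      rw [if_neg (by omega)]
      simpa using this
  | succ j =>
    rw [hφ.succ]
    rcases lt_trichotomy (j + 1) k with h | h | h
    · rw [hzero _ h, hzero _ (by omega), if_neg h.ne, sub_zero]
    · rw [hone _ h.ge, hzero _ (by omega), if_pos h, sub_zero]
    · rw [hone _ h.le, hone _ (by omega), if_neg h.ne', sub_self]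

variable {X : Type*} [NormedAddCommGroup X] [NormedSpace ℂ X]

theorem continuous_fourierCutoff (ψ : 𝓢(Rd d, ℂ)) (f : 𝓢'(Rd d, X)) :
    Continuous (fourierCutoff ψ f) :=
  (continuous_apply_compSubConst f _).const_smul (fourierConst d)

theorem exists_norm_fourierCutoff_le (ψ : 𝓢(Rd d, ℂ)) (f : 𝓢'(Rd d, X)) :
    ∃ (C : ℝ) (m : ℕ), 0 ≤ C ∧ ∀ x, ‖fourierCutoff ψ f x‖ ≤ C * (1 + ‖x‖) ^ m := by
  obtain ⟨C, m, hC0, hC⟩ := exists_norm_apply_compSubConst_le f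
    (SchwartzMap.compCLMOfContinuousLinearEquiv ℂ (ContinuousLinearEquiv.neg ℝ) ψ)
  have h0 := (fourierConst_pos d).le
  refine ⟨fourierConst d * C, m, by positivity, fun x => ?_⟩
  change ‖fourierConst d • f (reflectTranslate ψ x)‖ ≤ _
  rw [norm_smul, Real.norm_of_nonneg h0, mul_assoc]
  exact mul_le_mul_of_nonneg_left (hC x) h0

/-- The reproducing formula for frequency localized functions. -/
theorem IsDyadicResolution.fourierCutoff_eq_integral [CompleteSpace X]
    (hφ : IsDyadicResolution φ) (k : ℕ) (f : 𝓢'(Rd d, X)) (x : Rd d) :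
    fourierCutoff (φ k) f x = fourierConst d •
      ∫ y, φ 0 y • fourierCutoff (φ k) f (x - ((2 : ℝ) ^ (k + 1))⁻¹ • y) := by
  have hR : (0 : ℝ) < 2 ^ (k + 1) := by positivity
  set Ψ := dilate (2 ^ (k + 1)) hR.ne' (φ 0) with hΨ
  -- The translate by `x - y` of the reflected `φ k` is `reflectTranslate (φ k) (x - y)`. The kernel
  -- carries the factor `fourierConst d` of the unitary convolution theorem.
  have key := apply_eq_integral_compSubConst f
    (SchwartzMap.compCLMOfContinuousLinearEquiv ℂ (ContinuousLinearEquiv.neg ℝ) (φ k))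
    (reflectTranslate (φ k) x) ((fourierConst d : ℂ) • Ψ) x (fun z => by
      rw [reflectTranslate_apply, eq_integral_of_fourierHat_eq_mul
        (hφ.fourierHat_mul_fourierHat_dilate k), ← integral_const_mul]
      congr 1
      ext y
      simp only [smul_apply, smul_eq_mul, SchwartzMap.compCLMOfContinuousLinearEquiv_apply,
        Function.comp_apply, ContinuousLinearEquiv.coe_neg, Pi.neg_apply, id_eq]
      rw [show -(z - (x - y)) = x - z - y by abel]
      ring)
  rw [← integral_dilate_smul hR (φ 0) (fun y => fourierCutoff (φ k) f (x - y))]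
  change fourierConst d • f (reflectTranslate (φ k) x) = fourierConst d •
      ∫ y, Ψ y • (fourierConst d • f (reflectTranslate (φ k) (x - y)))
  rw [key]
  congr 2
  ext y
  rw [smul_apply, smul_eq_mul, mul_comm, mul_smul, Complex.coe_smul]
  rfl

/-- The extra factor two moves into the kernel, so that the scale is exactly `2^{-k}` with a kernel
independent of `k`. -/
theorem IsDyadicResolution.fourierCutoff_eq_integral_dilate [CompleteSpace X]
    (hφ : IsDyadicResolution φ) (k : ℕ) (f : 𝓢'(Rd d, X)) (x : Rd d) :
    fourierCutoff (φ k) f x = fourierConst d • ∫ y, dilate 2 two_ne_zero (φ 0) y •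
      fourierCutoff (φ k) f (x - ((2 : ℝ) ^ k)⁻¹ • y) := by
  rw [integral_dilate_smul two_pos (φ 0)
    (fun y => fourierCutoff (φ k) f (x - ((2 : ℝ) ^ k)⁻¹ • y)), hφ.fourierCutoff_eq_integral]
  simp_rw [smul_smul, pow_succ, mul_inv]

/-- The tempered distribution `η ⊗ v`. -/
def tensorDistribution (η : 𝓢(Rd d, ℂ)) (v : X) : 𝓢'(Rd d, X) :=
  (SchwartzMap.postcompCLM (ContinuousLinearMap.toSpanSingleton ℂ v) η : 𝓢(Rd d, X))

theorem fourierCutoff_tensorDistribution [CompleteSpace X] {η ψ χ : 𝓢(Rd d, ℂ)}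
    (h : ∀ ξ, fourierHat χ ξ = fourierHat ψ ξ * fourierHat η ξ) (v : X) (x : Rd d) :
    fourierCutoff ψ (tensorDistribution η v) x = χ x • v := by
  unfold fourierCutoff tensorDistribution
  rw [SchwartzMap.coe_apply, eq_integral_of_fourierHat_eq_mul h x, mul_smul, ← integral_smul_const,
    Complex.coe_smul]
  congr 2
  ext y
  simp [reflectTranslate_apply, mul_smul]

end Fourier

end WeightedTL

end

noncomputable section

namespace WeightedTL

/-! ### A maximal inequality for functions with a reproducing kernel -/

section Peetre

variable {d : ℕ}

/-- The weight `1 + |x|`. -/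
def bracket (x : Rd d) : ℝ≥0∞ := 1 + ‖x‖ₑ

theorem one_le_bracket (x : Rd d) : 1 ≤ bracket x := le_self_add

theorem bracket_ne_zero (x : Rd d) : bracket x ≠ 0 :=
  (zero_lt_one.trans_le (one_le_bracket x)).ne'

theorem bracket_ne_top (x : Rd d) : bracket x ≠ ∞ := by simp [bracket]

theorem bracket_zero : bracket (0 : Rd d) = 1 := by simp [bracket]

theorem bracket_neg (x : Rd d) : bracket (-x) = bracket x := by simp [bracket]

theorem bracket_eq_ofReal (x : Rd d) : bracket x = ENNReal.ofReal (1 + ‖x‖) := by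
  rw [bracket, ENNReal.ofReal_add zero_le_one (norm_nonneg _), ENNReal.ofReal_one, ofReal_norm]

@[fun_prop]
theorem measurable_bracket : Measurable (bracket : Rd d → ℝ≥0∞) := by
  unfold bracket; fun_prop

theorem bracket_add_le (x y : Rd d) : bracket (x + y) ≤ bracket x * bracket y := by
  unfold bracket
  calc 1 + ‖x + y‖ₑ ≤ 1 + (‖x‖ₑ + ‖y‖ₑ) := by gcongr; exact enorm_add_le x y
    _ ≤ 1 + (‖x‖ₑ + ‖y‖ₑ) + ‖x‖ₑ * ‖y‖ₑ := le_self_add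
    _ = (1 + ‖x‖ₑ) * (1 + ‖y‖ₑ) := by ring

theorem bracket_rpow_ne_zero (x : Rd d) (a : ℝ) : bracket x ^ a ≠ 0 := by
  simp [ENNReal.rpow_eq_zero_iff, bracket_ne_zero, bracket_ne_top]

theorem bracket_rpow_ne_top (x : Rd d) (a : ℝ) : bracket x ^ a ≠ ∞ := by
  simp [ENNReal.rpow_eq_top_iff, bracket_ne_zero, bracket_ne_top]

theorem bracket_rpow_le (x : Rd d) {a b : ℝ} (h : a ≤ b) : bracket x ^ a ≤ bracket x ^ b :=
  ENNReal.rpow_le_rpow_of_exponent_le (one_le_bracket x) h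

/-- Peetre's inequality. -/
theorem bracket_rpow_add_le (x y : Rd d) (a : ℝ) :
    bracket (x + y) ^ a ≤ bracket x ^ a * bracket y ^ |a| := by
  rcases le_total 0 a with ha | ha
  · rw [abs_of_nonneg ha, ← ENNReal.mul_rpow_of_nonneg _ _ ha]
    exact ENNReal.rpow_le_rpow (bracket_add_le x y) ha
  · have h : bracket x ≤ bracket (x + y) * bracket y := by
      simpa [bracket_neg] using bracket_add_le (x + y) (-y)
    have h' := ENNReal.rpow_le_rpow h (neg_nonneg.2 ha)
    rw [ENNReal.mul_rpow_of_nonneg _ _ (neg_nonneg.2 ha)] at h'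
    rw [abs_of_nonpos ha]
    calc bracket (x + y) ^ a = bracket x ^ a * bracket x ^ (-a) * bracket (x + y) ^ a := by
          rw [← ENNReal.rpow_add _ _ (bracket_ne_zero x) (bracket_ne_top x), add_neg_cancel,
            ENNReal.rpow_zero, one_mul]
      _ ≤ bracket x ^ a * (bracket (x + y) ^ (-a) * bracket y ^ (-a)) * bracket (x + y) ^ a := by
          gcongr
      _ = bracket x ^ a * bracket y ^ (-a) * (bracket (x + y) ^ (-a) * bracket (x + y) ^ a) := by
          ring
      _ = bracket x ^ a * bracket y ^ (-a) := by
          rw [← ENNReal.rpow_add _ _ (bracket_ne_zero _) (bracket_ne_top _), neg_add_cancel,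
            ENNReal.rpow_zero, mul_one]

theorem bracket_neg_rpow_mul_le (x y z : Rd d) {N : ℝ} (hN : 0 ≤ N) :
    bracket (x - y) ^ (-N) * bracket (y - z) ^ (-N) ≤ bracket (x - z) ^ (-N) := by
  rw [← ENNReal.mul_rpow_of_ne_zero (bracket_ne_zero _) (bracket_ne_zero _), ENNReal.rpow_neg,
    ENNReal.rpow_neg]
  refine ENNReal.inv_le_inv.2 (ENNReal.rpow_le_rpow ?_ hN)
  simpa using bracket_add_le (x - y) (y - z)

/-- Let `M` be the Peetre supremum. Submultiplicativity of the bracket gives `M ≤ A ∫ w` with `w = u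
z * bracket (x - z) ^ (-N) ≤ M`. Writing `w = w^{1-r} w^r ≤ M^{1-r} w^r` and dividing by `M^{1-r}`
yields the bound; the division is why `M` must be finite. -/
theorem iSup_rpow_le_of_reproducing {u : Rd d → ℝ≥0∞} {r N : ℝ} (hr : 0 < r) (hr1 : r ≤ 1)
    (hN : 0 ≤ N) {A : ℝ≥0∞}
    (hA : ∀ x, u x ≤ A * ∫⁻ z, u z * bracket (x - z) ^ (-N)) (x : Rd d)
    (hM : (⨆ y, u y * bracket (x - y) ^ (-N)) ≠ ∞) :
    (⨆ y, u y * bracket (x - y) ^ (-N)) ^ r ≤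
      A * ∫⁻ z, u z ^ r * bracket (x - z) ^ (-(N * r)) := by
  set M := ⨆ y, u y * bracket (x - y) ^ (-N) with hMdef
  rcases eq_or_ne M 0 with h0 | h0
  · rw [h0, ENNReal.zero_rpow_of_pos hr]
    exact zero_le
  have h1 : M ≤ A * ∫⁻ z, u z * bracket (x - z) ^ (-N) := by
    refine iSup_le fun y => ?_
    calc u y * bracket (x - y) ^ (-N)
        ≤ (A * ∫⁻ z, u z * bracket (y - z) ^ (-N)) * bracket (x - y) ^ (-N) := by
          gcongr; exact hA y
      _ = A * ∫⁻ z, u z * bracket (y - z) ^ (-N) * bracket (x - y) ^ (-N) := by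
          rw [mul_assoc, lintegral_mul_const' _ _ (bracket_rpow_ne_top _ _)]
      _ ≤ A * ∫⁻ z, u z * bracket (x - z) ^ (-N) := by
          refine mul_le_mul' le_rfl (lintegral_mono fun z => ?_)
          rw [mul_assoc, mul_comm (bracket (y - z) ^ (-N))]
          gcongr
          exact bracket_neg_rpow_mul_le x y z hN
  have hMr : M ^ (1 - r) ≠ ∞ := ENNReal.rpow_ne_top_of_nonneg (by linarith) hM
  have h2 : ∫⁻ z, u z * bracket (x - z) ^ (-N) ≤
      M ^ (1 - r) * ∫⁻ z, u z ^ r * bracket (x - z) ^ (-(N * r)) := by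
    rw [← lintegral_const_mul' _ _ hMr]
    refine lintegral_mono fun z => ?_
    set w := u z * bracket (x - z) ^ (-N) with hw
    have hwM : w ≤ M := le_iSup (fun y => u y * bracket (x - y) ^ (-N)) z
    have hwr : u z ^ r * bracket (x - z) ^ (-(N * r)) = w ^ r := by
      rw [hw, ENNReal.mul_rpow_of_nonneg _ _ hr.le, ← ENNReal.rpow_mul, neg_mul]
    rw [hwr]
    calc w = w ^ (1 - r) * w ^ r := by
          rw [← ENNReal.rpow_add_of_nonneg _ _ (by linarith) hr.le, sub_add_cancel,
            ENNReal.rpow_one]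
      _ ≤ M ^ (1 - r) * w ^ r := by
          gcongr
  calc M ^ r = M ^ (r - 1) * M := by
        nth_rw 3 [← ENNReal.rpow_one M]
        rw [← ENNReal.rpow_add _ _ h0 hM, sub_add_cancel]
    _ ≤ M ^ (r - 1) * (A * (M ^ (1 - r) * ∫⁻ z, u z ^ r * bracket (x - z) ^ (-(N * r)))) := by
        gcongr
        exact h1.trans (by gcongr)
    _ = (M ^ (r - 1) * M ^ (1 - r)) *
        (A * ∫⁻ z, u z ^ r * bracket (x - z) ^ (-(N * r))) := by ring
    _ = _ := by
        rw [← ENNReal.rpow_add _ _ h0 hM, sub_add_sub_cancel, sub_self, ENNReal.rpow_zero, one_mul]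

/-- A function of polynomial growth that is reproduced by rapidly decaying kernels is bounded by
its `r`-means, also for `r < 1`. -/
theorem rpow_le_lintegral_of_reproducing {u : Rd d → ℝ≥0∞} {r : ℝ} (hr : 0 < r) (hr1 : r ≤ 1)
    {A : ℝ → ℝ≥0∞} (hA0 : ∀ N, A N ≠ 0) (hA1 : ∀ N, A N ≠ ∞)
    (hA : ∀ N, 0 ≤ N → ∀ x, u x ≤ A N * ∫⁻ z, u z * bracket (x - z) ^ (-N))
    {C : ℝ≥0∞} (hC : C ≠ ∞) {m : ℝ} (hu : ∀ y, u y ≤ C * bracket y ^ m)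
    {N : ℝ} (hN : 0 ≤ N) (x : Rd d) :
    u x ^ r ≤ A N * ∫⁻ z, u z ^ r * bracket (x - z) ^ (-(N * r)) := by
  have hle : ∀ (K : ℝ) (y : Rd d), u y ≤ ⨆ w, u w * bracket (y - w) ^ (-K) := fun K y =>
    le_iSup_of_le y (by simp [bracket_zero])
  by_cases hI : ∫⁻ z, u z ^ r * bracket (x - z) ^ (-(N * r)) = ∞
  · rw [hI, ENNReal.mul_top (hA0 N)]
    exact le_top
  set K := max N m with hK
  have hKN : N ≤ K := le_max_left _ _
  have hK0 : 0 ≤ K := hN.trans hKN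
  have hfin : ∀ y, (⨆ w, u w * bracket (y - w) ^ (-K)) ≠ ∞ := by
    intro y
    refine ne_top_of_le_ne_top (ENNReal.mul_ne_top hC (bracket_rpow_ne_top y K))
      (iSup_le fun w => ?_)
    have h1 : bracket w ^ m ≤ bracket y ^ K * bracket (y - w) ^ K := by
      refine (bracket_rpow_le w (le_max_right N m)).trans ?_
      have := bracket_rpow_add_le y (w - y) K
      rwa [add_sub_cancel, abs_of_nonneg hK0, ← neg_sub y w, bracket_neg] at this
    calc u w * bracket (y - w) ^ (-K)
        ≤ C * (bracket y ^ K * bracket (y - w) ^ K) * bracket (y - w) ^ (-K) := by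
          gcongr
          exact (hu w).trans (by gcongr)
      _ = C * bracket y ^ K * (bracket (y - w) ^ K * bracket (y - w) ^ (-K)) := by ring
      _ = C * bracket y ^ K := by
          rw [← ENNReal.rpow_add _ _ (bracket_ne_zero _) (bracket_ne_top _), add_neg_cancel,
            ENNReal.rpow_zero, mul_one]
  -- Here the supremum is finite by polynomial growth. The decay `K r` on the right is weakened to
  -- `N r` so that the integral is the one assumed finite.
  have hyK : ∀ y, u y ^ r ≤ A K * ∫⁻ z, u z ^ r * bracket (y - z) ^ (-(N * r)) := fun y => by
    refine (ENNReal.rpow_le_rpow (hle K y) hr.le).trans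
      ((iSup_rpow_le_of_reproducing hr hr1 hK0 (hA K hK0) y (hfin y)).trans ?_)
    gcongr with z
    exact one_le_bracket _
  have hfinN : (⨆ w, u w * bracket (x - w) ^ (-N)) ≠ ∞ := by
    refine ne_top_of_le_ne_top (b := (A K * ∫⁻ z, u z ^ r * bracket (x - z) ^ (-(N * r))) ^ r⁻¹)
      (ENNReal.rpow_ne_top_of_nonneg (by positivity) (ENNReal.mul_ne_top (hA1 K) hI))
      (iSup_le fun w => ?_)
    rw [ENNReal.le_rpow_inv_iff hr, ENNReal.mul_rpow_of_nonneg _ _ hr.le, ← ENNReal.rpow_mul,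
      neg_mul]
    calc u w ^ r * bracket (x - w) ^ (-(N * r))
        ≤ (A K * ∫⁻ z, u z ^ r * bracket (w - z) ^ (-(N * r))) *
          bracket (x - w) ^ (-(N * r)) := by gcongr; exact hyK w
      _ = A K * ∫⁻ z, u z ^ r * bracket (w - z) ^ (-(N * r)) * bracket (x - w) ^ (-(N * r)) := by
          rw [mul_assoc, lintegral_mul_const' _ _ (bracket_rpow_ne_top _ _)]
      _ ≤ A K * ∫⁻ z, u z ^ r * bracket (x - z) ^ (-(N * r)) := by
          refine mul_le_mul' le_rfl (lintegral_mono fun z => ?_)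
          rw [mul_assoc, mul_comm (bracket (w - z) ^ _)]
          gcongr
          exact bracket_neg_rpow_mul_le x w z (by positivity)
  -- A second application, now with exponent `N`, brings the constant back to `A N`.
  exact (ENNReal.rpow_le_rpow (hle N x) hr.le).trans
    (iSup_rpow_le_of_reproducing hr hr1 hN (hA N hN) x hfinN)

end Peetre

/-! ### Weighted kernel estimates and pointwise bounds for arbitrary power weights. -/

section Kernel

variable {d : ℕ}

theorem lintegral_bracket_rpow_lt_top {L : ℝ} (hL : d < L) :
    ∫⁻ x : Rd d, bracket x ^ (-L) < ∞ := by
  have h := finite_integral_one_add_norm (E := Rd d) (μ := volume) (r := L) (by simpa using hL)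
  refine lt_of_eq_of_lt (lintegral_congr fun x => ?_) h
  rw [bracket_eq_ofReal, ENNReal.ofReal_rpow_of_pos (by positivity)]

theorem enorm_rpow_eq_ofReal {x : Rd d} (hx : x ≠ 0) (a : ℝ) :
    ‖x‖ₑ ^ a = ENNReal.ofReal (‖x‖ ^ a) := by
  rw [← ofReal_norm, ENNReal.ofReal_rpow_of_pos (norm_pos_iff.2 hx)]

theorem ae_ne_zero (hd : 1 ≤ d) : ∀ᵐ x : Rd d, x ≠ 0 := by
  have : Nonempty (Fin d) := ⟨⟨0, hd⟩⟩
  have : Nontrivial (Rd d) := inferInstance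
  exact Measure.ae_ne volume 0

theorem lintegral_ball_enorm_rpow_lt_top (hd : 1 ≤ d) {c : ℝ} (hc : -(d : ℝ) < c) (ρ : ℝ) :
    ∫⁻ x in Metric.ball (0 : Rd d) ρ, ‖x‖ₑ ^ c < ∞ := by
  rcases le_or_gt ρ 0 with hρ | hρ
  · simp [Metric.ball_eq_empty.2 hρ]
  have : Nonempty (Fin d) := ⟨⟨0, hd⟩⟩
  have hint : IntegrableOn (fun x : Rd d => ‖x‖ ^ c) (Metric.ball 0 ρ) := by
    rw [integrableOn_fun_norm_addHaar volume (f := fun t : ℝ => t ^ c)]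
    have h1 : IntegrableOn (fun y : ℝ => y ^ ((d : ℝ) - 1 + c)) (Set.Ioo 0 ρ) :=
      (intervalIntegral.integrableOn_Ioo_rpow_iff hρ).2 (by linarith)
    refine h1.congr_fun (fun y hy => ?_) measurableSet_Ioo
    dsimp only
    rw [finrank_euclideanSpace, Fintype.card_fin, smul_eq_mul, Real.rpow_add hy.1,
      ← Real.rpow_natCast, Nat.cast_sub hd, Nat.cast_one]
  refine lt_of_eq_of_lt ?_ hint.hasFiniteIntegral
  refine lintegral_congr_ae (ae_restrict_of_ae ?_)
  filter_upwards [ae_ne_zero hd] with x hx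
  rw [enorm_rpow_eq_ofReal hx, Real.enorm_of_nonneg (by positivity)]

/-- On the unit ball the singularity is integrable and the kernel is of size `bracket x ^ (-L)`,
which is at most `bracket x ^ c`. Off the ball `‖y‖ₑ ^ c` is comparable to `bracket y ^ c`, and
Peetre's inequality moves the weight to `x`, leaving the integrable decay `L - |c| > d`. -/
theorem lintegral_enorm_rpow_mul_bracket_le (hd : 1 ≤ d) {c L : ℝ} (hc : -(d : ℝ) < c)
    (hL : d + |c| < L) :
    ∃ C : ℝ≥0∞, C ≠ ∞ ∧ ∀ x : Rd d,
      ∫⁻ y, ‖y‖ₑ ^ c * bracket (x - y) ^ (-L) ≤ C * bracket x ^ c := by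
  set C₁ := ∫⁻ y in Metric.ball (0 : Rd d) 1, ‖y‖ₑ ^ c
  set C₂ := ∫⁻ y : Rd d, bracket y ^ (-(L - |c|))
  have hC₁ : C₁ ≠ ∞ := (lintegral_ball_enorm_rpow_lt_top hd hc 1).ne
  have hC₂ : C₂ ≠ ∞ := (lintegral_bracket_rpow_lt_top (by linarith)).ne
  have hL0 : 0 ≤ L := by have := abs_nonneg c; have := Nat.cast_nonneg (α := ℝ) d; linarith
  refine ⟨2 ^ L * C₁ + 2 ^ |c| * C₂, ENNReal.add_ne_top.2
    ⟨ENNReal.mul_ne_top (ENNReal.rpow_ne_top_of_nonneg hL0 (by simp)) hC₁,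
      ENNReal.mul_ne_top (ENNReal.rpow_ne_top_of_nonneg (abs_nonneg c) (by simp)) hC₂⟩,
    fun x => ?_⟩
  have hpt : ∀ y : Rd d, ‖y‖ₑ ^ c * bracket (x - y) ^ (-L) ≤
      bracket x ^ c * 2 ^ L * (Metric.ball (0 : Rd d) 1).indicator (fun y => ‖y‖ₑ ^ c) y +
      bracket x ^ c * 2 ^ |c| * bracket (x - y) ^ (-(L - |c|)) := by
    intro y
    by_cases hy : y ∈ Metric.ball (0 : Rd d) 1
    · refine le_add_right ?_
      rw [Set.indicator_of_mem hy, mul_comm]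
      gcongr
      have h1 : bracket (x - y) ^ (-L) ≤ bracket x ^ (-L) * bracket y ^ L := by
        have := bracket_rpow_add_le x (-y) (-L)
        rwa [bracket_neg, abs_neg, abs_of_nonneg hL0, ← sub_eq_add_neg] at this
      refine h1.trans (mul_le_mul' (bracket_rpow_le x ?_) (ENNReal.rpow_le_rpow ?_ hL0))
      · have := neg_abs_le c
        have := Nat.cast_nonneg (α := ℝ) d
        linarith
      · have : ‖y‖ₑ ≤ 1 := by
          rw [← ofReal_norm, ENNReal.ofReal_le_one]
          exact (mem_ball_zero_iff.1 hy).le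
        calc bracket y ≤ 1 + 1 := by unfold bracket; gcongr
          _ = 2 := one_add_one_eq_two
    · refine le_add_left ?_
      have hy1 : 1 ≤ ‖y‖ₑ := by
        rw [← ofReal_norm, ENNReal.one_le_ofReal]
        simpa using hy
      have h1 : ‖y‖ₑ ^ c ≤ 2 ^ |c| * bracket y ^ c := by
        rcases le_total 0 c with hc0 | hc0
        · calc ‖y‖ₑ ^ c ≤ 1 * bracket y ^ c := by
                rw [one_mul]
                exact ENNReal.rpow_le_rpow (by unfold bracket; exact le_add_self) hc0
            _ ≤ _ := by
                gcongr
                rw [← ENNReal.rpow_zero (x := 2)]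
                exact ENNReal.rpow_le_rpow_of_exponent_le (by norm_num) (abs_nonneg c)
        · rw [abs_of_nonpos hc0]
          have h2 : bracket y ≤ 2 * ‖y‖ₑ := by
            rw [two_mul]; unfold bracket; gcongr
          have h3 := ENNReal.rpow_le_rpow h2 (neg_nonneg.2 hc0)
          rw [ENNReal.mul_rpow_of_nonneg _ _ (neg_nonneg.2 hc0)] at h3
          have hy0 : ‖y‖ₑ ≠ 0 := (zero_lt_one.trans_le hy1).ne'
          calc ‖y‖ₑ ^ c = bracket y ^ (-c) * bracket y ^ c * ‖y‖ₑ ^ c := by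
                rw [← ENNReal.rpow_add _ _ (bracket_ne_zero _) (bracket_ne_top _),
                  neg_add_cancel, ENNReal.rpow_zero, one_mul]
            _ ≤ 2 ^ (-c) * ‖y‖ₑ ^ (-c) * bracket y ^ c * ‖y‖ₑ ^ c := by gcongr
            _ = 2 ^ (-c) * bracket y ^ c * (‖y‖ₑ ^ (-c) * ‖y‖ₑ ^ c) := by ring
            _ = _ := by
                rw [← ENNReal.rpow_add _ _ hy0 enorm_ne_top, neg_add_cancel, ENNReal.rpow_zero,
                  mul_one]
      have h2 : bracket y ^ c ≤ bracket x ^ c * bracket (x - y) ^ |c| := by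
        have := bracket_rpow_add_le x (y - x) c
        rwa [add_sub_cancel, ← neg_sub x y, bracket_neg] at this
      calc ‖y‖ₑ ^ c * bracket (x - y) ^ (-L)
          ≤ 2 ^ |c| * (bracket x ^ c * bracket (x - y) ^ |c|) * bracket (x - y) ^ (-L) := by
            gcongr
            exact h1.trans (by gcongr)
        _ = bracket x ^ c * 2 ^ |c| * (bracket (x - y) ^ |c| * bracket (x - y) ^ (-L)) := by ring
        _ = _ := by
            rw [← ENNReal.rpow_add _ _ (bracket_ne_zero _) (bracket_ne_top _)]
            congr 2
            ring
  calc ∫⁻ y, ‖y‖ₑ ^ c * bracket (x - y) ^ (-L)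
      ≤ ∫⁻ y, (bracket x ^ c * 2 ^ L * (Metric.ball (0 : Rd d) 1).indicator
          (fun y => ‖y‖ₑ ^ c) y + bracket x ^ c * 2 ^ |c| * bracket (x - y) ^ (-(L - |c|))) :=
        lintegral_mono hpt
    _ = bracket x ^ c * 2 ^ L * C₁ + bracket x ^ c * 2 ^ |c| * C₂ := by
        rw [lintegral_add_right _ (by fun_prop), lintegral_const_mul _
          ((by fun_prop : Measurable fun y : Rd d => ‖y‖ₑ ^ c).indicator measurableSet_ball),
          lintegral_const_mul _ (by fun_prop), lintegral_indicator measurableSet_ball,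
          lintegral_sub_left_eq_self (fun y => bracket y ^ (-(L - |c|))) x]
    _ = _ := by ring

/-- The weighted pointwise bound for functions with a reproducing kernel. -/
theorem exists_rpow_le_weighted_lintegral (hd : 1 ≤ d) {p a M : ℝ} (hp : 0 < p)
    (hM : 0 ≤ M) {A : ℝ → ℝ≥0∞} (hA0 : ∀ N, A N ≠ 0) (hA1 : ∀ N, A N ≠ ∞) :
    ∃ C : ℝ≥0∞, C ≠ ∞ ∧ ∀ u : Rd d → ℝ≥0∞, Measurable u →
      (∀ N, 0 ≤ N → ∀ x, u x ≤ A N * ∫⁻ z, u z * bracket (x - z) ^ (-N)) →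
      (∃ C' : ℝ≥0∞, C' ≠ ∞ ∧ ∃ m : ℝ, ∀ y, u y ≤ C' * bracket y ^ m) → ∀ x,
      u x ^ p ≤ C * bracket x ^ (-a) *
        ∫⁻ y, u y ^ p * ‖y‖ₑ ^ a * bracket (x - y) ^ (-M) := by
  have hd' : (1 : ℝ) ≤ d := by exact_mod_cast hd
  have ha := abs_nonneg a
  -- The bound `t ≤ 1/p` gives `r = p t ≤ 1`. The other bound gives `a t / (1 - t) < d`, so the dual
  -- weight `‖z‖ₑ ^ c` is locally integrable whatever the size of `a`.
  set t := min (1 / p) (d / (2 * (d + |a|))) with ht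
  have ht0 : 0 < t := lt_min (by positivity) (by positivity)
  have ht1 : t ≤ 1 / p := min_le_left _ _
  have ht2 : t * (2 * (d + |a|)) ≤ d := by
    rw [← le_div_iff₀ (by positivity)]; exact min_le_right _ _
  have ht3 : t ≤ 1 / 2 := by nlinarith [mul_nonneg ht0.le ha]
  have h1t : 0 < 1 - t := by linarith
  set r := p * t with hr
  have hr0 : 0 < r := by positivity
  have hr1 : r ≤ 1 := by rw [hr, mul_comm]; exact (le_div_iff₀ hp).1 ht1
  set c := -(a * t / (1 - t)) with hc
  have hc1 : -(d : ℝ) < c := by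
    rw [hc, neg_lt_neg_iff, div_lt_iff₀ h1t]
    nlinarith [le_abs_self a, mul_nonneg ht0.le ha, mul_nonneg ht0.le (sub_nonneg.2 (le_abs_self a))]
  set L := d + |c| + 1 with hL
  have hL0 : 0 ≤ L := by positivity
  obtain ⟨K, hK, hKle⟩ := lintegral_enorm_rpow_mul_bracket_le hd hc1 (show d + |c| < L by linarith)
  -- The decay `N r` splits into `M t` for the mean of `u` and `L (1 - t)` for the dual weight.
  set N := (M * t + L * (1 - t)) / r with hN
  have hN0 : 0 ≤ N := by positivity
  have hNr : N * r = M * t + L * (1 - t) := div_mul_cancel₀ _ hr0.ne'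
  have htinv : 0 ≤ t⁻¹ := by positivity
  refine ⟨(A N * K ^ (1 - t)) ^ t⁻¹, ENNReal.rpow_ne_top_of_nonneg htinv
    (ENNReal.mul_ne_top (hA1 N) (ENNReal.rpow_ne_top_of_nonneg h1t.le hK)), ?_⟩
  rintro u hu hrep ⟨C', hC', m, hgrow⟩ x
  have h1 := rpow_le_lintegral_of_reproducing hr0 hr1 hA0 hA1 hrep hC' hgrow hN0 x
  set I := ∫⁻ y, u y ^ p * ‖y‖ₑ ^ a * bracket (x - y) ^ (-M) with hI
  have h2 : ∫⁻ z, u z ^ r * bracket (x - z) ^ (-(N * r)) ≤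
      I ^ t * (K * bracket x ^ c) ^ (1 - t) := by
    -- Hölder's inequality with exponents `1/t` and `1/(1-t)`. Since `a t + c (1 - t) = 0`, the
    -- inserted weights cancel away from the origin.
    calc ∫⁻ z, u z ^ r * bracket (x - z) ^ (-(N * r))
        = ∫⁻ z, (u z ^ p * ‖z‖ₑ ^ a * bracket (x - z) ^ (-M)) ^ t *
            (‖z‖ₑ ^ c * bracket (x - z) ^ (-L)) ^ (1 - t) := by
          refine lintegral_congr_ae ?_
          filter_upwards [ae_ne_zero hd] with z hz
          have hz0 : ‖z‖ₑ ≠ 0 := by simpa using hz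
          have e1 : -(N * r) = -M * t + -L * (1 - t) := by rw [hNr]; ring
          have e2 : a * t + c * (1 - t) = 0 := by
            rw [hc]; field_simp; ring
          rw [ENNReal.mul_rpow_of_nonneg _ _ ht0.le, ENNReal.mul_rpow_of_nonneg _ _ ht0.le,
            ENNReal.mul_rpow_of_nonneg _ _ h1t.le, ← ENNReal.rpow_mul, ← ENNReal.rpow_mul,
            ← ENNReal.rpow_mul, ← ENNReal.rpow_mul, ← ENNReal.rpow_mul, e1,
            ENNReal.rpow_add _ _ (bracket_ne_zero _) (bracket_ne_top _)]
          calc u z ^ r * (bracket (x - z) ^ (-M * t) * bracket (x - z) ^ (-L * (1 - t)))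
              = u z ^ r * (‖z‖ₑ ^ (a * t) * ‖z‖ₑ ^ (c * (1 - t))) *
                (bracket (x - z) ^ (-M * t) * bracket (x - z) ^ (-L * (1 - t))) := by
                rw [← ENNReal.rpow_add _ _ hz0 enorm_ne_top, e2, ENNReal.rpow_zero, mul_one]
            _ = _ := by ring
      _ ≤ I ^ t * (∫⁻ z, ‖z‖ₑ ^ c * bracket (x - z) ^ (-L)) ^ (1 - t) :=
          ENNReal.lintegral_mul_norm_pow_le (by fun_prop) (by fun_prop) ht0.le h1t.le (by ring)
      _ ≤ I ^ t * (K * bracket x ^ c) ^ (1 - t) := by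
          gcongr
          exact hKle x
  have h3 := ENNReal.rpow_le_rpow (h1.trans (mul_le_mul' le_rfl h2)) htinv
  have e3 : r * t⁻¹ = p := by rw [hr]; field_simp
  have e4 : c * (1 - t) * t⁻¹ = -a := by rw [hc]; field_simp
  rw [← ENNReal.rpow_mul, e3] at h3
  refine h3.trans (le_of_eq ?_)
  rw [ENNReal.mul_rpow_of_nonneg _ _ htinv, ENNReal.mul_rpow_of_nonneg _ _ htinv,
    ENNReal.mul_rpow_of_nonneg _ _ htinv, ENNReal.mul_rpow_of_nonneg _ _ h1t.le,
    ENNReal.mul_rpow_of_nonneg _ _ htinv, ← ENNReal.rpow_mul I, mul_inv_cancel₀ ht0.ne',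
    ENNReal.rpow_one, ← ENNReal.rpow_mul (bracket x), ← ENNReal.rpow_mul (bracket x), e4]
  ring

end Kernel

end WeightedTL

end

noncomputable section

namespace WeightedTL

/-! ### Pointwise bounds for the frequency localized parts -/

section Localized

variable {d : ℕ}

theorem enorm_two_pow_smul (k : ℕ) (x : Rd d) :
    ‖(2 : ℝ) ^ k • x‖ₑ = (2 : ℝ≥0∞) ^ (k : ℝ) * ‖x‖ₑ := by
  rw [enorm_smul, enorm_pow, ENNReal.rpow_natCast]
  congr 2
  simp [Real.enorm_eq_ofReal]

theorem lintegral_comp_two_pow_smul (k : ℕ) {g : Rd d → ℝ≥0∞} (hg : Measurable g) :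
    ∫⁻ x, g x = (2 : ℝ≥0∞) ^ ((k : ℝ) * d) * ∫⁻ x, g ((2 : ℝ) ^ k • x) := by
  have h2 : (2 : ℝ) ^ k ≠ 0 := by positivity
  have hmap := Measure.map_addHaar_smul (volume : Measure (Rd d)) h2
  have h1 : ∫⁻ x, g ((2 : ℝ) ^ k • x) = ∫⁻ x, g x ∂(Measure.map (((2 : ℝ) ^ k) • ·) volume) :=
    (lintegral_map hg (measurable_const_smul _)).symm
  rw [h1, hmap, lintegral_smul_measure, smul_eq_mul, ← mul_assoc]
  have h3 : (2 : ℝ≥0∞) ^ ((k : ℝ) * d) *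
      ENNReal.ofReal |(((2 : ℝ) ^ k) ^ Module.finrank ℝ (Rd d))⁻¹| = 1 := by
    rw [finrank_euclideanSpace, Fintype.card_fin, abs_of_pos (by positivity),
      ENNReal.ofReal_inv_of_pos (by positivity), ← pow_mul,
      ENNReal.ofReal_pow (by positivity), ENNReal.ofReal_ofNat, ← Nat.cast_mul,
      ENNReal.rpow_natCast]
    exact ENNReal.mul_inv_cancel (by simp) (by simp)
  rw [h3, one_mul]

theorem two_rpow_ne_zero (a : ℝ) : (2 : ℝ≥0∞) ^ a ≠ 0 := by simp [ENNReal.rpow_eq_zero_iff]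

theorem two_rpow_ne_top (a : ℝ) : (2 : ℝ≥0∞) ^ a ≠ ∞ := by simp [ENNReal.rpow_eq_top_iff]

theorem two_rpow_add (a b : ℝ) : (2 : ℝ≥0∞) ^ (a + b) = 2 ^ a * 2 ^ b :=
  ENNReal.rpow_add _ _ (by simp) (by simp)

theorem exists_enorm_le_bracket_rpow (ψ : 𝓢(Rd d, ℂ)) (N : ℝ) :
    ∃ B : ℝ≥0∞, B ≠ ∞ ∧ ∀ y, ‖ψ y‖ₑ ≤ B * bracket y ^ (-N) := by
  obtain ⟨C, hC0, hC⟩ := exists_bound_one_add_pow_mul_iteratedFDeriv ψ ⌈N⌉₊ 0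
  refine ⟨ENNReal.ofReal C, ENNReal.ofReal_ne_top, fun y => ?_⟩
  have h1 : bracket y ^ N * ‖ψ y‖ₑ ≤ ENNReal.ofReal C := by
    calc bracket y ^ N * ‖ψ y‖ₑ ≤ bracket y ^ (⌈N⌉₊ : ℝ) * ‖ψ y‖ₑ := by
          gcongr
          · exact one_le_bracket y
          · exact Nat.le_ceil N
      _ = ENNReal.ofReal ((1 + ‖y‖) ^ ⌈N⌉₊ * ‖ψ y‖) := by
          rw [ENNReal.rpow_natCast, bracket_eq_ofReal, ← ENNReal.ofReal_pow (by positivity),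
            ← ofReal_norm (ψ y), ← ENNReal.ofReal_mul (by positivity)]
      _ ≤ ENNReal.ofReal C := by
          have := hC y
          rw [norm_iteratedFDeriv_zero] at this
          exact ENNReal.ofReal_le_ofReal this
  rw [ENNReal.rpow_neg, ← div_eq_mul_inv, ENNReal.le_div_iff_mul_le
    (Or.inl (bracket_rpow_ne_zero _ _)) (Or.inl (bracket_rpow_ne_top _ _)), mul_comm]
  exact h1

variable {X : Type*} [NormedAddCommGroup X] [NormedSpace ℂ X]

/-- The weighted pointwise bound for the frequency localized parts of a distribution. -/
theorem IsDyadicResolution.exists_enorm_fourierCutoff_le [CompleteSpace X] (hd : 1 ≤ d)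
    {φ : ℕ → 𝓢(Rd d, ℂ)} (hφ : IsDyadicResolution φ) {p M : ℝ} (a : ℝ) (hp : 0 < p) (hM : 0 ≤ M) :
    ∃ C : ℝ≥0∞, C ≠ ∞ ∧ ∀ (f : 𝓢'(Rd d, X)) (k : ℕ) (x : Rd d),
      ‖fourierCutoff (φ k) f x‖ₑ ^ p ≤ C * bracket ((2 : ℝ) ^ k • x) ^ (-a) *
        (2 ^ ((k : ℝ) * (d + a)) * ∫⁻ y, ‖fourierCutoff (φ k) f y‖ₑ ^ p * ‖y‖ₑ ^ a *
          bracket ((2 : ℝ) ^ k • (x - y)) ^ (-M)) := by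
  choose B hB1 hB using exists_enorm_le_bracket_rpow (dilate 2 two_ne_zero (φ 0))
  -- Adding `1` enlarges the kernel constant harmlessly and makes it nonzero.
  obtain ⟨C, hC, h⟩ := exists_rpow_le_weighted_lintegral (d := d) hd (a := a) hp hM
    (A := fun N => ENNReal.ofReal (fourierConst d) * B N + 1) (fun N => by simp)
    (fun N => by simp [ENNReal.mul_ne_top, hB1])
  refine ⟨C, hC, fun f k x => ?_⟩
  have hR : ((2 : ℝ) ^ k) ≠ 0 := by positivity
  have hcont := continuous_fourierCutoff (φ k) f
  have hmeas : Measurable fun x => ‖fourierCutoff (φ k) f x‖ₑ := hcont.enorm.measurable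
  -- Rescaling to frequency one makes the reproducing kernel, and hence every constant, independent
  -- of `k`.
  set u : Rd d → ℝ≥0∞ := fun x => ‖fourierCutoff (φ k) f (((2 : ℝ) ^ k)⁻¹ • x)‖ₑ with hu
  have humeas : Measurable u := hmeas.comp (measurable_const_smul _)
  have hrep : ∀ N, 0 ≤ N → ∀ x, u x ≤ (ENNReal.ofReal (fourierConst d) * B N + 1) *
      ∫⁻ z, u z * bracket (x - z) ^ (-N) := by
    intro N _ x
    calc u x ≤ ENNReal.ofReal (fourierConst d) *
          ∫⁻ y, ‖dilate 2 two_ne_zero (φ 0) y‖ₑ * u (x - y) := by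
          rw [hu]
          dsimp only
          rw [hφ.fourierCutoff_eq_integral_dilate, enorm_smul,
            Real.enorm_of_nonneg (fourierConst_pos d).le]
          gcongr
          refine (enorm_integral_le_lintegral_enorm _).trans (le_of_eq ?_)
          simp_rw [enorm_smul, smul_sub]
      _ = ENNReal.ofReal (fourierConst d) *
          ∫⁻ z, ‖dilate 2 two_ne_zero (φ 0) (x - z)‖ₑ * u z := by
          rw [← lintegral_sub_left_eq_self (fun z =>
            ‖dilate 2 two_ne_zero (φ 0) (x - z)‖ₑ * u z) x]
          simp_rw [sub_sub_cancel]
      _ ≤ ENNReal.ofReal (fourierConst d) * ∫⁻ z, B N * (u z * bracket (x - z) ^ (-N)) := by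
          refine mul_le_mul' le_rfl (lintegral_mono fun z => ?_)
          calc _ ≤ B N * bracket (x - z) ^ (-N) * u z := by gcongr; exact hB N _
            _ = _ := by ring
      _ = (ENNReal.ofReal (fourierConst d) * B N) * ∫⁻ z, u z * bracket (x - z) ^ (-N) := by
          rw [lintegral_const_mul' _ _ (hB1 N), mul_assoc]
      _ ≤ _ := by gcongr; exact le_self_add
  have hgrow : ∃ C' : ℝ≥0∞, C' ≠ ∞ ∧ ∃ m : ℝ, ∀ y, u y ≤ C' * bracket y ^ m := by
    obtain ⟨C', m, hC'0, hC'⟩ := exists_norm_fourierCutoff_le (φ k) f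
    refine ⟨ENNReal.ofReal C', ENNReal.ofReal_ne_top, m, fun y => ?_⟩
    rw [hu, ENNReal.rpow_natCast, bracket_eq_ofReal, ← ENNReal.ofReal_pow (by positivity),
      ← ENNReal.ofReal_mul hC'0]
    dsimp only
    rw [← ofReal_norm]
    refine ENNReal.ofReal_le_ofReal ((hC' _).trans ?_)
    gcongr
    rw [norm_smul, norm_inv, norm_pow, Real.norm_two]
    exact mul_le_of_le_one_left (norm_nonneg y) (inv_le_one_of_one_le₀ (one_le_pow₀ one_le_two))
  have key := h u humeas hrep hgrow ((2 : ℝ) ^ k • x)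
  have e1 : u ((2 : ℝ) ^ k • x) = ‖fourierCutoff (φ k) f x‖ₑ := by
    rw [hu]; dsimp only; rw [smul_smul, inv_mul_cancel₀ hR, one_smul]
  rw [e1, lintegral_comp_two_pow_smul k (by fun_prop)] at key
  refine key.trans (le_of_eq ?_)
  congr 1
  have e2 : ∀ y : Rd d, u ((2 : ℝ) ^ k • y) ^ p * ‖(2 : ℝ) ^ k • y‖ₑ ^ a *
      bracket ((2 : ℝ) ^ k • x - (2 : ℝ) ^ k • y) ^ (-M) = 2 ^ ((k : ℝ) * a) *
      (‖fourierCutoff (φ k) f y‖ₑ ^ p * ‖y‖ₑ ^ a * bracket ((2 : ℝ) ^ k • (x - y)) ^ (-M)) := by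
    intro y
    rw [hu]
    dsimp only
    rw [smul_smul, inv_mul_cancel₀ hR, one_smul, ← smul_sub, enorm_two_pow_smul,
      ENNReal.mul_rpow_of_ne_top (two_rpow_ne_top _) enorm_ne_top, ← ENNReal.rpow_mul]
    ring
  simp_rw [e2]
  rw [lintegral_const_mul' _ _ (two_rpow_ne_top _), ← mul_assoc, ← two_rpow_add]
  congr 2
  ring

end Localized

/-! ### Dyadic sums -/

section Dyadic

theorem tsum_int_two_rpow_ne_top {c : ℝ} (hc : 0 < c) :
    ∑' j : ℤ, (2 : ℝ≥0∞) ^ (-(c * |(j : ℝ)|)) ≠ ∞ := by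
  have hs : Summable fun n : ℕ => (2 : ℝ) ^ (-(c * (n : ℝ))) := by
    have : (fun n : ℕ => (2 : ℝ) ^ (-(c * (n : ℝ)))) = fun n : ℕ => ((2 : ℝ) ^ (-c)) ^ n := by
      ext n
      rw [← Real.rpow_natCast, ← Real.rpow_mul (by norm_num), neg_mul]
    rw [this]
    exact summable_geometric_of_lt_one (by positivity)
      (Real.rpow_lt_one_of_one_lt_of_neg (by norm_num) (by linarith))
  have hs' : Summable fun j : ℤ => (2 : ℝ) ^ (-(c * |(j : ℝ)|)) := by
    refine Summable.of_nat_of_neg ?_ ?_ <;> simpa using hs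
  have h := hs'.tsum_ofReal_ne_top
  convert h using 3 with j
  rw [← ENNReal.ofReal_rpow_of_pos (by norm_num), ENNReal.ofReal_ofNat]

theorem exists_two_rpow_eq {a : ℝ≥0∞} (h0 : a ≠ 0) (h1 : a ≠ ∞) : ∃ A : ℝ, a = 2 ^ A := by
  refine ⟨Real.logb 2 a.toReal, ?_⟩
  have : 0 < a.toReal := ENNReal.toReal_pos h0 h1
  rw [← ENNReal.ofReal_ofNat 2, ENNReal.ofReal_rpow_of_pos (by norm_num),
    Real.rpow_logb (by norm_num) (by norm_num) this, ENNReal.ofReal_toReal h1]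

/-- A dyadic sum of the minimum of an increasing and a decreasing geometric sequence. -/
theorem exists_tsum_min_le {α β : ℝ} (hα : 0 < α) (hβ : 0 < β) :
    ∃ C : ℝ≥0∞, C ≠ ∞ ∧ ∀ a b : ℝ≥0∞,
      ∑' k : ℕ, min (a * 2 ^ ((k : ℝ) * α)) (b * 2 ^ (-((k : ℝ) * β))) ≤
        C * (a ^ (β / (α + β)) * b ^ (α / (α + β))) := by
  set c := min α β with hc
  have hc0 : 0 < c := lt_min hα hβ
  set S := ∑' j : ℤ, (2 : ℝ≥0∞) ^ (-(c * |(j : ℝ)|)) with hS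
  have hS0 : S ≠ 0 := by
    have : (1 : ℝ≥0∞) ≤ S := by
      refine le_trans (le_of_eq ?_) (ENNReal.le_tsum (0 : ℤ))
      simp
    exact (zero_lt_one.trans_le this).ne'
  have hC0 : (2 : ℝ≥0∞) ^ c * S ≠ 0 := mul_ne_zero (two_rpow_ne_zero c) hS0
  refine ⟨2 ^ c * S, ENNReal.mul_ne_top (two_rpow_ne_top c) (tsum_int_two_rpow_ne_top hc0),
    fun a b => ?_⟩
  have hα' : 0 < α / (α + β) := by positivity
  have hβ' : 0 < β / (α + β) := by positivity
  rcases eq_or_ne a 0 with rfl | ha0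
  · simp
  rcases eq_or_ne b 0 with rfl | hb0
  · simp
  rcases eq_or_ne a ∞ with rfl | ha1
  · rw [ENNReal.top_rpow_of_pos hβ', ENNReal.top_mul, ENNReal.mul_top hC0]
    · exact le_top
    · simp [ENNReal.rpow_eq_zero_iff, hb0, hα'.le]
  rcases eq_or_ne b ∞ with rfl | hb1
  · rw [ENNReal.top_rpow_of_pos hα', ENNReal.mul_top, ENNReal.mul_top hC0]
    · exact le_top
    · simp [ENNReal.rpow_eq_zero_iff, ha0, hβ'.le]
  obtain ⟨A, rfl⟩ := exists_two_rpow_eq ha0 ha1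
  obtain ⟨B, rfl⟩ := exists_two_rpow_eq hb0 hb1
  -- The two sequences cross at `k = t`, with common value `2 ^ v`. The minimum decays from there at
  -- rate at least `c` on both sides; rounding `t` to an integer costs a factor `2 ^ c`.
  set t := (B - A) / (α + β) with ht
  set v := A * (β / (α + β)) + B * (α / (α + β)) with hv
  have hv1 : A = v - t * α := by rw [hv, ht]; field_simp; ring
  have hv2 : B = v + t * β := by rw [hv, ht]; field_simp; ring
  rw [← ENNReal.rpow_mul, ← ENNReal.rpow_mul, ← two_rpow_add, ← hv]
  have hterm : ∀ k : ℕ, min ((2 : ℝ≥0∞) ^ A * 2 ^ ((k : ℝ) * α)) (2 ^ B * 2 ^ (-((k : ℝ) * β))) ≤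
      2 ^ (v + c) * 2 ^ (-(c * |(((k : ℤ) - ⌊t⌋ : ℤ) : ℝ)|)) := by
    intro k
    rw [← two_rpow_add, ← two_rpow_add, ← two_rpow_add]
    have hfl := Int.floor_le t
    have hfl' := Int.lt_floor_add_one t
    have hcα : c ≤ α := min_le_left _ _
    have hcβ : c ≤ β := min_le_right _ _
    push_cast
    rcases le_total (k : ℝ) t with hk | hk
    · refine (min_le_left _ _).trans (ENNReal.rpow_le_rpow_of_exponent_le (by norm_num) ?_)
      have h3 : |(k : ℝ) - ⌊t⌋| ≤ (t - k) + 1 := by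
        rw [abs_le]; constructor <;> linarith
      nlinarith [mul_le_mul_of_nonneg_left h3 hc0.le, mul_nonneg (sub_nonneg.2 hcα)
        (sub_nonneg.2 hk)]
    · refine (min_le_right _ _).trans (ENNReal.rpow_le_rpow_of_exponent_le (by norm_num) ?_)
      have h3 : |(k : ℝ) - ⌊t⌋| ≤ (k - t) + 1 := by
        rw [abs_le]; constructor <;> linarith
      nlinarith [mul_le_mul_of_nonneg_left h3 hc0.le, mul_nonneg (sub_nonneg.2 hcβ)
        (sub_nonneg.2 hk)]
  calc ∑' k : ℕ, min ((2 : ℝ≥0∞) ^ A * 2 ^ ((k : ℝ) * α)) (2 ^ B * 2 ^ (-((k : ℝ) * β)))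
      ≤ ∑' k : ℕ, 2 ^ (v + c) * 2 ^ (-(c * |(((k : ℤ) - ⌊t⌋ : ℤ) : ℝ)|)) :=
        ENNReal.tsum_le_tsum hterm
    _ = 2 ^ (v + c) * ∑' k : ℕ, 2 ^ (-(c * |(((k : ℤ) - ⌊t⌋ : ℤ) : ℝ)|)) := ENNReal.tsum_mul_left
    _ ≤ 2 ^ (v + c) * S := by
        gcongr
        have hinj : Function.Injective fun k : ℕ => (k : ℤ) - ⌊t⌋ := fun m n h => by
          simpa using h
        exact ENNReal.tsum_comp_le_tsum_of_injective hinj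
          (fun j : ℤ => (2 : ℝ≥0∞) ^ (-(c * |(j : ℝ)|)))
    _ = _ := by rw [two_rpow_add]; ring

end Dyadic

end WeightedTL

end

noncomputable section

namespace WeightedTL

/-! ### The Sobolev type inequality for sequences of functions -/

section HighFrequencies

theorem mul_rpow_inv_rpow {p : ℝ} (hp : 0 < p) {F a : ℝ≥0∞} (h : F ^ p ≤ a) : F ≤ a ^ p⁻¹ :=
  (ENNReal.le_rpow_inv_iff hp).2 h

theorem two_rpow_neg_mul_le_rpow {t : ℝ≥0∞} {k : ℕ}
    (h : 1 ≤ (2 : ℝ≥0∞) ^ (k : ℝ) * t) {ε : ℝ} (hε : 0 ≤ ε) :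
    (2 : ℝ≥0∞) ^ (-((k : ℝ) * ε)) ≤ t ^ ε := by
  have h1 := ENNReal.rpow_le_rpow h hε
  rw [ENNReal.one_rpow, ENNReal.mul_rpow_of_nonneg _ _ hε, ← ENNReal.rpow_mul] at h1
  rw [ENNReal.rpow_neg]
  exact ENNReal.inv_le_iff_le_mul (fun _ => two_rpow_ne_zero _) (fun h => absurd h
    (two_rpow_ne_top _)) |>.2 h1

theorem two_rpow_mul_le_rpow_neg {t : ℝ≥0∞} {k : ℕ}
    (h : (2 : ℝ≥0∞) ^ (k : ℝ) * t ≤ 1) {ε : ℝ} (hε : 0 ≤ ε) :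
    (2 : ℝ≥0∞) ^ ((k : ℝ) * ε) ≤ t ^ (-ε) := by
  have h1 := ENNReal.rpow_le_rpow h hε
  rw [ENNReal.one_rpow, ENNReal.mul_rpow_of_nonneg _ _ hε, ← ENNReal.rpow_mul] at h1
  rw [ENNReal.rpow_neg]
  exact ENNReal.le_inv_iff_mul_le.2 h1

/-- An argument of Hedberg type. The smoothness gap is `ε + σ` with `ε = γ₀/p₀ - γ₁/p₁ ≥ 0` and `σ =
D/p₀ - D/p₁ > 0`. The factor `2^{-kε}` is at most `t^ε` since `2^k t ≥ 1`, and the factor `2^{-kσ}`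
lets the sum interpolate between the bounds `g` and `h 2^{kD/p₀}`. -/
theorem exists_tsum_high_le_of_lt {p₀ p₁ γ₀ γ₁ D : ℝ} (hp₀ : 0 < p₀) (hp : p₀ < p₁) (hD : 0 < D)
    (hγ : γ₁ / p₁ ≤ γ₀ / p₀) {C₁ : ℝ≥0∞} (hC₁ : C₁ ≠ ∞) :
    ∃ C : ℝ≥0∞, C ≠ ∞ ∧ ∀ (F : ℕ → ℝ≥0∞) (g I t : ℝ≥0∞), t ≠ 0 → t ≠ ∞ → (∀ k, F k ≤ g) →
      (∀ k : ℕ, 1 ≤ (2 : ℝ≥0∞) ^ (k : ℝ) * t →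
        F k ^ p₀ ≤ C₁ * (2 ^ ((k : ℝ) * D) * (t ^ (-γ₀) * I))) →
      (∑' k : ℕ, if 1 ≤ (2 : ℝ≥0∞) ^ (k : ℝ) * t then
        2 ^ (-((k : ℝ) * ((D + γ₀) / p₀ - (D + γ₁) / p₁))) * F k else 0) ^ p₁ * t ^ γ₁ ≤
        C * I ^ (p₁ / p₀ - 1) * (g ^ p₀ * t ^ γ₀) := by
  have hp₁ : 0 < p₁ := hp₀.trans hp
  set ε := γ₀ / p₀ - γ₁ / p₁ with hε
  set σ := D / p₀ - D / p₁ with hσ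
  have hε0 : 0 ≤ ε := sub_nonneg.2 hγ
  have hσ0 : 0 < σ := sub_pos.2 (div_lt_div_of_pos_left hD hp₀ hp)
  have hα0 : 0 < D / p₁ := by positivity
  obtain ⟨K, hK, hsum⟩ := exists_tsum_min_le hα0 hσ0
  have hr0 : 0 ≤ p₁ / p₀ - 1 := by
    rw [sub_nonneg, one_le_div hp₀]; exact hp.le
  refine ⟨K ^ p₁ * C₁ ^ (p₁ / p₀ - 1), ENNReal.mul_ne_top
    (ENNReal.rpow_ne_top_of_nonneg hp₁.le hK) (ENNReal.rpow_ne_top_of_nonneg hr0 hC₁),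
    fun F g I t ht ht' hg hF => ?_⟩
  set h := (C₁ * (t ^ (-γ₀) * I)) ^ p₀⁻¹ with hh
  have hterm : ∀ k : ℕ, (if 1 ≤ (2 : ℝ≥0∞) ^ (k : ℝ) * t then
      2 ^ (-((k : ℝ) * ((D + γ₀) / p₀ - (D + γ₁) / p₁))) * F k else 0) ≤
      t ^ ε * min (h * 2 ^ ((k : ℝ) * (D / p₁))) (g * 2 ^ (-((k : ℝ) * σ))) := by
    intro k
    split_ifs with hk
    · have e : -((k : ℝ) * ((D + γ₀) / p₀ - (D + γ₁) / p₁)) = -(k * ε) + -(k * σ) := by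
        rw [hε, hσ]; ring
      rw [e, two_rpow_add, mul_assoc]
      refine mul_le_mul' (two_rpow_neg_mul_le_rpow hk hε0) (le_min ?_ ?_)
      · have h1 : F k ≤ h * 2 ^ ((k : ℝ) * (D / p₀)) := by
          refine (mul_rpow_inv_rpow hp₀ (hF k hk)).trans (le_of_eq ?_)
          rw [hh, mul_left_comm, ENNReal.mul_rpow_of_nonneg _ _ (inv_nonneg.2 hp₀.le),
            ← ENNReal.rpow_mul, mul_comm]
          congr 2
          ring
        calc 2 ^ (-((k : ℝ) * σ)) * F k ≤ 2 ^ (-((k : ℝ) * σ)) * (h * 2 ^ ((k : ℝ) * (D / p₀))) := by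
              gcongr
          _ = h * (2 ^ (-((k : ℝ) * σ)) * 2 ^ ((k : ℝ) * (D / p₀))) := by ring
          _ = _ := by
              rw [← two_rpow_add]
              congr 2
              rw [hσ]; ring
      · rw [mul_comm]
        gcongr
        exact hg k
    · exact zero_le
  have hS := (ENNReal.tsum_le_tsum hterm).trans (le_of_eq ENNReal.tsum_mul_left)
  have hS2 := ENNReal.rpow_le_rpow (hS.trans (mul_le_mul' le_rfl (hsum h g))) hp₁.le
  have hsum' : D / p₁ + σ = D / p₀ := by rw [hσ]; ring
  -- After raising to the power `p₁`, the interpolation exponents of `h` and `g` become `p₁ - p₀`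
  -- and `p₀`.
  have e1 : σ / (D / p₁ + σ) * p₁ = p₁ - p₀ := by rw [hsum', hσ]; field_simp
  have e2 : D / p₁ / (D / p₁ + σ) * p₁ = p₀ := by rw [hsum']; field_simp
  have e3 : p₀⁻¹ * (p₁ - p₀) = p₁ / p₀ - 1 := by field_simp
  rw [ENNReal.mul_rpow_of_nonneg _ _ hp₁.le, ENNReal.mul_rpow_of_nonneg _ _ hp₁.le,
    ENNReal.mul_rpow_of_nonneg _ _ hp₁.le, ← ENNReal.rpow_mul t, ← ENNReal.rpow_mul h,
    ← ENNReal.rpow_mul g, e1, e2, hh, ← ENNReal.rpow_mul, e3, ENNReal.mul_rpow_of_nonneg _ _ hr0,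
    ENNReal.mul_rpow_of_nonneg _ _ hr0, ← ENNReal.rpow_mul] at hS2
  refine (mul_le_mul' hS2 le_rfl).trans (le_of_eq ?_)
  have e4 : t ^ (ε * p₁) * t ^ (-γ₀ * (p₁ / p₀ - 1)) * t ^ γ₁ = t ^ γ₀ := by
    rw [← ENNReal.rpow_add _ _ ht ht', ← ENNReal.rpow_add _ _ ht ht']
    congr 1
    rw [hε]
    field_simp
    ring
  rw [← e4]
  ring

/-- Equal integrability leaves no room to interpolate, but `ε > 0` makes the series geometric from
`2^k ≥ 1/t` on, with sum of order `t^ε`. -/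
theorem exists_tsum_high_le_of_eq {p γ₀ γ₁ D : ℝ} (hp : 0 < p) (hγ : γ₁ < γ₀) :
    ∃ C : ℝ≥0∞, C ≠ ∞ ∧ ∀ (F : ℕ → ℝ≥0∞) (g t : ℝ≥0∞), t ≠ 0 → t ≠ ∞ → (∀ k, F k ≤ g) →
      (∑' k : ℕ, if 1 ≤ (2 : ℝ≥0∞) ^ (k : ℝ) * t then
        2 ^ (-((k : ℝ) * ((D + γ₀) / p - (D + γ₁) / p))) * F k else 0) ^ p * t ^ γ₁ ≤
        C * (g ^ p * t ^ γ₀) := by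
  set ε := (D + γ₀) / p - (D + γ₁) / p with hε
  have hε0 : 0 < ε := by
    rw [hε, ← sub_div]
    exact div_pos (by linarith) hp
  obtain ⟨K, hK, hsum⟩ := exists_tsum_min_le hε0 hε0
  refine ⟨K ^ p, ENNReal.rpow_ne_top_of_nonneg hp.le hK, fun F g t ht ht' hg => ?_⟩
  -- The truncated geometric sequence is put below a sequence of minima with crossing point `2^k =
  -- 1/t`.
  have hterm : ∀ k : ℕ, (if 1 ≤ (2 : ℝ≥0∞) ^ (k : ℝ) * t then
      2 ^ (-((k : ℝ) * ε)) * F k else 0) ≤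
      min (t ^ (2 * ε) * 2 ^ ((k : ℝ) * ε)) (1 * 2 ^ (-((k : ℝ) * ε))) * g := by
    intro k
    split_ifs with hk
    · refine mul_le_mul' (le_min ?_ (by rw [one_mul])) (hg k)
      calc (2 : ℝ≥0∞) ^ (-((k : ℝ) * ε))
          = 2 ^ (-((k : ℝ) * (2 * ε))) * 2 ^ ((k : ℝ) * ε) := by
            rw [← two_rpow_add]; congr 1; ring
        _ ≤ _ := by
            gcongr
            exact two_rpow_neg_mul_le_rpow hk (by positivity)
    · exact zero_le
  have hS := (ENNReal.tsum_le_tsum hterm).trans (le_of_eq ENNReal.tsum_mul_right)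
  have hS2 := ENNReal.rpow_le_rpow (hS.trans (mul_le_mul' (hsum _ 1) le_rfl)) hp.le
  have e1 : 2 * ε * (ε / (ε + ε)) = ε := by field_simp; ring
  rw [ENNReal.one_rpow, mul_one, ENNReal.mul_rpow_of_nonneg _ _ hp.le,
    ENNReal.mul_rpow_of_nonneg _ _ hp.le, ← ENNReal.rpow_mul t (2 * ε), e1,
    ← ENNReal.rpow_mul t ε] at hS2
  refine (mul_le_mul' hS2 le_rfl).trans (le_of_eq ?_)
  have e4 : t ^ (ε * p) * t ^ γ₁ = t ^ γ₀ := by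
    rw [← ENNReal.rpow_add _ _ ht ht']
    congr 1
    rw [hε]
    field_simp
    ring
  rw [← e4]
  ring

/-- The pointwise bound for the part of the sum with frequencies above `|x|⁻¹`. -/
theorem exists_tsum_high_le {p₀ p₁ γ₀ γ₁ D : ℝ} (hp₀ : 0 < p₀) (hp : p₀ ≤ p₁) (hD : 0 < D)
    (hγ : γ₁ / p₁ ≤ γ₀ / p₀) (hδ : (D + γ₁) / p₁ < (D + γ₀) / p₀) {C₁ : ℝ≥0∞} (hC₁ : C₁ ≠ ∞) :
    ∃ C : ℝ≥0∞, C ≠ ∞ ∧ ∀ (F : ℕ → ℝ≥0∞) (g I t : ℝ≥0∞), t ≠ 0 → t ≠ ∞ → (∀ k, F k ≤ g) →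
      (∀ k : ℕ, 1 ≤ (2 : ℝ≥0∞) ^ (k : ℝ) * t →
        F k ^ p₀ ≤ C₁ * (2 ^ ((k : ℝ) * D) * (t ^ (-γ₀) * I))) →
      (∑' k : ℕ, if 1 ≤ (2 : ℝ≥0∞) ^ (k : ℝ) * t then
        2 ^ (-((k : ℝ) * ((D + γ₀) / p₀ - (D + γ₁) / p₁))) * F k else 0) ^ p₁ * t ^ γ₁ ≤
        C * I ^ (p₁ / p₀ - 1) * (g ^ p₀ * t ^ γ₀) := by
  rcases hp.eq_or_lt with rfl | hlt
  · have hγ' : γ₁ < γ₀ := by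
      rw [div_lt_div_iff_of_pos_right hp₀] at hδ
      linarith
    obtain ⟨C, hC, h⟩ := exists_tsum_high_le_of_eq (D := D) hp₀ hγ'
    refine ⟨C, hC, fun F g I t ht ht' hg _ => ?_⟩
    rw [div_self hp₀.ne', sub_self, ENNReal.rpow_zero, mul_one]
    exact h F g t ht ht' hg
  · exact exists_tsum_high_le_of_lt hp₀ hlt hD hγ hC₁

end HighFrequencies

/-! ### Frequencies below `|x|⁻¹`. -/

section LowFrequencies

theorem tsum_rpow_mul_rpow_le (f g : ℕ → ℝ≥0∞) {p q : ℝ} (hp : 0 ≤ p) (hq : 0 ≤ q)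
    (hpq : p + q = 1) :
    ∑' k, f k ^ p * g k ^ q ≤ (∑' k, f k) ^ p * (∑' k, g k) ^ q := by
  simp_rw [← lintegral_count]
  exact ENNReal.lintegral_mul_norm_pow_le (by fun_prop) (by fun_prop) hp hq hpq

/-- The pointwise bound for the part of the sum with frequencies below `|x|⁻¹`. -/
theorem exists_tsum_low_le {p κ : ℝ} (hp : 1 < p) (hκ : 0 < κ) :
    ∃ C : ℝ≥0∞, C ≠ ∞ ∧ ∀ (B : ℕ → ℝ≥0∞) (t : ℝ≥0∞), t ≠ 0 → t ≠ ∞ →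
      (∑' k : ℕ, if (2 : ℝ≥0∞) ^ (k : ℝ) * t ≤ 1 then
        2 ^ ((k : ℝ) * (κ / p)) * B k ^ p⁻¹ else 0) ^ p ≤
      C * t ^ (-(κ / 2)) *
        ∑' k : ℕ, if (2 : ℝ≥0∞) ^ (k : ℝ) * t ≤ 1 then 2 ^ ((k : ℝ) * (κ / 2)) * B k else 0 := by
  have hp0 : 0 < p := by linarith
  have hp1 : 0 < p - 1 := by linarith
  -- With this choice `2^{kκ/p} = (2^{kη})^{1-1/p} (2^{kκ/2})^{1/p}`. In Hölder's inequality the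
  -- first factor sums to order `t^{-η}`, and half of the growth stays with `B`.
  set η := κ / (2 * (p - 1)) with hη
  have hη0 : 0 < η := by positivity
  have hq : 0 < 1 - p⁻¹ := by
    rw [sub_pos]; exact inv_lt_one_of_one_lt₀ hp
  obtain ⟨K, hK, hsum⟩ := exists_tsum_min_le hη0 hη0
  refine ⟨K ^ (p - 1), ENNReal.rpow_ne_top_of_nonneg hp1.le hK, fun B t ht ht' => ?_⟩
  have hholder := tsum_rpow_mul_rpow_le
    (fun k : ℕ => if (2 : ℝ≥0∞) ^ (k : ℝ) * t ≤ 1 then 2 ^ ((k : ℝ) * η) else 0)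
    (fun k : ℕ => if (2 : ℝ≥0∞) ^ (k : ℝ) * t ≤ 1 then 2 ^ ((k : ℝ) * (κ / 2)) * B k else 0)
    hq.le (inv_nonneg.2 hp0.le) (by ring)
  have hterm : ∀ k : ℕ, (if (2 : ℝ≥0∞) ^ (k : ℝ) * t ≤ 1 then
      2 ^ ((k : ℝ) * (κ / p)) * B k ^ p⁻¹ else 0) =
      (if (2 : ℝ≥0∞) ^ (k : ℝ) * t ≤ 1 then 2 ^ ((k : ℝ) * η) else 0) ^ (1 - p⁻¹) *
      (if (2 : ℝ≥0∞) ^ (k : ℝ) * t ≤ 1 then 2 ^ ((k : ℝ) * (κ / 2)) * B k else 0) ^ p⁻¹ := by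
    intro k
    split_ifs with hk
    · rw [ENNReal.mul_rpow_of_nonneg _ _ (inv_nonneg.2 hp0.le), ← mul_assoc, ← ENNReal.rpow_mul,
        ← ENNReal.rpow_mul, ← two_rpow_add]
      congr 2
      rw [hη]
      field_simp
      ring
    · rw [ENNReal.zero_rpow_of_pos hq, zero_mul]
  have hgeom : ∑' k : ℕ, (if (2 : ℝ≥0∞) ^ (k : ℝ) * t ≤ 1 then (2 : ℝ≥0∞) ^ ((k : ℝ) * η) else 0) ≤
      K * t ^ (-η) := by
    have hle : ∀ k : ℕ, (if (2 : ℝ≥0∞) ^ (k : ℝ) * t ≤ 1 then (2 : ℝ≥0∞) ^ ((k : ℝ) * η) else 0) ≤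
        min (1 * 2 ^ ((k : ℝ) * η)) (t ^ (-(2 * η)) * 2 ^ (-((k : ℝ) * η))) := by
      intro k
      split_ifs with hk
      · refine le_min (by rw [one_mul]) ?_
        calc (2 : ℝ≥0∞) ^ ((k : ℝ) * η) = 2 ^ ((k : ℝ) * (2 * η)) * 2 ^ (-((k : ℝ) * η)) := by
              rw [← two_rpow_add]; congr 1; ring
          _ ≤ _ := by
              gcongr
              exact two_rpow_mul_le_rpow_neg hk (by positivity)
      · exact zero_le
    refine (ENNReal.tsum_le_tsum hle).trans ((hsum 1 _).trans (le_of_eq ?_))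
    rw [ENNReal.one_rpow, one_mul, ← ENNReal.rpow_mul]
    congr 2
    field_simp
    ring
  simp_rw [hterm]
  refine (ENNReal.rpow_le_rpow (hholder.trans (mul_le_mul'
    (ENNReal.rpow_le_rpow hgeom hq.le) le_rfl)) hp0.le).trans (le_of_eq ?_)
  have e1 : (1 - p⁻¹) * p = p - 1 := by field_simp
  have e2 : -η * (p - 1) = -(κ / 2) := by rw [hη]; field_simp
  rw [ENNReal.mul_rpow_of_nonneg _ _ hp0.le, ← ENNReal.rpow_mul, ← ENNReal.rpow_mul,
    inv_mul_cancel₀ hp0.ne', ENNReal.rpow_one, e1, ENNReal.mul_rpow_of_nonneg _ _ hp1.le,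
    ← ENNReal.rpow_mul, e2]

end LowFrequencies

end WeightedTL

end

noncomputable section

namespace WeightedTL

/-! ### Summation over the dyadic scales -/

section SequenceInequality

variable {d : ℕ}

theorem bracket_rpow_le_of_one_le {z : Rd d} (h : 1 ≤ ‖z‖ₑ) (c : ℝ) :
    bracket z ^ c ≤ 2 ^ |c| * ‖z‖ₑ ^ c := by
  rcases le_total 0 c with hc | hc
  · rw [abs_of_nonneg hc, ← ENNReal.mul_rpow_of_nonneg _ _ hc]
    refine ENNReal.rpow_le_rpow ?_ hc
    rw [two_mul]; unfold bracket; gcongr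
  · calc bracket z ^ c ≤ 1 * ‖z‖ₑ ^ c := by
          have h' : ‖z‖ₑ ≤ bracket z := by unfold bracket; exact le_add_self
          have := ENNReal.inv_le_inv.2 (ENNReal.rpow_le_rpow h' (neg_nonneg.2 hc))
          rwa [← ENNReal.rpow_neg, ← ENNReal.rpow_neg, neg_neg, ← one_mul (‖z‖ₑ ^ c)] at this
      _ ≤ _ := by
          gcongr
          rw [← ENNReal.rpow_zero (x := 2)]
          exact ENNReal.rpow_le_rpow_of_exponent_le (by norm_num) (abs_nonneg c)

theorem bracket_rpow_le_of_le_one {z : Rd d} (h : ‖z‖ₑ ≤ 1) (c : ℝ) :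
    bracket z ^ c ≤ 2 ^ |c| := by
  refine (bracket_rpow_le z (le_abs_self c)).trans (ENNReal.rpow_le_rpow ?_ (abs_nonneg c))
  rw [← one_add_one_eq_two]; unfold bracket; gcongr

/-- The functions `F k` are controlled pointwise by weighted means at scale `2⁻ᵏ`. -/
def LocalBound (p a M : ℝ) (C : ℝ≥0∞) (F : ℕ → Rd d → ℝ≥0∞) : Prop :=
  ∀ (k : ℕ) (x : Rd d), F k x ^ p ≤ C * bracket ((2 : ℝ) ^ k • x) ^ (-a) *
    (2 ^ ((k : ℝ) * (d + a)) * ∫⁻ y, F k y ^ p * ‖y‖ₑ ^ a *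
      bracket ((2 : ℝ) ^ k • (x - y)) ^ (-M))

/-- Away from the ball of radius `2^{-k}` the bracket of `2^k x` is comparable to `2^k ‖x‖`. With `M
= 0` the kernel is absent and the whole weighted integral appears. -/
theorem LocalBound.le_of_high {p γ : ℝ} {C : ℝ≥0∞} {F : ℕ → Rd d → ℝ≥0∞} (hp : 0 ≤ p)
    (hF : LocalBound p γ 0 C F) {k : ℕ} {x : Rd d} (hk : 1 ≤ (2 : ℝ≥0∞) ^ (k : ℝ) * ‖x‖ₑ) :
    F k x ^ p ≤ C * 2 ^ |γ| * (2 ^ ((k : ℝ) * d) *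
      (‖x‖ₑ ^ (-γ) * ∫⁻ y, (⨆ j, F j y) ^ p * ‖y‖ₑ ^ γ)) := by
  have h1 : bracket ((2 : ℝ) ^ k • x) ^ (-γ) ≤
      2 ^ |γ| * (2 ^ ((k : ℝ) * -γ) * ‖x‖ₑ ^ (-γ)) := by
    rw [← enorm_two_pow_smul] at hk
    have := bracket_rpow_le_of_one_le hk (-γ)
    rwa [abs_neg, enorm_two_pow_smul, ENNReal.mul_rpow_of_ne_top (two_rpow_ne_top _)
      enorm_ne_top, ← ENNReal.rpow_mul] at this
  have h2 : ∫⁻ y, F k y ^ p * ‖y‖ₑ ^ γ * bracket ((2 : ℝ) ^ k • (x - y)) ^ (-(0 : ℝ)) ≤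
      ∫⁻ y, (⨆ j, F j y) ^ p * ‖y‖ₑ ^ γ := by
    refine lintegral_mono fun y => ?_
    rw [neg_zero, ENNReal.rpow_zero, mul_one]
    gcongr
    exact le_iSup (fun j => F j y) k
  refine (hF k x).trans ((mul_le_mul' (mul_le_mul' le_rfl h1) (mul_le_mul' le_rfl h2)).trans
    (le_of_eq ?_))
  have e : (2 : ℝ≥0∞) ^ ((k : ℝ) * d) = 2 ^ ((k : ℝ) * -γ) * 2 ^ ((k : ℝ) * (d + γ)) := by
    rw [← two_rpow_add]; congr 1; ring
  rw [e]
  ring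

/-- The part of a weighted integral that is seen at scale `2⁻ᵏ` around the origin. -/
def dyadicPart (W : Rd d → ℝ≥0∞) (k : ℕ) : ℝ≥0∞ :=
  ∫⁻ y, W y * min (‖y‖ₑ * 2 ^ ((k : ℝ) * 1)) (‖y‖ₑ⁻¹ * 2 ^ (-((k : ℝ) * 1)))

theorem dyadicPart_le (W : Rd d → ℝ≥0∞) (k : ℕ) : dyadicPart W k ≤ ∫⁻ y, W y := by
  refine lintegral_mono fun y => ?_
  refine mul_le_of_le_one_right' ?_
  rcases le_total (‖y‖ₑ * 2 ^ ((k : ℝ) * 1)) 1 with h | h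
  · exact (min_le_left _ _).trans h
  · refine (min_le_right _ _).trans ?_
    rw [ENNReal.rpow_neg, ← ENNReal.mul_inv (Or.inr (two_rpow_ne_top _)) (Or.inl enorm_ne_top)]
    exact ENNReal.inv_le_one.2 h

/-- For fixed `y ≠ 0` the kernels are minima with `a = ‖y‖ₑ`, `b = ‖y‖ₑ⁻¹` and `α = β = 1`; the
geometric mean of `a` and `b` is `1`, so their sum over `k` is bounded uniformly in `y`. -/
theorem exists_tsum_dyadicPart_le (hd : 1 ≤ d) :
    ∃ C : ℝ≥0∞, C ≠ ∞ ∧ ∀ W : Rd d → ℝ≥0∞, Measurable W →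
      ∑' k, dyadicPart W k ≤ C * ∫⁻ y, W y := by
  obtain ⟨C, hC, h⟩ := exists_tsum_min_le (zero_lt_one (α := ℝ)) (zero_lt_one (α := ℝ))
  refine ⟨C, hC, fun W hW => ?_⟩
  unfold dyadicPart
  rw [← lintegral_tsum fun k => by fun_prop, ← lintegral_const_mul' _ _ hC]
  refine lintegral_mono_ae ?_
  filter_upwards [ae_ne_zero hd] with y hy
  have hy0 : ‖y‖ₑ ≠ 0 := by simpa using hy
  rw [ENNReal.tsum_mul_left, mul_comm]
  refine mul_le_mul' ((h _ _).trans (le_of_eq ?_)) le_rfl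
  rw [← ENNReal.mul_rpow_of_nonneg _ _ (by norm_num), ENNReal.mul_inv_cancel hy0 enorm_ne_top,
    ENNReal.one_rpow, mul_one]

theorem mul_rpow_neg_two_le_min (T : ℝ≥0∞) :
    T * (1 + T) ^ (-(2 : ℝ)) ≤ min T T⁻¹ := by
  have h1 : 1 ≤ 1 + T := le_self_add
  refine le_min ?_ ?_
  · refine mul_le_of_le_one_right' ?_
    rw [ENNReal.rpow_neg]
    exact ENNReal.inv_le_one.2 (ENNReal.one_le_rpow h1 (by norm_num))
  · rw [ENNReal.le_inv_iff_mul_le, ENNReal.rpow_neg, mul_right_comm, ← div_eq_mul_inv]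
    refine ENNReal.div_le_of_le_mul ?_
    rw [one_mul, ENNReal.rpow_two, sq]
    gcongr <;> exact le_add_self

/-- The raised weight exponent `γ + 1` supplies a factor `T = 2^k ‖y‖` that is small near the
origin, and the decay of order two beats it far away. Together they give `min T T⁻¹`, the kernel of
`dyadicPart`. -/
theorem LocalBound.le_of_low (hd : 1 ≤ d) {p γ : ℝ} {C : ℝ≥0∞} {F : ℕ → Rd d → ℝ≥0∞} (hp : 0 ≤ p)
    (hF : LocalBound p (γ + 1) 2 C F) {k : ℕ} {x : Rd d}
    (hk : (2 : ℝ≥0∞) ^ (k : ℝ) * ‖x‖ₑ ≤ 1) :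
    F k x ^ p ≤ C * 2 ^ |γ + 1| * 2 ^ (2 : ℝ) * (2 ^ ((k : ℝ) * (d + γ)) *
      dyadicPart (fun y => (⨆ j, F j y) ^ p * ‖y‖ₑ ^ γ) k) := by
  rw [← enorm_two_pow_smul] at hk
  have h1 : bracket ((2 : ℝ) ^ k • x) ^ (-(γ + 1)) ≤ 2 ^ |γ + 1| := by
    have := bracket_rpow_le_of_le_one hk (-(γ + 1))
    rwa [abs_neg] at this
  have h2 : 2 ^ (k : ℝ) * ∫⁻ y, F k y ^ p * ‖y‖ₑ ^ (γ + 1) *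
      bracket ((2 : ℝ) ^ k • (x - y)) ^ (-(2 : ℝ)) ≤
      2 ^ (2 : ℝ) * dyadicPart (fun y => (⨆ j, F j y) ^ p * ‖y‖ₑ ^ γ) k := by
    unfold dyadicPart
    rw [← lintegral_const_mul' _ _ (two_rpow_ne_top _), ← lintegral_const_mul' _ _
      (two_rpow_ne_top _)]
    refine lintegral_mono_ae ?_
    filter_upwards [ae_ne_zero hd] with y hy
    have hy0 : ‖y‖ₑ ≠ 0 := by simpa using hy
    set T := (2 : ℝ≥0∞) ^ (k : ℝ) * ‖y‖ₑ with hT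
    have h3 : bracket ((2 : ℝ) ^ k • (x - y)) ^ (-(2 : ℝ)) ≤
        2 ^ (2 : ℝ) * (1 + T) ^ (-(2 : ℝ)) := by
      have h := bracket_rpow_add_le (-((2 : ℝ) ^ k • y)) ((2 : ℝ) ^ k • x) (-2)
      rw [bracket_neg, neg_add_eq_sub, ← smul_sub] at h
      refine h.trans ?_
      rw [mul_comm]
      refine mul_le_mul' ?_ (le_of_eq ?_)
      · have := bracket_rpow_le_of_le_one hk |(-2 : ℝ)|
        simpa using this
      · rw [bracket, enorm_two_pow_smul]
    have h4 : min T T⁻¹ = min (‖y‖ₑ * 2 ^ ((k : ℝ) * 1)) (‖y‖ₑ⁻¹ * 2 ^ (-((k : ℝ) * 1))) := by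
      rw [hT, mul_one, ENNReal.rpow_neg,
        ENNReal.mul_inv (Or.inr enorm_ne_top) (Or.inl (two_rpow_ne_top _)),
        mul_comm, mul_comm ‖y‖ₑ⁻¹]
    have h5 : F k y ≤ ⨆ j, F j y := le_iSup (fun j => F j y) k
    calc 2 ^ (k : ℝ) * (F k y ^ p * ‖y‖ₑ ^ (γ + 1) *
          bracket ((2 : ℝ) ^ k • (x - y)) ^ (-(2 : ℝ)))
        ≤ 2 ^ (k : ℝ) * ((⨆ j, F j y) ^ p * ‖y‖ₑ ^ (γ + 1) *
          (2 ^ (2 : ℝ) * (1 + T) ^ (-(2 : ℝ)))) := by gcongr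
      _ = 2 ^ (2 : ℝ) * ((⨆ j, F j y) ^ p * ‖y‖ₑ ^ γ * (T * (1 + T) ^ (-(2 : ℝ)))) := by
          rw [ENNReal.rpow_add _ _ hy0 enorm_ne_top, ENNReal.rpow_one, hT]
          ring
      _ ≤ _ := by
          rw [← h4]
          gcongr
          exact mul_rpow_neg_two_le_min T
  refine (hF k x).trans ?_
  have e : (2 : ℝ≥0∞) ^ ((k : ℝ) * (d + (γ + 1))) = 2 ^ ((k : ℝ) * (d + γ)) * 2 ^ (k : ℝ) := by
    rw [← two_rpow_add]; congr 1; ring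
  rw [e, mul_assoc (2 ^ ((k : ℝ) * (d + γ)))]
  refine (mul_le_mul' (mul_le_mul' le_rfl h1) (mul_le_mul' le_rfl h2)).trans (le_of_eq ?_)
  ring

theorem exists_lintegral_dyadic_ball (hd : 1 ≤ d) {c : ℝ} (hc : -(d : ℝ) < c) :
    ∃ C : ℝ≥0∞, C ≠ ∞ ∧ ∀ k : ℕ,
      ∫⁻ x : Rd d, (if (2 : ℝ≥0∞) ^ (k : ℝ) * ‖x‖ₑ ≤ 1 then ‖x‖ₑ ^ c else 0) =
        2 ^ (-((k : ℝ) * (d + c))) * C := by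
  set q : Rd d → ℝ≥0∞ := fun y => if ‖y‖ₑ ≤ 1 then ‖y‖ₑ ^ c else 0 with hq
  have hqm : Measurable q := by
    refine Measurable.ite (measurableSet_le measurable_enorm measurable_const) ?_ measurable_const
    fun_prop
  refine ⟨∫⁻ y, q y, ?_, fun k => ?_⟩
  · refine ne_top_of_le_ne_top (lintegral_ball_enorm_rpow_lt_top hd hc 2).ne ?_
    rw [← lintegral_indicator measurableSet_ball]
    refine lintegral_mono fun y => ?_
    rw [hq]
    dsimp only
    split_ifs with hy
    · rw [Set.indicator_of_mem]
      rw [← ofReal_norm, ENNReal.ofReal_le_one] at hy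
      rw [mem_ball_zero_iff]
      linarith
    · exact zero_le
  · have e : ∀ x : Rd d, q ((2 : ℝ) ^ k • x) = 2 ^ ((k : ℝ) * c) *
        (if (2 : ℝ≥0∞) ^ (k : ℝ) * ‖x‖ₑ ≤ 1 then ‖x‖ₑ ^ c else 0) := by
      intro x
      rw [hq]
      dsimp only
      rw [enorm_two_pow_smul, mul_ite, mul_zero]
      congr 1
      rw [ENNReal.mul_rpow_of_ne_top (two_rpow_ne_top _) enorm_ne_top, ← ENNReal.rpow_mul]
    rw [lintegral_comp_two_pow_smul k hqm]
    simp_rw [e]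
    rw [lintegral_const_mul' _ _ (two_rpow_ne_top _), ← mul_assoc, ← mul_assoc, ← two_rpow_add,
      ← two_rpow_add]
    ring_nf
    simp

variable {p₀ p₁ γ₀ γ₁ : ℝ}

/-- After Hölder's inequality in `k`, integrating in `x` over `‖x‖ ≤ 2^{-k}` cancels the powers of
two exactly. What remains is the sum of the dyadic parts, which is at most a multiple of `I`. -/
theorem exists_lintegral_low_le (hd : 1 ≤ d) (hp₀ : 1 < p₀) (hp : p₀ ≤ p₁) (hγ₁ : -(d : ℝ) < γ₁)
    {C₂ : ℝ≥0∞} (hC₂ : C₂ ≠ ∞) :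
    ∃ C : ℝ≥0∞, C ≠ ∞ ∧ ∀ F : ℕ → Rd d → ℝ≥0∞, (∀ k, Measurable (F k)) →
      LocalBound p₀ (γ₀ + 1) 2 C₂ F →
      ∫⁻ x, (∑' k : ℕ, if (2 : ℝ≥0∞) ^ (k : ℝ) * ‖x‖ₑ ≤ 1 then
        2 ^ (-((k : ℝ) * ((d + γ₀) / p₀ - (d + γ₁) / p₁))) * F k x else 0) ^ p₁ * ‖x‖ₑ ^ γ₁ ≤
        C * (∫⁻ x, (⨆ k, F k x) ^ p₀ * ‖x‖ₑ ^ γ₀) ^ (p₁ / p₀) := by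
  have hp₀0 : 0 < p₀ := by linarith
  have hp₁0 : 0 < p₁ := by linarith
  set κ := d + γ₁ with hκ
  have hκ0 : 0 < κ := by linarith
  obtain ⟨K, hK, hlow⟩ := exists_tsum_low_le (hp₀.trans_le hp) hκ0
  -- The exponent is admissible because `d + γ₁ - κ/2 = κ/2 > 0`.
  obtain ⟨J, hJ, hball⟩ := exists_lintegral_dyadic_ball hd (c := γ₁ - κ / 2) (by linarith)
  obtain ⟨S, hS, hsum⟩ := exists_tsum_dyadicPart_le hd
  set C₃ := C₂ * 2 ^ |γ₀ + 1| * 2 ^ (2 : ℝ) with hC₃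
  have hC₃' : C₃ ≠ ∞ := by simp [hC₃, ENNReal.mul_ne_top, hC₂]
  have hr0 : 0 ≤ p₁ / p₀ - 1 := by rw [sub_nonneg, one_le_div hp₀0]; exact hp
  have hr0' : 0 ≤ p₁ / p₀ := by positivity
  have hinv : 0 ≤ p₀⁻¹ - p₁⁻¹ := sub_nonneg.2 (inv_anti₀ hp₀0 hp)
  refine ⟨C₃ ^ (p₁ / p₀) * K * J * S, ENNReal.mul_ne_top (ENNReal.mul_ne_top
    (ENNReal.mul_ne_top (ENNReal.rpow_ne_top_of_nonneg hr0' hC₃') hK) hJ) hS,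
    fun F hFm hF => ?_⟩
  set W : Rd d → ℝ≥0∞ := fun y => (⨆ j, F j y) ^ p₀ * ‖y‖ₑ ^ γ₀ with hW
  have hWm : Measurable W := ((Measurable.iSup hFm).pow_const _).mul (by fun_prop)
  set I := ∫⁻ x, W x with hI
  set B := dyadicPart W with hB
  have hBI : ∀ k, B k ≤ I := dyadicPart_le W
  have hpt : ∀ x : Rd d, x ≠ 0 → (∑' k : ℕ, if (2 : ℝ≥0∞) ^ (k : ℝ) * ‖x‖ₑ ≤ 1 then
      2 ^ (-((k : ℝ) * ((d + γ₀) / p₀ - κ / p₁))) * F k x else 0) ^ p₁ * ‖x‖ₑ ^ γ₁ ≤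
      C₃ ^ (p₁ / p₀) * I ^ (p₁ / p₀ - 1) * K * ∑' k : ℕ, 2 ^ ((k : ℝ) * (κ / 2)) * B k *
        (if (2 : ℝ≥0∞) ^ (k : ℝ) * ‖x‖ₑ ≤ 1 then ‖x‖ₑ ^ (γ₁ - κ / 2) else 0) := by
    intro x hx
    have hx0 : ‖x‖ₑ ≠ 0 := by simpa using hx
    have hterm : ∀ k : ℕ, (if (2 : ℝ≥0∞) ^ (k : ℝ) * ‖x‖ₑ ≤ 1 then
        2 ^ (-((k : ℝ) * ((d + γ₀) / p₀ - κ / p₁))) * F k x else 0) ≤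
        C₃ ^ p₀⁻¹ * I ^ (p₀⁻¹ - p₁⁻¹) * (if (2 : ℝ≥0∞) ^ (k : ℝ) * ‖x‖ₑ ≤ 1 then
          2 ^ ((k : ℝ) * (κ / p₁)) * B k ^ p₁⁻¹ else 0) := by
      intro k
      split_ifs with hk
      · have h1 := mul_rpow_inv_rpow hp₀0 (hF.le_of_low hd hp₀0.le hk)
        have h0 : 0 ≤ p₀⁻¹ := by positivity
        rw [← hC₃, ENNReal.mul_rpow_of_nonneg C₃ _ h0,
          ENNReal.mul_rpow_of_nonneg (2 ^ ((k : ℝ) * (d + γ₀))) _ h0, ← ENNReal.rpow_mul] at h1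
        -- All but the power `1/p₁` of `B k` is traded for the total `I`, so that after raising to
        -- the power `p₁` each `B k` enters linearly.
        have h2 : B k ^ p₀⁻¹ ≤ I ^ (p₀⁻¹ - p₁⁻¹) * B k ^ p₁⁻¹ := by
          calc B k ^ p₀⁻¹ = B k ^ (p₀⁻¹ - p₁⁻¹) * B k ^ p₁⁻¹ := by
                rw [← ENNReal.rpow_add_of_nonneg _ _ hinv (by positivity), sub_add_cancel]
            _ ≤ _ := by
                gcongr
                exact hBI k
        calc 2 ^ (-((k : ℝ) * ((d + γ₀) / p₀ - κ / p₁))) * F k x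
            ≤ 2 ^ (-((k : ℝ) * ((d + γ₀) / p₀ - κ / p₁))) *
              (C₃ ^ p₀⁻¹ * (2 ^ ((k : ℝ) * (d + γ₀) * p₀⁻¹) *
                (I ^ (p₀⁻¹ - p₁⁻¹) * B k ^ p₁⁻¹))) := by
              gcongr
              exact h1.trans (mul_le_mul' le_rfl (mul_le_mul' le_rfl h2))
          _ = C₃ ^ p₀⁻¹ * I ^ (p₀⁻¹ - p₁⁻¹) *
              ((2 ^ (-((k : ℝ) * ((d + γ₀) / p₀ - κ / p₁))) * 2 ^ ((k : ℝ) * (d + γ₀) * p₀⁻¹)) *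
                B k ^ p₁⁻¹) := by ring
          _ = _ := by
              rw [← two_rpow_add]
              congr 4
              field_simp
              ring
      · exact zero_le
    have hsum1 := (ENNReal.tsum_le_tsum hterm).trans (le_of_eq ENNReal.tsum_mul_left)
    have hsum2 := ENNReal.rpow_le_rpow hsum1 hp₁0.le
    have e1 : (p₀⁻¹ - p₁⁻¹) * p₁ = p₁ / p₀ - 1 := by field_simp
    have e2 : p₀⁻¹ * p₁ = p₁ / p₀ := by field_simp
    rw [ENNReal.mul_rpow_of_nonneg _ _ hp₁0.le, ENNReal.mul_rpow_of_nonneg _ _ hp₁0.le,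
      ← ENNReal.rpow_mul C₃, ← ENNReal.rpow_mul I, e1, e2] at hsum2
    refine (mul_le_mul' (hsum2.trans (mul_le_mul' le_rfl (hlow B _ hx0 enorm_ne_top)))
      le_rfl).trans (le_of_eq ?_)
    have e3 : ‖x‖ₑ ^ (γ₁ - κ / 2) = ‖x‖ₑ ^ (-(κ / 2)) * ‖x‖ₑ ^ γ₁ := by
      rw [← ENNReal.rpow_add _ _ hx0 enorm_ne_top]; congr 1; ring
    have e4 : ∀ k : ℕ, 2 ^ ((k : ℝ) * (κ / 2)) * B k *
        (if (2 : ℝ≥0∞) ^ (k : ℝ) * ‖x‖ₑ ≤ 1 then ‖x‖ₑ ^ (γ₁ - κ / 2) else 0) =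
        (‖x‖ₑ ^ (-(κ / 2)) * ‖x‖ₑ ^ γ₁) * (if (2 : ℝ≥0∞) ^ (k : ℝ) * ‖x‖ₑ ≤ 1 then
          2 ^ ((k : ℝ) * (κ / 2)) * B k else 0) := by
      intro k
      split_ifs
      · rw [e3]; ring
      · simp
    simp_rw [e4]
    rw [ENNReal.tsum_mul_left]
    ring
  have hmeas : ∀ k : ℕ, Measurable fun x : Rd d =>
      (if (2 : ℝ≥0∞) ^ (k : ℝ) * ‖x‖ₑ ≤ 1 then ‖x‖ₑ ^ (γ₁ - κ / 2) else 0) := by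
    intro k
    refine Measurable.ite (measurableSet_le (by fun_prop) measurable_const) ?_ measurable_const
    fun_prop
  calc ∫⁻ x, (∑' k : ℕ, if (2 : ℝ≥0∞) ^ (k : ℝ) * ‖x‖ₑ ≤ 1 then
        2 ^ (-((k : ℝ) * ((d + γ₀) / p₀ - κ / p₁))) * F k x else 0) ^ p₁ * ‖x‖ₑ ^ γ₁
      ≤ ∫⁻ x, C₃ ^ (p₁ / p₀) * I ^ (p₁ / p₀ - 1) * K * ∑' k : ℕ, 2 ^ ((k : ℝ) * (κ / 2)) * B k *
        (if (2 : ℝ≥0∞) ^ (k : ℝ) * ‖x‖ₑ ≤ 1 then ‖x‖ₑ ^ (γ₁ - κ / 2) else 0) := by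
        refine lintegral_mono_ae ?_
        filter_upwards [ae_ne_zero hd] with x hx
        exact hpt x hx
    _ = C₃ ^ (p₁ / p₀) * I ^ (p₁ / p₀ - 1) * K * ∑' k : ℕ, 2 ^ ((k : ℝ) * (κ / 2)) * B k *
        ∫⁻ x : Rd d, (if (2 : ℝ≥0∞) ^ (k : ℝ) * ‖x‖ₑ ≤ 1 then ‖x‖ₑ ^ (γ₁ - κ / 2) else 0) := by
        rw [lintegral_const_mul _ (Measurable.tsum fun k => (hmeas k).const_mul _),
          lintegral_tsum fun k => ((hmeas k).const_mul _).aemeasurable]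
        congr 1
        refine tsum_congr fun k => ?_
        rw [lintegral_const_mul _ (hmeas k)]
    _ = C₃ ^ (p₁ / p₀) * I ^ (p₁ / p₀ - 1) * K * ∑' k : ℕ, J * B k := by
        congr 1
        refine tsum_congr fun k => ?_
        rw [hball]
        calc _ = (2 ^ ((k : ℝ) * (κ / 2)) * 2 ^ (-((k : ℝ) * (d + (γ₁ - κ / 2))))) * (J * B k) := by
              ring
          _ = _ := by
              rw [← two_rpow_add]
              have : (k : ℝ) * (κ / 2) + -((k : ℝ) * (d + (γ₁ - κ / 2))) = 0 := by
                rw [hκ]; ring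
              rw [this, ENNReal.rpow_zero, one_mul]
    _ ≤ C₃ ^ (p₁ / p₀) * I ^ (p₁ / p₀ - 1) * K * (J * (S * I)) := by
        rw [ENNReal.tsum_mul_left]
        gcongr
        exact hsum W hWm
    _ = C₃ ^ (p₁ / p₀) * K * J * S * (I ^ (p₁ / p₀ - 1) * I ^ (1 : ℝ)) := by
        rw [ENNReal.rpow_one]; ring
    _ = _ := by
        rw [← ENNReal.rpow_add_of_nonneg _ _ hr0 zero_le_one, sub_add_cancel]

/-- The Sobolev type inequality with optimal summation index. -/
theorem exists_lintegral_tsum_le (hd : 1 ≤ d) (hp₀ : 1 < p₀) (hp : p₀ ≤ p₁)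
    (hγ₁ : -(d : ℝ) < γ₁) (hγ : γ₁ / p₁ ≤ γ₀ / p₀) (hδ : (d + γ₁) / p₁ < (d + γ₀) / p₀)
    {C₁ C₂ : ℝ≥0∞} (hC₁ : C₁ ≠ ∞) (hC₂ : C₂ ≠ ∞) :
    ∃ C : ℝ≥0∞, C ≠ ∞ ∧ ∀ F : ℕ → Rd d → ℝ≥0∞, (∀ k, Measurable (F k)) →
      LocalBound p₀ γ₀ 0 C₁ F → LocalBound p₀ (γ₀ + 1) 2 C₂ F →
      ∫⁻ x, (∑' k : ℕ, 2 ^ (-((k : ℝ) * ((d + γ₀) / p₀ - (d + γ₁) / p₁))) * F k x) ^ p₁ *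
        ‖x‖ₑ ^ γ₁ ≤ C * (∫⁻ x, (⨆ k, F k x) ^ p₀ * ‖x‖ₑ ^ γ₀) ^ (p₁ / p₀) := by
  have hp₀0 : 0 < p₀ := by linarith
  have hp₁0 : 0 < p₁ := by linarith
  have hd0 : (0 : ℝ) < d := by exact_mod_cast hd
  have hr0 : 0 ≤ p₁ / p₀ - 1 := by rw [sub_nonneg, one_le_div hp₀0]; exact hp
  obtain ⟨L, hL, hlow⟩ := exists_lintegral_low_le (γ₀ := γ₀) hd hp₀ hp hγ₁ hC₂
  obtain ⟨H, hH, hhigh⟩ := exists_tsum_high_le hp₀0 hp hd0 hγ hδ (C₁ := C₁ * 2 ^ |γ₀|)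
    (ENNReal.mul_ne_top hC₁ (two_rpow_ne_top _))
  refine ⟨2 ^ (p₁ - 1) * (H + L), ENNReal.mul_ne_top (two_rpow_ne_top _)
    (ENNReal.add_ne_top.2 ⟨hH, hL⟩), fun F hFm hF1 hF2 => ?_⟩
  set δ := (d + γ₀) / p₀ - (d + γ₁) / p₁ with hδdef
  set I := ∫⁻ x, (⨆ k, F k x) ^ p₀ * ‖x‖ₑ ^ γ₀ with hI
  set hi : Rd d → ℝ≥0∞ := fun x => ∑' k : ℕ, if 1 ≤ (2 : ℝ≥0∞) ^ (k : ℝ) * ‖x‖ₑ then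
    2 ^ (-((k : ℝ) * δ)) * F k x else 0 with hhi
  set lo : Rd d → ℝ≥0∞ := fun x => ∑' k : ℕ, if (2 : ℝ≥0∞) ^ (k : ℝ) * ‖x‖ₑ ≤ 1 then
    2 ^ (-((k : ℝ) * δ)) * F k x else 0 with hlo
  have hlom : Measurable lo := by
    refine Measurable.tsum fun k => ?_
    exact Measurable.ite (measurableSet_le (by fun_prop) measurable_const)
      ((hFm k).const_mul _) measurable_const
  have hsupm : Measurable fun x => (⨆ k, F k x) ^ p₀ * ‖x‖ₑ ^ γ₀ :=
    ((Measurable.iSup hFm).pow_const _).mul (by fun_prop)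
  have hlom' : Measurable fun x => lo x ^ p₁ * ‖x‖ₑ ^ γ₁ :=
    (hlom.pow_const _).mul (by fun_prop)
  -- A term with `2^k ‖x‖ₑ = 1` is counted in both parts, which does no harm to an upper bound.
  have hsplit : ∀ x, ∑' k : ℕ, 2 ^ (-((k : ℝ) * δ)) * F k x ≤ hi x + lo x := by
    intro x
    rw [hhi, hlo]
    dsimp only
    rw [← ENNReal.tsum_add]
    refine ENNReal.tsum_le_tsum fun k => ?_
    rcases le_total 1 ((2 : ℝ≥0∞) ^ (k : ℝ) * ‖x‖ₑ) with h | h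
    · rw [if_pos h]; exact le_self_add
    · rw [if_pos h]; exact le_add_self
  have hhigh' : ∫⁻ x, hi x ^ p₁ * ‖x‖ₑ ^ γ₁ ≤ H * I ^ (p₁ / p₀) := by
    calc ∫⁻ x, hi x ^ p₁ * ‖x‖ₑ ^ γ₁
        ≤ ∫⁻ x, H * I ^ (p₁ / p₀ - 1) * ((⨆ k, F k x) ^ p₀ * ‖x‖ₑ ^ γ₀) := by
          refine lintegral_mono_ae ?_
          filter_upwards [ae_ne_zero hd] with x hx
          exact hhigh (fun k => F k x) _ I ‖x‖ₑ (by simpa using hx) enorm_ne_top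
            (fun k => le_iSup (fun k => F k x) k) fun k hk => hF1.le_of_high hp₀0.le hk
      _ = H * (I ^ (p₁ / p₀ - 1) * I ^ (1 : ℝ)) := by
          rw [lintegral_const_mul _ hsupm,
            ENNReal.rpow_one, mul_assoc]
      _ = _ := by rw [← ENNReal.rpow_add_of_nonneg _ _ hr0 zero_le_one, sub_add_cancel]
  calc ∫⁻ x, (∑' k : ℕ, 2 ^ (-((k : ℝ) * δ)) * F k x) ^ p₁ * ‖x‖ₑ ^ γ₁
      ≤ ∫⁻ x, 2 ^ (p₁ - 1) * (hi x ^ p₁ * ‖x‖ₑ ^ γ₁ + lo x ^ p₁ * ‖x‖ₑ ^ γ₁) := by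
        refine lintegral_mono fun x => ?_
        rw [← add_mul, ← mul_assoc]
        gcongr
        exact (ENNReal.rpow_le_rpow (hsplit x) hp₁0.le).trans
          (ENNReal.rpow_add_le_mul_rpow_add_rpow _ _ (by linarith))
    _ = 2 ^ (p₁ - 1) * ((∫⁻ x, hi x ^ p₁ * ‖x‖ₑ ^ γ₁) + ∫⁻ x, lo x ^ p₁ * ‖x‖ₑ ^ γ₁) := by
        rw [lintegral_const_mul' _ _ (two_rpow_ne_top _),
          lintegral_add_right _ hlom']
    _ ≤ 2 ^ (p₁ - 1) * (H * I ^ (p₁ / p₀) + L * I ^ (p₁ / p₀)) := by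
        exact mul_le_mul' le_rfl (add_le_add hhigh' (hlow F hFm hF2))
    _ = _ := by ring

end SequenceInequality

end WeightedTL

end

noncomputable section

namespace WeightedTL

/-! ### Sufficiency of the conditions -/

section CountingNorm

variable {E : Type*} [NormedAddCommGroup E]

theorem eLpNorm_count_eq_tsum {q : ℝ≥0∞} (hq : q ≠ 0) (hq' : q ≠ ∞) (g : ℕ → E) :
    eLpNorm g q Measure.count = (∑' k, ‖g k‖ₑ ^ q.toReal) ^ (1 / q.toReal) := by
  rw [eLpNorm_eq_lintegral_rpow_enorm_toReal hq hq', lintegral_count]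

/-- Each term is at most the `ℓ^{q₀}` norm `N`, so `N ^ (q₁ - q₀)` can be pulled out of the sum of
`q₁`-th powers. -/
theorem eLpNorm_count_anti {q₀ q₁ : ℝ≥0∞} (hq₀ : q₀ ≠ 0) (hq : q₀ ≤ q₁) (g : ℕ → E) :
    eLpNorm g q₁ Measure.count ≤ eLpNorm g q₀ Measure.count := by
  set N := eLpNorm g q₀ Measure.count with hN
  have hle : ∀ k, ‖g k‖ₑ ≤ N := fun k => enorm_le_eLpNorm_count g k hq₀
  rcases eq_or_ne q₁ ∞ with rfl | h1
  · rw [eLpNorm_exponent_top, eLpNormEssSup_count]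
    exact iSup_le hle
  have h0 : q₀ ≠ ∞ := ne_top_of_le_ne_top h1 hq
  have hq₁ : q₁ ≠ 0 := (lt_of_lt_of_le (pos_iff_ne_zero.2 hq₀) hq).ne'
  have t0 : 0 < q₀.toReal := ENNReal.toReal_pos hq₀ h0
  have t1 : 0 < q₁.toReal := ENNReal.toReal_pos hq₁ h1
  have t01 : q₀.toReal ≤ q₁.toReal := ENNReal.toReal_mono h1 hq
  have hNpow : N ^ q₀.toReal = ∑' k, ‖g k‖ₑ ^ q₀.toReal := by
    rw [hN, eLpNorm_count_eq_tsum hq₀ h0, ← ENNReal.rpow_mul, one_div_mul_cancel t0.ne',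
      ENNReal.rpow_one]
  rw [eLpNorm_count_eq_tsum hq₁ h1]
  calc (∑' k, ‖g k‖ₑ ^ q₁.toReal) ^ (1 / q₁.toReal)
      ≤ (∑' k, N ^ (q₁.toReal - q₀.toReal) * ‖g k‖ₑ ^ q₀.toReal) ^ (1 / q₁.toReal) := by
        gcongr with k
        calc ‖g k‖ₑ ^ q₁.toReal
            = ‖g k‖ₑ ^ (q₁.toReal - q₀.toReal) * ‖g k‖ₑ ^ q₀.toReal := by
              rw [← ENNReal.rpow_add_of_nonneg _ _ (sub_nonneg.2 t01) t0.le, sub_add_cancel]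
          _ ≤ _ := by
              gcongr
              exact hle k
    _ = (N ^ q₁.toReal) ^ (1 / q₁.toReal) := by
        rw [ENNReal.tsum_mul_left, ← hNpow,
          ← ENNReal.rpow_add_of_nonneg _ _ (sub_nonneg.2 t01) t0.le, sub_add_cancel]
    _ = N := by rw [← ENNReal.rpow_mul, mul_one_div_cancel t1.ne', ENNReal.rpow_one]

theorem eLpNorm_count_le_tsum {q : ℝ≥0∞} (hq : 1 ≤ q) (g : ℕ → E) :
    eLpNorm g q Measure.count ≤ ∑' k, ‖g k‖ₑ := by
  refine (eLpNorm_count_anti one_ne_zero hq g).trans (le_of_eq ?_)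
  rw [eLpNorm_one_eq_lintegral_enorm, lintegral_count]

theorem enorm_two_rpow_smul [NormedSpace ℝ E] (c : ℝ) (v : E) :
    ‖(2 : ℝ) ^ c • v‖ₑ = 2 ^ c * ‖v‖ₑ := by
  rw [enorm_smul]
  congr 1
  rw [Real.enorm_eq_ofReal (by positivity), ← ENNReal.ofReal_rpow_of_pos (by norm_num),
    ENNReal.ofReal_ofNat]

theorem tsum_two_rpow_neg_lt_top {c : ℝ} (hc : 0 < c) :
    ∑' k : ℕ, (2 : ℝ≥0∞) ^ (-((k : ℝ) * c)) < ∞ := by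
  have h : ∀ k : ℕ, (2 : ℝ≥0∞) ^ (-((k : ℝ) * c)) = ((2 : ℝ≥0∞) ^ (-c)) ^ k := by
    intro k
    rw [← ENNReal.rpow_natCast, ← ENNReal.rpow_mul]
    congr 1; ring
  simp_rw [h]
  rw [ENNReal.tsum_geometric, ENNReal.inv_lt_top, tsub_pos_iff_lt]
  exact ENNReal.rpow_lt_one_of_one_lt_of_neg (by norm_num) (neg_neg_of_pos hc)

end CountingNorm

/-! ### The embeddings. -/

section Sufficiency

variable {d : ℕ} {X : Type*} [NormedAddCommGroup X] [NormedSpace ℂ X]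

theorem tlNorm_powerWeight_eq (hd : 1 ≤ d) (φ : ℕ → 𝓢(Rd d, ℂ)) (s : ℝ) {p : ℝ} (hp : 0 < p)
    (q : ℝ≥0∞) (γ : ℝ) (f : 𝓢'(Rd d, X)) :
    tlNorm φ s p q (powerWeight d γ) f =
      (∫⁻ x, eLpNorm (fun k : ℕ => (2 : ℝ) ^ ((k : ℝ) * s) • fourierCutoff (φ k) f x) q
        Measure.count ^ p * ‖x‖ₑ ^ γ) ^ p⁻¹ := by
  unfold tlNorm
  rw [eLpNorm_eq_lintegral_rpow_enorm_toReal (by simpa using hp) ENNReal.ofReal_ne_top,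
    ENNReal.toReal_ofReal hp.le, one_div]
  congr 1
  have hm : Measurable fun x : Rd d => ENNReal.ofReal (powerWeight d γ x) := by
    unfold powerWeight
    fun_prop
  rw [lintegral_withDensity_eq_lintegral_mul_non_measurable _ hm
    (Filter.Eventually.of_forall fun x => ENNReal.ofReal_lt_top)]
  refine lintegral_congr_ae ?_
  -- The real and the extended power of `‖x‖` may differ at the origin, a null set because `d ≥ 1`.
  filter_upwards [ae_ne_zero hd] with x hx
  rw [Pi.mul_apply, enorm_eq_self, mul_comm, enorm_rpow_eq_ofReal hx, powerWeight]

theorem tlEmbedding_of_le {φ : ℕ → 𝓢(Rd d, ℂ)} {s₀ p₀ s₁ p₁ : ℝ} {q₀ q₁ : ℝ≥0∞}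
    {w₀ w₁ : Rd d → ℝ} {C : ℝ≥0∞} (hC : C ≠ ∞)
    (h : ∀ f : 𝓢'(Rd d, X), tlNorm φ s₁ p₁ q₁ w₁ f ≤ C * tlNorm φ s₀ p₀ q₀ w₀ f) :
    TLEmbedding X φ s₀ p₀ q₀ w₀ s₁ p₁ q₁ w₁ := by
  refine ⟨fun f hf => (h f).trans_lt (ENNReal.mul_lt_top hC.lt_top hf), C.toNNReal, fun f _ => ?_⟩
  rw [ENNReal.coe_toNNReal hC]
  exact h f

theorem tlEmbedding_of_exponent_le (φ : ℕ → 𝓢(Rd d, ℂ)) (s p : ℝ) {q₀ q₁ : ℝ≥0∞} (hq₀ : 1 ≤ q₀)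
    (hq : q₀ ≤ q₁) (w : Rd d → ℝ) : TLEmbedding X φ s p q₀ w s p q₁ w := by
  refine tlEmbedding_of_le ENNReal.one_ne_top fun f => ?_
  rw [one_mul]
  refine eLpNorm_mono_enorm fun x => ?_
  exact eLpNorm_count_anti (one_pos.trans_le hq₀).ne' hq _

/-- Pointwise in `x`: each term is bounded by the source `ℓ^{q₀}` norm, and the gain `2^{-k(s₀-s₁)}`
is summable. The weight and the values of `q₀`, `q₁` play no role. -/
theorem tlEmbedding_of_smoothness_lt (φ : ℕ → 𝓢(Rd d, ℂ)) {s₀ s₁ : ℝ} (hs : s₁ < s₀) (p : ℝ)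
    {q₀ q₁ : ℝ≥0∞} (hq₀ : 1 ≤ q₀) (hq₁ : 1 ≤ q₁) (w : Rd d → ℝ) :
    TLEmbedding X φ s₀ p q₀ w s₁ p q₁ w := by
  have hT := tsum_two_rpow_neg_lt_top (sub_pos.2 hs)
  set T := ∑' k : ℕ, (2 : ℝ≥0∞) ^ (-((k : ℝ) * (s₀ - s₁))) with hTdef
  refine tlEmbedding_of_le hT.ne fun f => ?_
  have h := eLpNorm_le_nnreal_smul_eLpNorm_of_ae_le_mul' (ε := ℝ≥0∞) (ε' := ℝ≥0∞)
    (μ := volume.withDensity fun x => ENNReal.ofReal (w x)) (c := T.toNNReal)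
    (f := fun x : Rd d => eLpNorm
      (fun k : ℕ => (2 : ℝ) ^ ((k : ℝ) * s₁) • fourierCutoff (φ k) f x) q₁ Measure.count)
    (g := fun x : Rd d => eLpNorm
      (fun k : ℕ => (2 : ℝ) ^ ((k : ℝ) * s₀) • fourierCutoff (φ k) f x) q₀ Measure.count)
    (Filter.Eventually.of_forall fun x => ?_) (ENNReal.ofReal p)
  · unfold tlNorm
    rwa [ENNReal.smul_def, smul_eq_mul, ENNReal.coe_toNNReal hT.ne] at h
  · rw [enorm_eq_self, enorm_eq_self, ENNReal.coe_toNNReal hT.ne]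
    refine (eLpNorm_count_le_tsum hq₁ _).trans ?_
    rw [hTdef, ← ENNReal.tsum_mul_right]
    refine ENNReal.tsum_le_tsum fun k => ?_
    have hk := enorm_le_eLpNorm_count
      (fun k : ℕ => (2 : ℝ) ^ ((k : ℝ) * s₀) • fourierCutoff (φ k) f x) k
      (one_pos.trans_le hq₀).ne'
    refine le_trans (le_of_eq ?_) (mul_le_mul' le_rfl hk)
    rw [enorm_two_rpow_smul, enorm_two_rpow_smul, ← mul_assoc, ← two_rpow_add]
    congr 2
    ring

theorem IsDyadicResolution.exists_localBound [CompleteSpace X] (hd : 1 ≤ d)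
    {φ : ℕ → 𝓢(Rd d, ℂ)} (hφ : IsDyadicResolution φ) {p M : ℝ} (a s : ℝ) (hp : 0 < p)
    (hM : 0 ≤ M) :
    ∃ C : ℝ≥0∞, C ≠ ∞ ∧ ∀ f : 𝓢'(Rd d, X),
      LocalBound p a M C fun k x => 2 ^ ((k : ℝ) * s) * ‖fourierCutoff (φ k) f x‖ₑ := by
  obtain ⟨C, hC, h⟩ := hφ.exists_enorm_fourierCutoff_le (X := X) hd a hp hM
  refine ⟨C, hC, fun f k x => ?_⟩
  have e : ∀ y, (2 ^ ((k : ℝ) * s) * ‖fourierCutoff (φ k) f y‖ₑ) ^ p * ‖y‖ₑ ^ a *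
      bracket ((2 : ℝ) ^ k • (x - y)) ^ (-M) = 2 ^ ((k : ℝ) * s * p) *
      (‖fourierCutoff (φ k) f y‖ₑ ^ p * ‖y‖ₑ ^ a *
        bracket ((2 : ℝ) ^ k • (x - y)) ^ (-M)) := by
    intro y
    rw [ENNReal.mul_rpow_of_nonneg _ _ hp.le, ← ENNReal.rpow_mul]
    ring
  simp_rw [e]
  rw [lintegral_const_mul' _ _ (two_rpow_ne_top _), ENNReal.mul_rpow_of_nonneg _ _ hp.le,
    ← ENNReal.rpow_mul]
  refine (mul_le_mul' le_rfl (h f k x)).trans (le_of_eq ?_)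
  ring

/-- The condition on the differential dimensions gives `2^{k s₁} ≤ 2^{-kδ} 2^{k s₀}`. The target
norm is then enlarged to `ℓ^1` and the source norm reduced to `ℓ^∞`. -/
theorem IsDyadicResolution.tlEmbedding_sobolev [CompleteSpace X] (hd : 1 ≤ d)
    {φ : ℕ → 𝓢(Rd d, ℂ)} (hφ : IsDyadicResolution φ) {p₀ p₁ : ℝ} (hp₀ : 1 < p₀) (hp : p₀ ≤ p₁)
    {q₀ q₁ : ℝ≥0∞} (hq₀ : 1 ≤ q₀) (hq₁ : 1 ≤ q₁) {s₀ s₁ γ₀ γ₁ : ℝ} (hγ₁ : -(d : ℝ) < γ₁)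
    (hγ : γ₁ / p₁ ≤ γ₀ / p₀) (hδ : (d + γ₁) / p₁ < (d + γ₀) / p₀)
    (hs : s₁ - (d + γ₁) / p₁ ≤ s₀ - (d + γ₀) / p₀) :
    TLEmbedding X φ s₀ p₀ q₀ (powerWeight d γ₀) s₁ p₁ q₁ (powerWeight d γ₁) := by
  have hp₀0 : 0 < p₀ := by linarith
  have hp₁0 : 0 < p₁ := by linarith
  obtain ⟨C₁, hC₁, h₁⟩ := hφ.exists_localBound (X := X) hd γ₀ s₀ hp₀0 le_rfl
  obtain ⟨C₂, hC₂, h₂⟩ := hφ.exists_localBound (X := X) hd (γ₀ + 1) s₀ hp₀0 zero_le_two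
  obtain ⟨C, hC, h⟩ := exists_lintegral_tsum_le hd hp₀ hp hγ₁ hγ hδ hC₁ hC₂
  refine tlEmbedding_of_le (C := C ^ p₁⁻¹) (ENNReal.rpow_ne_top_of_nonneg (by positivity) hC)
    fun f => ?_
  set F : ℕ → Rd d → ℝ≥0∞ := fun k x => 2 ^ ((k : ℝ) * s₀) * ‖fourierCutoff (φ k) f x‖ₑ with hF
  have hFm : ∀ k, Measurable (F k) := fun k =>
    ((continuous_fourierCutoff (φ k) f).enorm.measurable).const_mul _
  rw [tlNorm_powerWeight_eq hd φ s₁ hp₁0, tlNorm_powerWeight_eq hd φ s₀ hp₀0]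
  calc (∫⁻ x, eLpNorm (fun k : ℕ => (2 : ℝ) ^ ((k : ℝ) * s₁) • fourierCutoff (φ k) f x) q₁
        Measure.count ^ p₁ * ‖x‖ₑ ^ γ₁) ^ p₁⁻¹
      ≤ (∫⁻ x, (∑' k : ℕ, 2 ^ (-((k : ℝ) * ((d + γ₀) / p₀ - (d + γ₁) / p₁))) * F k x) ^ p₁ *
        ‖x‖ₑ ^ γ₁) ^ p₁⁻¹ := by
        refine ENNReal.rpow_le_rpow (lintegral_mono fun x => ?_) (by positivity)
        refine mul_le_mul' (ENNReal.rpow_le_rpow ?_ hp₁0.le) le_rfl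
        refine (eLpNorm_count_le_tsum hq₁ _).trans (ENNReal.tsum_le_tsum fun k => ?_)
        rw [hF, enorm_two_rpow_smul, ← mul_assoc, ← two_rpow_add]
        gcongr
        · norm_num
        · nlinarith [Nat.cast_nonneg (α := ℝ) k]
    _ ≤ (C * (∫⁻ x, (⨆ k, F k x) ^ p₀ * ‖x‖ₑ ^ γ₀) ^ (p₁ / p₀)) ^ p₁⁻¹ :=
        ENNReal.rpow_le_rpow (h F hFm (h₁ f) (h₂ f)) (by positivity)
    _ = C ^ p₁⁻¹ * (∫⁻ x, (⨆ k, F k x) ^ p₀ * ‖x‖ₑ ^ γ₀) ^ p₀⁻¹ := by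
        rw [ENNReal.mul_rpow_of_nonneg _ _ (by positivity), ← ENNReal.rpow_mul]
        congr 2
        field_simp
    _ ≤ _ := by
        refine mul_le_mul' le_rfl (ENNReal.rpow_le_rpow (lintegral_mono fun x => ?_)
          (by positivity))
        refine mul_le_mul' (ENNReal.rpow_le_rpow (iSup_le fun k => ?_) hp₀0.le) le_rfl
        simp only [hF, ← enorm_two_rpow_smul]
        exact enorm_le_eLpNorm_count
          (fun k : ℕ => (2 : ℝ) ^ ((k : ℝ) * s₀) • fourierCutoff (φ k) f x) k
          (one_pos.trans_le hq₀).ne'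

end Sufficiency

end WeightedTL

end

noncomputable section

open scoped FourierTransform

namespace WeightedTL

/-! ### Test functions -/

section Atoms

variable {d : ℕ}

theorem norm_exp_neg_I_mul (t : ℝ) : ‖Complex.exp (-(Complex.I * (t : ℂ)))‖ = 1 := by
  have : -(Complex.I * (t : ℂ)) = ((-t : ℝ) : ℂ) * Complex.I := by push_cast; ring
  rw [this, Complex.norm_exp_ofReal_mul_I]

/-- Band-limited Schwartz functions, with spectrum in a small ball around an arbitrary point. -/
theorem exists_bandlimited (d : ℕ) :
    ∃ θ : Rd d → 𝓢(Rd d, ℂ), (∀ a ξ, 1 / 8 ≤ ‖ξ - a‖ → fourierHat (θ a) ξ = 0) ∧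
      (∀ a x, ‖θ a x‖ₑ = ‖θ 0 x‖ₑ) ∧ θ 0 0 ≠ 0 := by
  have hπ : 0 < 2 * Real.pi := by positivity
  -- The factor `(2π)⁻¹` converts angular frequency into the frequency of `𝓕`. The functions are
  -- inverse transforms of translated bumps, that is, modulations of one function; hence they share
  -- one modulus.
  let f : ContDiffBump (0 : Rd d) :=
    ⟨(2 * Real.pi)⁻¹ * (1 / 16), (2 * Real.pi)⁻¹ * (1 / 8), by positivity, by gcongr; norm_num⟩
  have hfc : HasCompactSupport fun x => ((f x : ℝ) : ℂ) :=
    f.hasCompactSupport.comp_left Complex.ofReal_zero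
  let b : 𝓢(Rd d, ℂ) := hfc.toSchwartzMap (Complex.ofRealCLM.contDiff.comp f.contDiff)
  have hb : ∀ x, b x = ((f x : ℝ) : ℂ) := fun x => rfl
  let B : Rd d → 𝓢(Rd d, ℂ) := fun a => SchwartzMap.compSubConstCLM ℂ ((2 * Real.pi)⁻¹ • a) b
  have hB : ∀ a x, B a x = b (x - (2 * Real.pi)⁻¹ • a) := fun a x => by simp [B]
  have hinv : ∀ a x, 𝓕⁻ (B a) x = (fourierConst d : ℂ)⁻¹ *
      fourierHat (B a) (-((2 * Real.pi) • x)) := by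
    intro a x
    rw [SchwartzMap.fourierInv_coe, Real.fourierInv_eq_fourier_neg, ← SchwartzMap.fourier_coe,
      fourier_eq_fourierHat, smul_neg]
  refine ⟨fun a => 𝓕⁻ (B a), fun a ξ h => ?_, fun a x => ?_, ?_⟩
  · rw [fourierHat_eq, FourierTransform.fourier_fourierInv_eq, hB, hb, ← smul_sub]
    rw [f.zero_of_le_dist, Complex.ofReal_zero, mul_zero]
    rw [dist_zero_right, norm_smul, Real.norm_of_nonneg (by positivity)]
    exact mul_le_mul_of_nonneg_left h (by positivity)
  · rw [hinv, hinv, fourierHat_compSubConst, fourierHat_compSubConst]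
    simp only [enorm_mul]
    congr 2
    rw [← ofReal_norm, ← ofReal_norm, norm_exp_neg_I_mul, norm_exp_neg_I_mul]
  · have h0 : B 0 = b := by ext x; rw [hB, smul_zero, sub_zero]
    have h1 : 𝓕⁻ b 0 = ((∫ x, f x : ℝ) : ℂ) := by
      rw [SchwartzMap.fourierInv_coe, Real.fourierInv_eq', ← integral_complex_ofReal]
      simp [hb]
    change 𝓕⁻ (B 0) 0 ≠ 0
    rw [h0, h1]
    exact_mod_cast (f.integral_pos (μ := volume)).ne'

theorem fourierHat_sum {ι : Type*} (S : Finset ι) (η : ι → 𝓢(Rd d, ℂ)) (ξ : Rd d) :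
    fourierHat (∑ k ∈ S, η k) ξ = ∑ k ∈ S, fourierHat (η k) ξ := by
  classical
  induction S using Finset.induction_on with
  | empty => simpa using fourierHat_smul 0 0 ξ
  | insert a S ha ih => rw [Finset.sum_insert ha, Finset.sum_insert ha, fourierHat_add, ih]

/-- The norm of `L^p(ℝ^d, |x|^γ)`. -/
def powerNorm (p γ : ℝ) (g : Rd d → ℝ≥0∞) : ℝ≥0∞ := (∫⁻ x, g x ^ p * ‖x‖ₑ ^ γ) ^ p⁻¹

theorem powerNorm_const_mul {p : ℝ} (hp : 0 < p) (γ : ℝ) {c : ℝ≥0∞} (hc : c ≠ ∞)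
    (g : Rd d → ℝ≥0∞) : powerNorm p γ (fun x => c * g x) = c * powerNorm p γ g := by
  unfold powerNorm
  simp_rw [ENNReal.mul_rpow_of_nonneg _ _ hp.le, mul_assoc]
  rw [lintegral_const_mul' _ _ (ENNReal.rpow_ne_top_of_nonneg hp.le hc),
    ENNReal.mul_rpow_of_nonneg _ _ (by positivity), ← ENNReal.rpow_mul, mul_inv_cancel₀ hp.ne',
    ENNReal.rpow_one]

/-- The spectrum of `η` is contained in the annulus on which `φ̂_k` is the only non-zero member of
the resolution. -/
def SpectrumInAnnulus (k : ℕ) (η : 𝓢(Rd d, ℂ)) : Prop :=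
  ∀ ξ, fourierHat η ξ ≠ 0 → 3 / 4 * 2 ^ k ≤ ‖ξ‖ ∧ ‖ξ‖ ≤ 2 ^ k

/-- For `q = ∞` the exponent `1 / q.toReal` is `1 / 0 = 0`, which is the correct power of the
cardinality. -/
theorem eLpNorm_count_ite {E : Type*} [NormedAddCommGroup E] {q : ℝ≥0∞} (hq : q ≠ 0)
    {S : Finset ℕ} (hS : S.Nonempty) {g : ℕ → E} {t : ℝ≥0∞} (hg : ∀ k ∈ S, ‖g k‖ₑ = t) :
    eLpNorm (fun k => if k ∈ S then g k else 0) q Measure.count =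
      t * (S.card : ℝ≥0∞) ^ (1 / q.toReal) := by
  have h1 : eLpNorm (fun k => if k ∈ S then g k else 0) q Measure.count =
      eLpNorm ((S : Set ℕ).indicator fun _ => t) q Measure.count := by
    refine eLpNorm_congr_enorm_ae (Filter.Eventually.of_forall fun k => ?_)
    by_cases hk : k ∈ S
    · simp [hk, hg k hk]
    · simp [hk]
  rw [h1, eLpNorm_indicator_const' S.measurableSet (by simpa using hS.ne_empty) hq, enorm_eq_self,
    Measure.count_apply_finset]

variable {X : Type*} [NormedAddCommGroup X] [NormedSpace ℂ X]

theorem IsDyadicResolution.fourierCutoff_tensorDistribution_sum [CompleteSpace X]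
    {φ : ℕ → 𝓢(Rd d, ℂ)} (hφ : IsDyadicResolution φ) {S : Finset ℕ} {η : ℕ → 𝓢(Rd d, ℂ)}
    (hη : ∀ k ∈ S, SpectrumInAnnulus k (η k)) (v : X) (j : ℕ) (x : Rd d) :
    fourierCutoff (φ j) (tensorDistribution (∑ k ∈ S, η k) v) x =
      if j ∈ S then η j x • v else 0 := by
  have key : ∀ ξ, fourierHat (if j ∈ S then η j else 0) ξ =
      fourierHat (φ j) ξ * fourierHat (∑ k ∈ S, η k) ξ := by
    intro ξ
    have h : ∀ k ∈ S, fourierHat (φ j) ξ * fourierHat (η k) ξ =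
        if j = k then fourierHat (η k) ξ else 0 := by
      intro k hk
      by_cases h0 : fourierHat (η k) ξ = 0
      · simp [h0]
      · obtain ⟨h1, h2⟩ := hη k hk ξ h0
        rw [hφ.fourierHat_eq_ite j k h1 h2]
        simp
    rw [fourierHat_sum, Finset.mul_sum, Finset.sum_congr rfl h, Finset.sum_ite_eq]
    split_ifs
    · rfl
    · simpa using fourierHat_smul 0 0 ξ
  rw [fourierCutoff_tensorDistribution key]
  split_ifs <;> simp

/-- The operator `S_j` returns exactly the piece with index `j`. As all rescaled pieces share the
modulus `g`, the inner `ℓ^q` norm is a constant multiple of `g`. -/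
theorem IsDyadicResolution.tlNorm_tensorDistribution_sum [CompleteSpace X] (hd : 1 ≤ d)
    {φ : ℕ → 𝓢(Rd d, ℂ)} (hφ : IsDyadicResolution φ) {S : Finset ℕ} (hS : S.Nonempty)
    {η : ℕ → 𝓢(Rd d, ℂ)} (hη : ∀ k ∈ S, SpectrumInAnnulus k (η k)) {s p : ℝ} (hp : 0 < p)
    {q : ℝ≥0∞} (hq : q ≠ 0) (γ : ℝ) {g : Rd d → ℝ≥0∞}
    (hg : ∀ k ∈ S, ∀ x, 2 ^ ((k : ℝ) * s) * ‖η k x‖ₑ = g x) (v : X) :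
    tlNorm φ s p q (powerWeight d γ) (tensorDistribution (∑ k ∈ S, η k) v) =
      ‖v‖ₑ * (S.card : ℝ≥0∞) ^ (1 / q.toReal) * powerNorm p γ g := by
  rw [tlNorm_powerWeight_eq hd φ s hp, ← powerNorm_const_mul hp]
  · unfold powerNorm
    congr 2
    ext x
    congr 2
    simp_rw [hφ.fourierCutoff_tensorDistribution_sum hη, smul_ite, smul_zero]
    rw [eLpNorm_count_ite hq hS (t := ‖v‖ₑ * g x)]
    · ring
    · intro k hk
      rw [enorm_two_rpow_smul, enorm_smul, ← mul_assoc, hg k hk, mul_comm]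
  · exact ENNReal.mul_ne_top enorm_ne_top
      (ENNReal.rpow_ne_top_of_nonneg (by positivity) (ENNReal.natCast_ne_top _))

theorem IsDyadicResolution.tlNorm_tensorDistribution [CompleteSpace X] (hd : 1 ≤ d)
    {φ : ℕ → 𝓢(Rd d, ℂ)} (hφ : IsDyadicResolution φ) {k : ℕ}
    {η : 𝓢(Rd d, ℂ)} (hη : SpectrumInAnnulus k η) (s : ℝ) {p : ℝ} (hp : 0 < p)
    {q : ℝ≥0∞} (hq : q ≠ 0) (γ : ℝ) (v : X) :
    tlNorm φ s p q (powerWeight d γ) (tensorDistribution η v) =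
      ‖v‖ₑ * (2 ^ ((k : ℝ) * s) * powerNorm p γ fun x => ‖η x‖ₑ) := by
  have h := hφ.tlNorm_tensorDistribution_sum hd (S := {k}) (Finset.singleton_nonempty k)
    (η := fun _ => η) (s := s) (g := fun x => 2 ^ ((k : ℝ) * s) * ‖η x‖ₑ) (by simpa using hη) hp hq
    γ (by simp) v
  rw [powerNorm_const_mul hp _ (two_rpow_ne_top _)] at h
  simpa using h

end Atoms

/-! ### Dilations and translations in the weighted `L^p` norm. -/

section PowerNorm

variable {d : ℕ}

theorem powerNorm_comp_two_pow_smul {p : ℝ} (hp : 0 < p) (γ : ℝ) {g : Rd d → ℝ≥0∞}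
    (hg : Measurable g) (k : ℕ) :
    powerNorm p γ (fun x => g ((2 : ℝ) ^ k • x)) =
      2 ^ (-((k : ℝ) * ((d + γ) / p))) * powerNorm p γ g := by
  unfold powerNorm
  have hm : Measurable fun x => g x ^ p * ‖x‖ₑ ^ γ := (hg.pow_const _).mul (by fun_prop)
  have e : ∀ x : Rd d, g ((2 : ℝ) ^ k • x) ^ p * ‖(2 : ℝ) ^ k • x‖ₑ ^ γ =
      2 ^ ((k : ℝ) * γ) * (g ((2 : ℝ) ^ k • x) ^ p * ‖x‖ₑ ^ γ) := by
    intro x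
    rw [enorm_two_pow_smul, ENNReal.mul_rpow_of_ne_top (two_rpow_ne_top _) enorm_ne_top,
      ← ENNReal.rpow_mul]
    ring
  rw [lintegral_comp_two_pow_smul k hm]
  simp_rw [e]
  rw [lintegral_const_mul' _ _ (two_rpow_ne_top _), ← mul_assoc, ← two_rpow_add,
    ENNReal.mul_rpow_of_nonneg _ _ (by positivity), ← mul_assoc, ← ENNReal.rpow_mul,
    ← two_rpow_add]
  have : -((k : ℝ) * ((d + γ) / p)) + (k * d + k * γ) * p⁻¹ = 0 := by field_simp; ring
  rw [this, ENNReal.rpow_zero, one_mul]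

theorem powerNorm_ne_zero (hd : 1 ≤ d) {p : ℝ} (hp : 0 < p) (γ : ℝ) {η : 𝓢(Rd d, ℂ)}
    (hη : η 0 ≠ 0) : powerNorm p γ (fun x => ‖η x‖ₑ) ≠ 0 := by
  intro h
  have hm : Measurable fun x : Rd d => ‖η x‖ₑ ^ p * ‖x‖ₑ ^ γ :=
    (η.continuous.enorm.measurable.pow_const _).mul (by fun_prop)
  rw [powerNorm, ENNReal.rpow_eq_zero_iff_of_pos (by positivity), lintegral_eq_zero_iff hm] at h
  have h1 : (η : Rd d → ℂ) =ᵐ[volume] 0 := by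
    filter_upwards [h, ae_ne_zero hd] with x hx hx0
    rw [Pi.zero_apply, mul_eq_zero, ENNReal.rpow_eq_zero_iff_of_pos hp, enorm_eq_zero] at hx
    refine hx.resolve_right ?_
    rw [ENNReal.rpow_eq_zero_iff]
    simp [hx0]
  exact hη (congrFun ((η.continuous.ae_eq_iff_eq volume continuous_const).1 h1) 0)

/-- Decay of `η` of order `L/p` reduces this to the integral of a power weight against a bracket
kernel. -/
theorem exists_powerNorm_translate_le (hd : 1 ≤ d) {p γ : ℝ} (hp : 0 < p) (hγ : -(d : ℝ) < γ)
    (η : 𝓢(Rd d, ℂ)) :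
    ∃ C : ℝ≥0∞, C ≠ ∞ ∧ ∀ a, powerNorm p γ (fun x => ‖η (x - a)‖ₑ) ≤ C * bracket a ^ (γ / p) := by
  set L := d + |γ| + 1
  obtain ⟨K, hK, h⟩ := lintegral_enorm_rpow_mul_bracket_le hd hγ (L := L) (by simp [L])
  obtain ⟨B, hB, hη⟩ := exists_enorm_le_bracket_rpow η (L / p)
  have hBp : B ^ p ≠ ∞ := ENNReal.rpow_ne_top_of_nonneg hp.le hB
  refine ⟨(B ^ p * K) ^ p⁻¹, ENNReal.rpow_ne_top_of_nonneg (by positivity)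
    (ENNReal.mul_ne_top hBp hK), fun a => ?_⟩
  unfold powerNorm
  rw [div_eq_mul_inv, ENNReal.rpow_mul, ← ENNReal.mul_rpow_of_nonneg _ _ (by positivity)]
  refine ENNReal.rpow_le_rpow ?_ (by positivity)
  calc ∫⁻ x, ‖η (x - a)‖ₑ ^ p * ‖x‖ₑ ^ γ
      ≤ ∫⁻ x, B ^ p * (‖x‖ₑ ^ γ * bracket (a - x) ^ (-L)) := by
        refine lintegral_mono fun x => ?_
        calc ‖η (x - a)‖ₑ ^ p * ‖x‖ₑ ^ γ
            ≤ (B * bracket (x - a) ^ (-(L / p))) ^ p * ‖x‖ₑ ^ γ := by gcongr; exact hη _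
          _ = _ := by
            rw [ENNReal.mul_rpow_of_nonneg _ _ hp.le, ← ENNReal.rpow_mul, ← bracket_neg, neg_sub]
            have : -(L / p) * p = -L := by field_simp
            rw [this]
            ring
    _ ≤ B ^ p * (K * bracket a ^ γ) := by
        rw [lintegral_const_mul' _ _ hBp]
        exact mul_le_mul' le_rfl (h a)
    _ = _ := by ring

theorem exists_le_powerNorm_translate {p : ℝ} (hp : 0 < p) (γ : ℝ)
    {η : 𝓢(Rd d, ℂ)} (hη : η 0 ≠ 0) :
    ∃ c : ℝ≥0∞, c ≠ 0 ∧ ∀ a : Rd d, 1 ≤ ‖a‖ →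
      c * ‖a‖ₑ ^ (γ / p) ≤ powerNorm p γ (fun x => ‖η (x - a)‖ₑ) := by
  have hη0 : ‖η 0‖ₑ ≠ 0 := by simpa using hη
  have hev : ∀ᶠ x in nhds (0 : Rd d), ‖η 0‖ₑ / 2 < ‖η x‖ₑ :=
    (η.continuous.enorm.tendsto 0).eventually_const_lt (ENNReal.half_lt_self hη0 enorm_ne_top)
  obtain ⟨r, hr0, hr⟩ := Metric.eventually_nhds_iff_ball.1 hev
  -- On this ball around `a` the function stays above half its central value, and `‖a‖ ≥ 1` makes
  -- `‖x‖` comparable to `‖a‖` with factor two.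
  set ρ := min r (1 / 2) with hρ
  have hρ0 : 0 < ρ := lt_min hr0 (by norm_num)
  set V := volume (Metric.ball (0 : Rd d) ρ) with hV
  have hV0 : V ≠ 0 := (Metric.measure_ball_pos volume _ hρ0).ne'
  have ht0 : (‖η 0‖ₑ / 2) ^ p * (2 ^ |γ|)⁻¹ * V ≠ 0 := by
    refine mul_ne_zero (mul_ne_zero ?_ (by simp)) hV0
    rw [Ne, ENNReal.rpow_eq_zero_iff_of_pos hp]
    simpa using hη
  refine ⟨((‖η 0‖ₑ / 2) ^ p * (2 ^ |γ|)⁻¹ * V) ^ p⁻¹, ?_, fun a ha => ?_⟩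
  · rwa [Ne, ENNReal.rpow_eq_zero_iff_of_pos (by positivity)]
  have hweight : ∀ x ∈ Metric.ball a ρ, (2 ^ |γ|)⁻¹ * ‖a‖ₑ ^ γ ≤ ‖x‖ₑ ^ γ := by
    intro x hx
    have hxa : ‖x - a‖ ≤ 1 / 2 := by
      rw [Metric.mem_ball, dist_eq_norm] at hx
      exact hx.le.trans (min_le_right _ _)
    have hn1 : ‖x‖ ≤ 2 * ‖a‖ := by
      have := norm_add_le a (x - a)
      rw [add_sub_cancel] at this
      linarith
    have hn2 : ‖a‖ ≤ 2 * ‖x‖ := by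
      have := norm_sub_le x (x - a)
      rw [sub_sub_cancel] at this
      linarith
    have he : ∀ y z : Rd d, ‖y‖ ≤ 2 * ‖z‖ → ‖y‖ₑ ≤ 2 * ‖z‖ₑ := by
      intro y z h
      have := ENNReal.ofReal_le_ofReal h
      rwa [ENNReal.ofReal_mul (by norm_num), ofReal_norm, ofReal_norm,
        ENNReal.ofReal_ofNat] at this
    rw [ENNReal.inv_mul_le_iff (two_rpow_ne_zero _) (two_rpow_ne_top _)]
    rcases le_total 0 γ with hc | hc
    · rw [abs_of_nonneg hc, ← ENNReal.mul_rpow_of_nonneg _ _ hc]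
      exact ENNReal.rpow_le_rpow (he _ _ hn2) hc
    · have := ENNReal.inv_le_inv.2 (ENNReal.rpow_le_rpow (he _ _ hn1) (neg_nonneg.2 hc))
      rw [ENNReal.mul_rpow_of_nonneg _ _ (neg_nonneg.2 hc), ENNReal.mul_inv
        (Or.inl (two_rpow_ne_zero _)) (Or.inl (two_rpow_ne_top _)), ← ENNReal.rpow_neg ‖a‖ₑ,
        ← ENNReal.rpow_neg ‖x‖ₑ, neg_neg,
        ENNReal.inv_mul_le_iff (two_rpow_ne_zero _) (two_rpow_ne_top _)] at this
      rwa [abs_of_nonpos hc]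
  unfold powerNorm
  rw [div_eq_mul_inv γ, ENNReal.rpow_mul, ← ENNReal.mul_rpow_of_nonneg _ _ (by positivity)]
  refine ENNReal.rpow_le_rpow ?_ (by positivity)
  calc (‖η 0‖ₑ / 2) ^ p * (2 ^ |γ|)⁻¹ * V * ‖a‖ₑ ^ γ
      = ∫⁻ x in Metric.ball a ρ, (‖η 0‖ₑ / 2) ^ p * ((2 ^ |γ|)⁻¹ * ‖a‖ₑ ^ γ) := by
        rw [setLIntegral_const, hV, Measure.addHaar_ball_center volume a ρ]
        ring
    _ ≤ ∫⁻ x in Metric.ball a ρ, ‖η (x - a)‖ₑ ^ p * ‖x‖ₑ ^ γ := by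
        refine setLIntegral_mono' measurableSet_ball fun x hx => ?_
        refine mul_le_mul' (ENNReal.rpow_le_rpow (hr _ ?_).le hp.le) (hweight x hx)
        rw [mem_ball_zero_iff, ← dist_eq_norm]
        exact (Metric.mem_ball.1 hx).trans_le (min_le_left _ _)
    _ ≤ _ := setLIntegral_le_lintegral _ _

theorem powerNorm_ne_top (hd : 1 ≤ d) {p γ : ℝ} (hp : 0 < p) (hγ : -(d : ℝ) < γ)
    (η : 𝓢(Rd d, ℂ)) : powerNorm p γ (fun x => ‖η x‖ₑ) ≠ ∞ := by
  obtain ⟨C, hC, h⟩ := exists_powerNorm_translate_le hd hp hγ η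
  refine ne_top_of_le_ne_top hC ?_
  simpa [bracket_zero] using h 0

end PowerNorm

end WeightedTL

end

noncomputable section

namespace WeightedTL

/-! ### Necessity of the conditions -/

section Necessity

variable {d : ℕ} {X : Type*} [NormedAddCommGroup X] [NormedSpace ℂ X]

theorem le_of_two_rpow_mul_le {a b : ℝ} {A B : ℝ≥0∞} (hA : A ≠ 0) (hB : B ≠ ∞)
    (h : ∀ k : ℕ, 2 ^ ((k : ℝ) * a) * A ≤ 2 ^ ((k : ℝ) * b) * B) : a ≤ b := by
  by_contra! hab
  have h1 : ∀ k : ℕ, ((2 : ℝ≥0∞) ^ (a - b)) ^ k * A ≤ B := by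
    intro k
    have h2 := mul_le_mul' (le_refl ((2 : ℝ≥0∞) ^ (-((k : ℝ) * b)))) (h k)
    rw [← mul_assoc, ← mul_assoc, ← two_rpow_add, ← two_rpow_add, neg_add_cancel,
      ENNReal.rpow_zero, one_mul] at h2
    refine le_trans (le_of_eq ?_) h2
    rw [← ENNReal.rpow_natCast, ← ENNReal.rpow_mul]
    congr 2
    ring
  have h2 : Filter.Tendsto (fun k : ℕ => ((2 : ℝ≥0∞) ^ (a - b)) ^ k) Filter.atTop (nhds ∞) := by
    refine ENNReal.tendsto_pow_atTop_nhds_top_iff.2 ?_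
    exact ENNReal.one_lt_rpow (by norm_num) (sub_pos.2 hab)
  have h3 := ENNReal.Tendsto.mul_const (b := A) h2 (Or.inl ENNReal.top_ne_zero)
  rw [ENNReal.top_mul hA] at h3
  exact hB (top_le_iff.1 (le_of_tendsto' h3 h1))

theorem SpectrumInAnnulus.dilate {η : 𝓢(Rd d, ℂ)} (hη : SpectrumInAnnulus 0 η) (k : ℕ) :
    SpectrumInAnnulus k (dilate (2 ^ k) (by positivity) η) := by
  have h2 : (0 : ℝ) < 2 ^ k := by positivity
  intro ξ hξ
  rw [fourierHat_dilate h2] at hξ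
  obtain ⟨h, h'⟩ := hη _ hξ
  rw [norm_smul, norm_inv, Real.norm_of_nonneg h2.le, pow_zero] at h h'
  rw [inv_mul_eq_div, le_div_iff₀ h2] at h
  rw [inv_mul_eq_div, div_le_iff₀ h2] at h'
  constructor <;> linarith

theorem SpectrumInAnnulus.compSubConst {k : ℕ} {η : 𝓢(Rd d, ℂ)} (hη : SpectrumInAnnulus k η)
    (a : Rd d) : SpectrumInAnnulus k (SchwartzMap.compSubConstCLM ℂ a η) := by
  intro ξ hξ
  rw [fourierHat_compSubConst] at hξ
  exact hη ξ (right_ne_zero_of_mul hξ)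

theorem SpectrumInAnnulus.smul {k : ℕ} {η : 𝓢(Rd d, ℂ)} (hη : SpectrumInAnnulus k η) (c : ℂ) :
    SpectrumInAnnulus k (c • η) := by
  intro ξ hξ
  rw [fourierHat_smul] at hξ
  exact hη ξ (right_ne_zero_of_mul hξ)

/-- Schwartz functions with equal absolute value, one for each annulus of the resolution. -/
theorem exists_spectrumInAnnulus (hd : 1 ≤ d) :
    ∃ θ : ℕ → 𝓢(Rd d, ℂ), (∀ k, SpectrumInAnnulus k (θ k)) ∧
      (∀ k x, ‖θ k x‖ₑ = ‖θ 0 x‖ₑ) ∧ θ 0 0 ≠ 0 := by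
  obtain ⟨η, hη, hnorm, h0⟩ := exists_bandlimited d
  set e : Rd d := EuclideanSpace.single ⟨0, hd⟩ 1 with he
  have he1 : ‖e‖ = 1 := by simp [he]
  -- The number `7/8` is the midpoint of `[3/4, 1]`; the margin `2^k / 8` on either side is at least
  -- the radius `1/8` of the spectrum.
  refine ⟨fun k => η ((7 / 8 * 2 ^ k : ℝ) • e), fun k ξ hξ => ?_, fun k x => ?_, fun h => h0 ?_⟩
  · have h1 : ‖ξ - (7 / 8 * 2 ^ k : ℝ) • e‖ < 1 / 8 := by
      by_contra! h
      exact hξ (hη _ _ h)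
    have h2 : ‖(7 / 8 * 2 ^ k : ℝ) • e‖ = 7 / 8 * 2 ^ k := by
      rw [norm_smul, he1, mul_one, Real.norm_of_nonneg (by positivity)]
    have h3 : (1 : ℝ) ≤ 2 ^ k := one_le_pow₀ (by norm_num)
    have h4 := abs_le.1 (abs_norm_sub_norm_le ξ ((7 / 8 * 2 ^ k : ℝ) • e))
    rw [h2] at h4
    constructor <;> linarith [h4.1, h4.2]
  · rw [hnorm, hnorm ((7 / 8 * 2 ^ 0 : ℝ) • e)]
  · have := hnorm ((7 / 8 * 2 ^ 0 : ℝ) • e) 0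
    rw [h, enorm_zero] at this
    exact enorm_eq_zero.1 this.symm

variable [CompleteSpace X] [Nontrivial X] {φ : ℕ → 𝓢(Rd d, ℂ)} {s₀ s₁ p₀ p₁ γ₀ γ₁ : ℝ}
  {q₀ q₁ : ℝ≥0∞}

/-- A continuous embedding, tested on a function with spectrum in one annulus. -/
theorem TLEmbedding.exists_powerNorm_le (hd : 1 ≤ d) (hφ : IsDyadicResolution φ) (hp₀ : 0 < p₀)
    (hp₁ : 0 < p₁) (hq₀ : q₀ ≠ 0) (hq₁ : q₁ ≠ 0) (hγ₀ : -(d : ℝ) < γ₀)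
    (h : TLEmbedding X φ s₀ p₀ q₀ (powerWeight d γ₀) s₁ p₁ q₁ (powerWeight d γ₁)) :
    ∃ C : ℝ≥0∞, C ≠ ∞ ∧ ∀ (k : ℕ) (η : 𝓢(Rd d, ℂ)), SpectrumInAnnulus k η →
      2 ^ ((k : ℝ) * s₁) * powerNorm p₁ γ₁ (fun x => ‖η x‖ₑ) ≤
        C * (2 ^ ((k : ℝ) * s₀) * powerNorm p₀ γ₀ (fun x => ‖η x‖ₑ)) := by
  obtain ⟨C, hC⟩ := h.2
  obtain ⟨v, hv⟩ := exists_ne (0 : X)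
  have hv0 : ‖v‖ₑ ≠ 0 := by simpa using hv
  refine ⟨C, ENNReal.coe_ne_top, fun k η hη => ?_⟩
  have e₀ := hφ.tlNorm_tensorDistribution hd hη s₀ hp₀ hq₀ γ₀ v
  have e₁ := hφ.tlNorm_tensorDistribution hd hη s₁ hp₁ hq₁ γ₁ v
  have hmem : tensorDistribution η v ∈ tlSpace X φ s₀ p₀ q₀ (powerWeight d γ₀) := by
    change tlNorm _ _ _ _ _ _ < ∞
    rw [e₀]
    exact ENNReal.mul_lt_top enorm_lt_top (ENNReal.mul_lt_top (two_rpow_ne_top _).lt_top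
      (powerNorm_ne_top hd hp₀ hγ₀ η).lt_top)
  have := hC _ hmem
  rw [e₀, e₁, mul_left_comm (C : ℝ≥0∞), ENNReal.mul_le_mul_iff_right hv0 enorm_ne_top] at this
  exact this

/-- Tested on the dilates of one function by `2^k`, with `k → ∞`. The normalizing factor `2^{kd}` is
common to both sides. -/
theorem TLEmbedding.smoothness_le (hd : 1 ≤ d) (hφ : IsDyadicResolution φ) (hp₀ : 0 < p₀)
    (hp₁ : 0 < p₁) (hq₀ : q₀ ≠ 0) (hq₁ : q₁ ≠ 0) (hγ₀ : -(d : ℝ) < γ₀)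
    (h : TLEmbedding X φ s₀ p₀ q₀ (powerWeight d γ₀) s₁ p₁ q₁ (powerWeight d γ₁)) :
    s₁ - (d + γ₁) / p₁ ≤ s₀ - (d + γ₀) / p₀ := by
  obtain ⟨C, hC, h⟩ := h.exists_powerNorm_le hd hφ hp₀ hp₁ hq₀ hq₁ hγ₀
  obtain ⟨θ, hθ, -, hθ0⟩ := exists_spectrumInAnnulus hd
  have hnorm : ∀ {p : ℝ}, 0 < p → ∀ (γ : ℝ) (k : ℕ),
      powerNorm p γ (fun x => ‖dilate (2 ^ k) (by positivity) (θ 0) x‖ₑ) =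
      2 ^ ((k : ℝ) * d) * (2 ^ (-((k : ℝ) * ((d + γ) / p))) *
        powerNorm p γ (fun x => ‖θ 0 x‖ₑ)) := by
    intro p hp γ k
    rw [← powerNorm_comp_two_pow_smul hp γ (θ 0).continuous.enorm.measurable,
      ← powerNorm_const_mul hp _ (two_rpow_ne_top _)]
    congr 1
    ext x
    rw [dilate_apply, enorm_mul]
    congr 1
    rw [← ofReal_norm, Complex.norm_real, Real.norm_of_nonneg (by positivity), ← pow_mul,
      ENNReal.ofReal_pow (by norm_num), ENNReal.ofReal_ofNat, ← Nat.cast_mul,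
      ENNReal.rpow_natCast]
  refine le_of_two_rpow_mul_le (powerNorm_ne_zero hd hp₁ γ₁ hθ0)
    (ENNReal.mul_ne_top hC (powerNorm_ne_top hd hp₀ hγ₀ (θ 0))) fun k => ?_
  have hk := h k _ ((hθ 0).dilate k)
  rw [hnorm hp₁, hnorm hp₀] at hk
  have hk' := mul_le_mul' (le_refl ((2 : ℝ≥0∞) ^ (-((k : ℝ) * d)))) hk
  refine le_trans (le_of_eq ?_) (hk'.trans (le_of_eq ?_))
  · simp only [← mul_assoc, ← two_rpow_add]
    congr 2
    ring
  · rw [mul_left_comm _ C, mul_left_comm _ C]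
    congr 1
    simp only [← mul_assoc, ← two_rpow_add]
    congr 2
    ring

/-- Tested on translates of one function of frequency about one along a ray: at distance `2^k` the
weights act like the powers `2^{kγ/p}`, and the smoothness does not enter. -/
theorem TLEmbedding.weight_le (hd : 1 ≤ d) (hφ : IsDyadicResolution φ) (hp₀ : 0 < p₀)
    (hp₁ : 0 < p₁) (hq₀ : q₀ ≠ 0) (hq₁ : q₁ ≠ 0) (hγ₀ : -(d : ℝ) < γ₀)
    (h : TLEmbedding X φ s₀ p₀ q₀ (powerWeight d γ₀) s₁ p₁ q₁ (powerWeight d γ₁)) :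
    γ₁ / p₁ ≤ γ₀ / p₀ := by
  obtain ⟨C, hC, h⟩ := h.exists_powerNorm_le hd hφ hp₀ hp₁ hq₀ hq₁ hγ₀
  obtain ⟨θ, hθ, -, hθ0⟩ := exists_spectrumInAnnulus hd
  obtain ⟨c, hc, hlow⟩ := exists_le_powerNorm_translate hp₁ γ₁ hθ0
  obtain ⟨K, hK, hup⟩ := exists_powerNorm_translate_le hd hp₀ hγ₀ (θ 0)
  set e : Rd d := EuclideanSpace.single ⟨0, hd⟩ 1 with he
  have he1 : ‖e‖ = 1 := by simp [he]
  have he2 : ‖e‖ₑ = 1 := by rw [← ofReal_norm, he1, ENNReal.ofReal_one]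
  have hek : ∀ k : ℕ, ‖(2 : ℝ) ^ k • e‖ₑ = 2 ^ (k : ℝ) := fun k => by
    rw [enorm_two_pow_smul, he2, mul_one]
  refine le_of_two_rpow_mul_le hc (B := C * (K * 2 ^ |γ₀ / p₀|))
    (ENNReal.mul_ne_top hC (ENNReal.mul_ne_top hK (two_rpow_ne_top _))) fun k => ?_
  have hk := h 0 _ ((hθ 0).compSubConst ((2 : ℝ) ^ k • e))
  simp only [Nat.cast_zero, zero_mul, ENNReal.rpow_zero, one_mul,
    SchwartzMap.compSubConstCLM_apply] at hk
  have h1 : (1 : ℝ) ≤ ‖(2 : ℝ) ^ k • e‖ := by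
    rw [norm_smul, he1, mul_one, Real.norm_of_nonneg (by positivity)]
    exact one_le_pow₀ (by norm_num)
  have h2 : (1 : ℝ≥0∞) ≤ ‖(2 : ℝ) ^ k • e‖ₑ := by
    rw [← ofReal_norm, ENNReal.one_le_ofReal]; exact h1
  have h3 := bracket_rpow_le_of_one_le h2 (γ₀ / p₀)
  have h4 := hlow _ h1
  rw [hek, ← ENNReal.rpow_mul] at h3 h4
  calc 2 ^ ((k : ℝ) * (γ₁ / p₁)) * c = c * 2 ^ ((k : ℝ) * (γ₁ / p₁)) := mul_comm _ _
    _ ≤ C * (K * (2 ^ |γ₀ / p₀| * 2 ^ ((k : ℝ) * (γ₀ / p₀)))) :=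
        h4.trans (hk.trans (mul_le_mul' le_rfl ((hup _).trans (mul_le_mul' le_rfl h3))))
    _ = _ := by ring

/-- Tested on `2^m` pieces in different annuli, normalized to a common modulus. Both norms are the
same multiple of `2^{m/q}` with the respective `q`, and `m → ∞` compares the exponents. -/
theorem TLEmbedding.exponent_le {s p γ : ℝ} (hd : 1 ≤ d) (hφ : IsDyadicResolution φ) (hp : 0 < p)
    (hq₀ : 1 ≤ q₀) (hq₁ : 1 ≤ q₁) (hγ : -(d : ℝ) < γ)
    (h : TLEmbedding X φ s p q₀ (powerWeight d γ) s p q₁ (powerWeight d γ)) : q₀ ≤ q₁ := by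
  obtain ⟨C, hC⟩ := h.2
  obtain ⟨v, hv⟩ := exists_ne (0 : X)
  have hv0 : ‖v‖ₑ ≠ 0 := by simpa using hv
  obtain ⟨θ, hθ, hnorm, hθ0⟩ := exists_spectrumInAnnulus hd
  have hH0 := powerNorm_ne_zero hd hp γ hθ0
  have hH1 := powerNorm_ne_top hd hp hγ (θ 0)
  set H := powerNorm p γ (fun x => ‖θ 0 x‖ₑ)
  have hq₀' : q₀ ≠ 0 := (one_pos.trans_le hq₀).ne'
  have hq₁' : q₁ ≠ 0 := (one_pos.trans_le hq₁).ne'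
  let η : ℕ → 𝓢(Rd d, ℂ) := fun k => (((2 : ℝ) ^ (-((k : ℝ) * s)) : ℝ) : ℂ) • θ k
  have hη : ∀ k, SpectrumInAnnulus k (η k) := fun k => (hθ k).smul _
  have hg : ∀ (k : ℕ) x, 2 ^ ((k : ℝ) * s) * ‖η k x‖ₑ = ‖θ 0 x‖ₑ := by
    intro k x
    have : η k x = (2 : ℝ) ^ (-((k : ℝ) * s)) • θ k x := by
      simp [η]
    rw [this, enorm_two_rpow_smul, ← mul_assoc, ← two_rpow_add, add_neg_cancel,
      ENNReal.rpow_zero, one_mul, hnorm]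
  have htl : ∀ {q : ℝ≥0∞}, q ≠ 0 → ∀ m : ℕ, tlNorm φ s p q (powerWeight d γ)
      (tensorDistribution (∑ k ∈ Finset.range (2 ^ m), η k) v) =
      ‖v‖ₑ * (2 ^ ((m : ℝ) * (1 / q.toReal)) * H) := by
    intro q hq m
    rw [hφ.tlNorm_tensorDistribution_sum hd (Finset.nonempty_range_iff.2 (by positivity))
      (fun k _ => hη k) hp hq γ (fun k _ => hg k) v, Finset.card_range, Nat.cast_pow,
      Nat.cast_ofNat, ← ENNReal.rpow_natCast, ← ENNReal.rpow_mul, mul_assoc]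
  have hle : 1 / q₁.toReal ≤ 1 / q₀.toReal := by
    refine le_of_two_rpow_mul_le hH0 (B := C * H) (ENNReal.mul_ne_top ENNReal.coe_ne_top hH1)
      fun m => ?_
    have hmem : tensorDistribution (∑ k ∈ Finset.range (2 ^ m), η k) v ∈
        tlSpace X φ s p q₀ (powerWeight d γ) := by
      change tlNorm _ _ _ _ _ _ < ∞
      rw [htl hq₀']
      exact ENNReal.mul_lt_top enorm_lt_top (ENNReal.mul_lt_top (two_rpow_ne_top _).lt_top
        hH1.lt_top)
    have := hC _ hmem
    rw [htl hq₀', htl hq₁', mul_left_comm (C : ℝ≥0∞),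
      ENNReal.mul_le_mul_iff_right hv0 enorm_ne_top, mul_left_comm (C : ℝ≥0∞)] at this
    exact this
  -- Passing to inverses in `ℝ≥0∞` treats the values `q = ∞` together with the finite ones.
  rw [one_div, one_div, ← ENNReal.toReal_inv, ← ENNReal.toReal_inv,
    ENNReal.toReal_le_toReal (ENNReal.inv_ne_top.2 hq₁') (ENNReal.inv_ne_top.2 hq₀'),
    ENNReal.inv_le_inv] at hle
  exact hle

end Necessity

end WeightedTL

end

theorem theorem1p2 {d : ℕ} (hd : 1 ≤ d)
    {X : Type*} [NormedAddCommGroup X] [NormedSpace ℂ X] [CompleteSpace X] [Nontrivial X]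
    (φ : ℕ → 𝓢(WeightedTL.Rd d, ℂ)) (hφ : WeightedTL.IsDyadicResolution φ)
    (p₀ p₁ : ℝ) (hp₀ : 1 < p₀) (hp : p₀ ≤ p₁)
    (q₀ q₁ : ℝ≥0∞) (hq₀ : 1 ≤ q₀) (hq₁ : 1 ≤ q₁)
    (s₀ s₁ γ₀ γ₁ : ℝ) (hγ₀ : -(d : ℝ) < γ₀) (hγ₁ : -(d : ℝ) < γ₁) :
    WeightedTL.TLEmbedding X φ s₀ p₀ q₀ (WeightedTL.powerWeight d γ₀)
        s₁ p₁ q₁ (WeightedTL.powerWeight d γ₁) ↔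
      (γ₀ = γ₁ ∧ p₀ = p₁ ∧ (s₁ < s₀ ∨ (s₀ = s₁ ∧ q₀ ≤ q₁))) ∨
      (γ₁ / p₁ ≤ γ₀ / p₀ ∧ ((d : ℝ) + γ₁) / p₁ < ((d : ℝ) + γ₀) / p₀ ∧
        s₁ - ((d : ℝ) + γ₁) / p₁ ≤ s₀ - ((d : ℝ) + γ₀) / p₀) := by
  have hp₀0 : 0 < p₀ := by linarith
  have hp₁0 : 0 < p₁ := by linarith
  have hq₀' : q₀ ≠ 0 := (one_pos.trans_le hq₀).ne'
  have hq₁' : q₁ ≠ 0 := (one_pos.trans_le hq₁).ne'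
  constructor
  · intro h
    have hs := h.smoothness_le hd hφ hp₀0 hp₁0 hq₀' hq₁' hγ₀
    have hγ := h.weight_le hd hφ hp₀0 hp₁0 hq₀' hq₁' hγ₀
    by_cases hδ : ((d : ℝ) + γ₁) / p₁ < ((d : ℝ) + γ₀) / p₀
    · exact Or.inr ⟨hγ, hδ, hs⟩
    left
    have hd0 : (0 : ℝ) < d := by exact_mod_cast hd
    -- If the strict inequality fails, subtracting `γ₁/p₁ ≤ γ₀/p₀` leaves `d/p₀ ≤ d/p₁`, hence `p₁ ≤
    -- p₀`. With equal integrability, the same two inequalities force `γ₀ = γ₁`.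
    have hpp : p₀ = p₁ := by
      refine le_antisymm hp ?_
      rw [not_lt, add_div, add_div] at hδ
      have : (d : ℝ) / p₀ ≤ d / p₁ := by linarith
      rwa [div_le_div_iff_of_pos_left hd0 hp₀0 hp₁0] at this
    subst hpp
    rw [not_lt, div_le_div_iff_of_pos_right hp₀0] at hδ
    rw [div_le_div_iff_of_pos_right hp₀0] at hγ
    obtain rfl : γ₀ = γ₁ := by linarith
    refine ⟨rfl, rfl, ?_⟩
    rcases lt_or_ge s₁ s₀ with hlt | hge
    · exact Or.inl hlt
    · obtain rfl : s₀ = s₁ := by linarith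
      exact Or.inr ⟨rfl, h.exponent_le hd hφ hp₀0 hq₀ hq₁ hγ₀⟩
  · rintro (⟨rfl, rfl, hs | ⟨rfl, hq⟩⟩ | ⟨hγ, hδ, hs⟩)
    · exact WeightedTL.tlEmbedding_of_smoothness_lt φ hs p₀ hq₀ hq₁ _
    · exact WeightedTL.tlEmbedding_of_exponent_le φ s₀ p₀ hq₀ hq _
    · exact hφ.tlEmbedding_sobolev hd hp₀ hp hq₀ hq₁ hγ₁ hγ hδ hs
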